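/- Conventions. For an integer $n\ge 1$ let $[n]_\Lambda$ be the category whose objects are the residues $y\in\mathbb{Z}/n\mathbb{Z}$, whose morphisms $y\to y'$ are the integers $a\ge 0$ with $y+a=y'$ modulo $n$, and whose composition is addition; let $\tau_y:y\to y$ be the endomorphism $a=n$. A functor $f:[n]_\Lambda\to[m]_\Lambda$ has degree $d$ if $f(\tau_y)=\tau_{f(y)}^{d}$ for all $y$; it is horizontal if it has degree $1$, and vertical if it is a discrete bifibration. Connes' cyclic category $\Lambda$ has objects $[n]$, $n\ge1$, and morphisms $[n]\to[m]$ the horizontal functors $[n]_\Lambda\to[m]_\Lambda$. For $l\ge1$, let $\Lambda_l$ be the category of vertical functors $v:[n']_\Lambda\to[n]_\Lambda$ of degree $l$, with morphisms from $v$ to $w$ the commutative squares $g\circ v=w\circ f$ with $f,g$ horizontal; let $i_l,\pi_l:\Lambda_l\to\Lambda$ send $v:[n']_\Lambda\to[n]_\Lambda$ to $[n']$ and to $[n]$ respectively. Denote by $[n]\in\Lambda_l$ the object given by the reduction $[nl]_\Lambda\to[n]_\Lambda$, so that $i_l([n])=[nl]$ and $\pi_l([n])=[n]$. Let $\mathsf{pt}_n$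 be the groupoid with one object with automorphism group $\mathbb{Z}/n\mathbb{Z}$, let $e^n:\mathsf{pt}_n\to\Lambda$ be the embedding onto $[n]$ given by $\mathrm{Aut}([n])=\mathbb{Z}/n\mathbb{Z}$, and let $e^n_l:\mathsf{pt}_{nl}\to\Lambda_l$ be the embedding onto $[n]\in\Lambda_l$ given by $\mathrm{Aut}([n])=\mathbb{Z}/nl\mathbb{Z}$; then $i_l\circ e^n_l=e^{nl}$. For a ring $A$ and a small category $I$ let $\mathrm{Fun}(I,A)$ be the category of functors from $I$ to left $A$-modules. For a functor $\gamma:I\to I'$ between small categories let $\gamma^*:\mathrm{Fun}(I',A)\to\mathrm{Fun}(I,A)$ be the pullback and $\gamma_!$ its left adjoint, the (underived) left Kan extension. Let $H_i(I,-)$, $i\ge 0$, be the left derived functors of $\mathrm{colim}:\mathrm{Fun}(I,A)\to A\text{-mod}$. Let $\Delta$ be the category of finite non-empty ordinals and let $j^o:\Delta^{o}\to\Lambda$ be the standard embedding: it sends $\{0,\dots,k\}$ to $[k+1]$, and a monotone map $\{0,\dots,k\}\to\{0,\dots,k'\}$ to the morphism $[k'+1]\to[k+1]$ induced by $y\mapsto\min\{x\in\mathbb{Z}\mid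 \tilde f(x)\ge y\}$, where $\tilde f:\mathbb{Z}\to\mathbb{Z}$ is the extension of the given map that satisfies $\tilde f(x+k+1)=\tilde f(x)+k'+1$. For $E\in\mathrm{Fun}(\Lambda,A)$ set $HH_i(E)=H_i(\Delta^{o},j^{o*}E)$. Proposition. Let $A$ be a ring, let $n,l\ge1$ be integers, and let $M$ be an $A[\mathbb{Z}/nl\mathbb{Z}]$-module, viewed as an object of $\mathrm{Fun}(\mathsf{pt}_{nl},A)$. Let $$e^n_{l!}M\longrightarrow i_l^*e^{nl}_!M$$ be the natural map adjoint to the adjunction unit $M\to e^{nl*}e^{nl}_!M=e^{n*}_l i_l^*e^{nl}_!M$. Then for every $i\ge0$ the induced map $$HH_i(\pi_{l!}e^n_{l!}M)\longrightarrow HH_i(\pi_{l!}i_l^*e^{nl}_!M)$$ is an isomorphism. -/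

import Mathlib

open CategoryTheory CategoryTheory.Limits Opposite

universe u

namespace HochschildWitt

/-! ### The categories `[n]_Λ` -/

/-- The category `[n]_Λ`: its objects are the residues `y ∈ ℤ/n`, its morphisms `y ⟶ y'` are the
integers `a ≥ 0` such that `y + a = y'` modulo `n`, and composition is addition. -/
@[ext] structure Wheel (n : ℕ+) : Type where
  /-- The residue underlying an object of `[n]_Λ`. -/
  res : ZMod (n : ℕ)

namespace Wheel

instance (n : ℕ+) : SmallCategory (Wheel n) where
  Hom y y' := {a : ℕ // y.res + (a : ZMod (n : ℕ)) = y'.res}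
  id y := ⟨0, by simp⟩
  comp f g := ⟨f.1 + g.1, by rw [Nat.cast_add, ← add_assoc, f.2, g.2]⟩
  id_comp f := Subtype.ext (Nat.zero_add _)
  comp_id f := Subtype.ext (Nat.add_zero _)
  assoc f g h := Subtype.ext (Nat.add_assoc _ _ _)

/-- The length `a` of a morphism `y ⟶ y'` of `[n]_Λ`. -/
def len {n : ℕ+} {y y' : Wheel n} (f : y ⟶ y') : ℕ := f.1

theorem len_cond {n : ℕ+} {y y' : Wheel n} (f : y ⟶ y') :
    y.res + (len f : ZMod (n : ℕ)) = y'.res := f.2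

/-- The morphism `y ⟶ y'` of length `a`. -/
def homMk {n : ℕ+} {y y' : Wheel n} (a : ℕ) (h : y.res + (a : ZMod (n : ℕ)) = y'.res) :
    y ⟶ y' := ⟨a, h⟩

@[simp] theorem len_homMk {n : ℕ+} {y y' : Wheel n} (a : ℕ)
    (h : y.res + (a : ZMod (n : ℕ)) = y'.res) : len (homMk a h) = a := rfl

@[simp] theorem len_id {n : ℕ+} (y : Wheel n) : len (𝟙 y) = 0 := rfl

@[simp] theorem len_comp {n : ℕ+} {y y' y'' : Wheel n} (f : y ⟶ y') (g : y' ⟶ y'') :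
    len (f ≫ g) = len f + len g := rfl

@[ext] theorem hom_ext {n : ℕ+} {y y' : Wheel n} {f g : y ⟶ y'} (h : len f = len g) : f = g :=
  Subtype.ext h

theorem len_eqToHom {n : ℕ+} {y y' : Wheel n} (h : y = y') : len (eqToHom h) = 0 := by
  subst h; rfl

theorem functor_ext {n m : ℕ+} {F G : Wheel n ⥤ Wheel m} (h : ∀ y, F.obj y = G.obj y)
    (h' : ∀ (y y' : Wheel n) (f : y ⟶ y'), len (F.map f) = len (G.map f)) : F = G :=
  CategoryTheory.Functor.ext h (fun y y' f => by
    apply hom_ext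
    simp [len_eqToHom, h'])

/-- The endomorphism `τ_y` of an object `y` of `[n]_Λ`, of length `n`. -/
def tau {n : ℕ+} (y : Wheel n) : End y := homMk (n : ℕ) (by simp)

theorem len_tau_pow {n : ℕ+} (y : Wheel n) (d : ℕ) :
    len (show y ⟶ y from tau y ^ d) = d * (n : ℕ) := by
  induction d with
  | zero => simp [End.one_def]
  | succ d ih =>
    rw [pow_succ, End.mul_def, len_comp, ih, add_mul, add_comm, one_mul]
    rfl

/-- A functor `F : [n]_Λ ⥤ [m]_Λ` has degree `d` if `F(τ_y) = τ_{F(y)} ^ d` for every `y`. -/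
def HasDegree {n m : ℕ+} (F : Wheel n ⥤ Wheel m) (d : ℕ) : Prop :=
  ∀ y : Wheel n, F.map (tau y) = tau (F.obj y) ^ d

/-- A functor is horizontal if it has degree `1`. -/
def IsHorizontal {n m : ℕ+} (F : Wheel n ⥤ Wheel m) : Prop := HasDegree F 1

theorem hasDegree_iff {n m : ℕ+} (F : Wheel n ⥤ Wheel m) (d : ℕ) :
    HasDegree F d ↔ ∀ y : Wheel n, len (F.map (tau y)) = d * (m : ℕ) := by
  refine forall_congr' fun y => ⟨fun h => ?_, fun h => ?_⟩
  · rw [h]; exact len_tau_pow _ _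
  · exact hom_ext (h.trans (len_tau_pow _ _).symm)

theorem isHorizontal_id (n : ℕ+) : IsHorizontal (𝟭 (Wheel n)) := fun y => (pow_one (tau y)).symm

theorem IsHorizontal.comp {n m k : ℕ+} {F : Wheel n ⥤ Wheel m} {G : Wheel m ⥤ Wheel k}
    (hF : IsHorizontal F) (hG : IsHorizontal G) : IsHorizontal (F ⋙ G) := fun y => by
  rw [Functor.comp_map, hF y, pow_one, hG (F.obj y)]
  rfl

/-- A functor is a discrete bifibration if morphisms of the target lift uniquely, both with
prescribed source and with prescribed target. -/
def IsDiscreteBifibration {C D : Type} [SmallCategory C] [SmallCategory D] (F : C ⥤ D) : Prop :=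
  (∀ (c : C) (d : D) (g : F.obj c ⟶ d),
    ∃! p : (Σ c' : C, c ⟶ c'), (⟨F.obj p.1, F.map p.2⟩ : Σ d' : D, F.obj c ⟶ d') = ⟨d, g⟩) ∧
  (∀ (c : C) (d : D) (g : d ⟶ F.obj c),
    ∃! p : (Σ c' : C, c' ⟶ c), (⟨F.obj p.1, F.map p.2⟩ : Σ d' : D, d' ⟶ F.obj c) = ⟨d, g⟩)

/-- A functor `[n]_Λ ⥤ [m]_Λ` is vertical if it is a discrete bifibration. -/
def IsVertical {n m : ℕ+} (F : Wheel n ⥤ Wheel m) : Prop := IsDiscreteBifibration F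

/-- The automorphism `y ↦ y + a` of `[n]_Λ` given by a residue `a ∈ ℤ/n`. -/
def rot (n : ℕ+) (a : ZMod (n : ℕ)) : Wheel n ⥤ Wheel n where
  obj y := ⟨y.res + a⟩
  map f := homMk (len f) (by
    rw [← len_cond f]
    ring)
  map_id _ := rfl
  map_comp _ _ := rfl

theorem rot_isHorizontal (n : ℕ+) (a : ZMod (n : ℕ)) : IsHorizontal (rot n a) :=
  (hasDegree_iff _ _).2 fun _ => (one_mul _).symm

theorem rot_zero (n : ℕ+) : rot n 0 = 𝟭 (Wheel n) :=
  functor_ext (fun y => Wheel.ext (add_zero y.res)) (fun _ _ _ => rfl)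

theorem rot_comp (n : ℕ+) (a b : ZMod (n : ℕ)) : rot n a ⋙ rot n b = rot n (b + a) :=
  functor_ext (fun y => Wheel.ext (by
    change y.res + a + b = y.res + (b + a)
    ring)) (fun _ _ _ => rfl)

/-- The reduction of residues `ℤ/nl → ℤ/n`. -/
def reduce (n l : ℕ+) : ZMod ((n * l : ℕ+) : ℕ) →+* ZMod (n : ℕ) :=
  ZMod.castHom ⟨(l : ℕ), PNat.mul_coe n l⟩ (ZMod (n : ℕ))

/-- The projection `[nl]_Λ ⥤ [n]_Λ` given by reduction of residues. -/
def proj (n l : ℕ+) : Wheel (n * l) ⥤ Wheel n where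
  obj y := ⟨reduce n l y.res⟩
  map f := homMk (len f) (by
    have := congrArg (reduce n l) (len_cond f)
    rwa [map_add, map_natCast] at this)
  map_id _ := rfl
  map_comp _ _ := rfl

theorem proj_hasDegree (n l : ℕ+) : HasDegree (proj n l) (l : ℕ) :=
  (hasDegree_iff _ _).2 fun _ => (PNat.mul_coe n l).trans (mul_comm _ _)

theorem sigma_out_ext {n : ℕ+} {y : Wheel n} {p q : Σ y' : Wheel n, y ⟶ y'}
    (h : len p.2 = len q.2) : p = q := by
  obtain ⟨p, f⟩ := p
  obtain ⟨q, g⟩ := q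
  have hpq : p = q := by
    have hf := len_cond f
    have hg := len_cond g
    rw [show len f = len g from h] at hf
    exact Wheel.ext (hf.symm.trans hg)
  subst hpq
  rw [hom_ext (f := f) (g := g) h]

theorem sigma_in_ext {n : ℕ+} {y : Wheel n} {p q : Σ y' : Wheel n, y' ⟶ y}
    (h : len p.2 = len q.2) : p = q := by
  obtain ⟨p, f⟩ := p
  obtain ⟨q, g⟩ := q
  have hpq : p = q := by
    have hf := len_cond f
    have hg := len_cond g
    rw [show len f = len g from h] at hf
    exact Wheel.ext (add_right_cancel (hf.trans hg.symm))
  subst hpq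
  rw [hom_ext (f := f) (g := g) h]

theorem proj_isVertical (n l : ℕ+) : IsVertical (proj n l) := by
  constructor
  · intro y d g
    refine ⟨⟨⟨y.res + (len g : ZMod _)⟩, homMk (len g) rfl⟩,
      sigma_out_ext (p := ⟨_, (proj n l).map _⟩) rfl, ?_⟩
    intro p hp
    apply sigma_out_ext
    exact congrArg (fun q : (Σ d' : Wheel n, (proj n l).obj y ⟶ d') => len q.2) hp
  · intro y d g
    refine ⟨⟨⟨y.res - (len g : ZMod _)⟩, homMk (len g) (sub_add_cancel _ _)⟩,
      sigma_in_ext (p := ⟨_, (proj n l).map _⟩) rfl, ?_⟩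
    intro p hp
    apply sigma_in_ext
    exact congrArg (fun q : (Σ d' : Wheel n, d' ⟶ (proj n l).obj y) => len q.2) hp

theorem rot_comp_proj (n l : ℕ+) (a : ZMod ((n * l : ℕ+) : ℕ)) :
    rot (n * l) a ⋙ proj n l = proj n l ⋙ rot n (reduce n l a) :=
  functor_ext (fun y => Wheel.ext (map_add (reduce n l) y.res a)) (fun _ _ _ => rfl)

end Wheel

/-! ### The cyclic category `Λ` and the categories `Λ_l` -/

/-- Objects `[n]`, `n ≥ 1`, of the cyclic category `Λ`. -/
structure Cyclic : Type where
  /-- The integer `n`. -/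
  size : ℕ+

/-- Morphisms `[n] ⟶ [m]` in `Λ` are the horizontal functors `[n]_Λ ⥤ [m]_Λ`. -/
instance : SmallCategory Cyclic where
  Hom X Y := {F : Wheel X.size ⥤ Wheel Y.size // Wheel.IsHorizontal F}
  id _ := ⟨𝟭 _, Wheel.isHorizontal_id _⟩
  comp f g := ⟨f.1 ⋙ g.1, f.2.comp g.2⟩
  id_comp _ := rfl
  comp_id _ := rfl
  assoc _ _ _ := rfl

/-- Objects of `Λ_l`: the vertical functors `v : [n']_Λ ⥤ [n]_Λ` of degree `l`. -/
structure CyclicL (l : ℕ+) : Type where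
  /-- The source `[n']` of `v`. -/
  src : Cyclic
  /-- The target `[n]` of `v`. -/
  tgt : Cyclic
  /-- The functor `v`. -/
  v : Wheel src.size ⥤ Wheel tgt.size
  vertical : Wheel.IsVertical v
  degree : Wheel.HasDegree v (l : ℕ)

/-- A morphism in `Λ_l` from `v` to `w`: a commutative square with horizontal `f` and `g`. -/
@[ext] structure CyclicL.Hom {l : ℕ+} (X Y : CyclicL l) : Type where
  /-- The morphism of sources. -/
  f : X.src ⟶ Y.src
  /-- The morphism of targets. -/
  g : X.tgt ⟶ Y.tgt
  comm : X.v ⋙ g.1 = f.1 ⋙ Y.v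

instance (l : ℕ+) : SmallCategory (CyclicL l) where
  Hom X Y := CyclicL.Hom X Y
  id X := ⟨𝟙 _, 𝟙 _, rfl⟩
  comp {X Y Z} a b := ⟨a.f ≫ b.f, a.g ≫ b.g, by
    change (X.v ⋙ a.g.1) ⋙ b.g.1 = a.f.1 ⋙ (b.f.1 ⋙ Z.v)
    rw [a.comm, ← b.comm]
    rfl⟩
  id_comp _ := rfl
  comp_id _ := rfl
  assoc _ _ _ := rfl

/-- The functor `i_l : Λ_l ⥤ Λ` sending `v : [n'] → [n]` to its source `[n']`. -/
def iL (l : ℕ+) : CyclicL l ⥤ Cyclic where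
  obj X := X.src
  map a := a.f

/-- The functor `π_l : Λ_l ⥤ Λ` sending `v : [n'] → [n]` to its target `[n]`. -/
def piL (l : ℕ+) : CyclicL l ⥤ Cyclic where
  obj X := X.tgt
  map a := a.g

/-! ### The functors `e^n` and `e^n_l` -/

/-- The group `ℤ/n`, written multiplicatively. -/
abbrev CyclicGroup (n : ℕ+) : Type := Multiplicative (ZMod (n : ℕ))

/-- The embedding `e^n : pt_n ⥤ Λ` onto `[n]`, under `Aut([n]) = ℤ/n`. -/
def e (n : ℕ+) : SingleObj (CyclicGroup n) ⥤ Cyclic where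
  obj _ := ⟨n⟩
  map a := ⟨Wheel.rot n (Multiplicative.toAdd a), Wheel.rot_isHorizontal _ _⟩
  map_id _ := Subtype.ext (Wheel.rot_zero n)
  map_comp a b := Subtype.ext (Wheel.rot_comp n (Multiplicative.toAdd a)
    (Multiplicative.toAdd b)).symm

/-- The object `[n]` of `Λ_l`, represented by the reduction `[nl]_Λ ⥤ [n]_Λ`. -/
def CyclicL.of (l n : ℕ+) : CyclicL l where
  src := ⟨n * l⟩
  tgt := ⟨n⟩
  v := Wheel.proj n l
  vertical := Wheel.proj_isVertical n l
  degree := Wheel.proj_hasDegree n l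

/-- The embedding `e^n_l : pt_{nl} ⥤ Λ_l` onto `[n]`, under `Aut([n]) = ℤ/nl`. -/
def eL (n l : ℕ+) : SingleObj (CyclicGroup (n * l)) ⥤ CyclicL l where
  obj _ := CyclicL.of l n
  map a :=
    { f := (e (n * l)).map a
      g := ⟨Wheel.rot n (Wheel.reduce n l (Multiplicative.toAdd a)), Wheel.rot_isHorizontal _ _⟩
      comm := (Wheel.rot_comp_proj n l (Multiplicative.toAdd a)).symm }
  map_id X := CyclicL.Hom.ext ((e (n * l)).map_id X) (Subtype.ext (by
    change Wheel.rot n (Wheel.reduce n l 0) = _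
    rw [map_zero]
    exact Wheel.rot_zero n))
  map_comp a b := CyclicL.Hom.ext ((e (n * l)).map_comp a b) (Subtype.ext (by
    change Wheel.rot n (Wheel.reduce n l
      ((show CyclicGroup (n * l) from b).toAdd + (show CyclicGroup (n * l) from a).toAdd)) = _
    rw [map_add]
    exact (Wheel.rot_comp n _ _).symm))

/-- `i_l ∘ e^n_l = e^{nl}`. -/
def eLCompIL (n l : ℕ+) : eL n l ⋙ iL l ≅ e (n * l) :=
  NatIso.ofComponents (fun _ => Iso.refl _) (fun a => by
    change (e (n * l)).map a ≫ 𝟙 _ = 𝟙 _ ≫ (e (n * l)).map a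
    rw [Category.comp_id, Category.id_comp])

/-! ### The embedding `j^o : Δ^o ⥤ Λ` -/

/-- Monotone maps `φ : ℤ → ℤ` with `φ (x + n) = φ x + m`. Each of them describes a horizontal
functor `[n]_Λ ⥤ [m]_Λ`. -/
@[ext] structure PeriodicMap (n m : ℕ+) : Type where
  /-- The underlying map. -/
  toFun : ℤ → ℤ
  mono : Monotone toFun
  period : ∀ x : ℤ, toFun (x + ((n : ℕ) : ℤ)) = toFun x + ((m : ℕ) : ℤ)

namespace PeriodicMap

/-- The identity. -/
def id (n : ℕ+) : PeriodicMap n n := ⟨fun x => x, monotone_id, fun _ => rfl⟩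

/-- The composition, first `φ`, then `ψ`. -/
def comp {n m k : ℕ+} (φ : PeriodicMap n m) (ψ : PeriodicMap m k) : PeriodicMap n k where
  toFun x := ψ.toFun (φ.toFun x)
  mono := ψ.mono.comp φ.mono
  period x := by rw [φ.period, ψ.period]

theorem period_mul {n m : ℕ+} (φ : PeriodicMap n m) (x k : ℤ) :
    φ.toFun (x + k * ((n : ℕ) : ℤ)) = φ.toFun x + k * ((m : ℕ) : ℤ) := by
  induction k using Int.induction_on with
  | zero => simp
  | succ i ih =>
    have h := φ.period (x + (i : ℤ) * ((n : ℕ) : ℤ))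
    rw [ih] at h
    rw [show x + ((i : ℤ) + 1) * ((n : ℕ) : ℤ) = x + (i : ℤ) * ((n : ℕ) : ℤ) + ((n : ℕ) : ℤ) by ring,
      h]
    ring
  | pred i ih =>
    have h := φ.period (x + (-(i : ℤ) - 1) * ((n : ℕ) : ℤ))
    rw [show x + (-(i : ℤ) - 1) * ((n : ℕ) : ℤ) + ((n : ℕ) : ℤ) = x + -(i : ℤ) * ((n : ℕ) : ℤ) by ring,
      ih] at h
    linarith

/-- The increment of `φ` over an interval depends only on residues. -/
theorem exists_shift {n m : ℕ+} (φ : PeriodicMap n m) {x x' : ℤ}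
    (h : (x : ZMod (n : ℕ)) = (x' : ZMod (n : ℕ))) :
    ∃ k : ℤ, x' = x + k * ((n : ℕ) : ℤ) ∧
      ∀ a : ℤ, φ.toFun (x' + a) = φ.toFun (x + a) + k * ((m : ℕ) : ℤ) := by
  obtain ⟨k, hk⟩ := (ZMod.intCast_eq_intCast_iff_dvd_sub x x' (n : ℕ)).1 h
  refine ⟨k, by linarith, fun a => ?_⟩
  rw [← φ.period_mul]
  congr 1
  linarith

theorem intCast_cast {n : ℕ+} (y : ZMod (n : ℕ)) : ((y.val : ℤ) : ZMod (n : ℕ)) = y := by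
  rw [Int.cast_natCast, ZMod.natCast_zmod_val]

theorem increment_nonneg {n m : ℕ+} (φ : PeriodicMap n m) (x : ℤ) (a : ℕ) :
    0 ≤ φ.toFun (x + a) - φ.toFun x :=
  sub_nonneg.2 (φ.mono (by linarith [Int.natCast_nonneg a]))

/-- The horizontal functor `[n]_Λ ⥤ [m]_Λ` described by `φ`. -/
def toFunctor {n m : ℕ+} (φ : PeriodicMap n m) : Wheel n ⥤ Wheel m where
  obj y := ⟨((φ.toFun (y.res.val : ℤ) : ℤ) : ZMod (m : ℕ))⟩
  map {y y'} f := Wheel.homMk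
    (φ.toFun ((y.res.val : ℤ) + (Wheel.len f : ℤ)) - φ.toFun (y.res.val : ℤ)).toNat (by
      have h : ((((y.res.val : ℤ) + (Wheel.len f : ℤ) : ℤ)) : ZMod (n : ℕ)) =
          ((y'.res.val : ℤ) : ZMod (n : ℕ)) := by
        rw [Int.cast_add, intCast_cast, intCast_cast, Int.cast_natCast]
        exact Wheel.len_cond f
      obtain ⟨k, -, hk⟩ := φ.exists_shift h
      have hk0 := hk 0
      rw [add_zero, add_zero] at hk0
      change ((φ.toFun (y.res.val : ℤ) : ℤ) : ZMod (m : ℕ)) + _ =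
        ((φ.toFun (y'.res.val : ℤ) : ℤ) : ZMod (m : ℕ))
      rw [hk0, ← Int.cast_natCast (R := ZMod (m : ℕ)), Int.toNat_of_nonneg (φ.increment_nonneg _ _)]
      push_cast
      simp)
  map_id y := by
    apply Wheel.hom_ext
    simp
  map_comp {y y' y''} f g := by
    apply Wheel.hom_ext
    have h : ((((y.res.val : ℤ) + (Wheel.len f : ℤ) : ℤ)) : ZMod (n : ℕ)) =
        ((y'.res.val : ℤ) : ZMod (n : ℕ)) := by
      rw [Int.cast_add, intCast_cast, intCast_cast, Int.cast_natCast]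
      exact Wheel.len_cond f
    obtain ⟨k, -, hk⟩ := φ.exists_shift h
    have hk0 := hk 0
    have hk1 := hk (Wheel.len g : ℤ)
    rw [add_zero, add_zero] at hk0
    have e1 := φ.increment_nonneg (y.res.val : ℤ) (Wheel.len f)
    have e2 := φ.increment_nonneg (y'.res.val : ℤ) (Wheel.len g)
    simp only [Wheel.len_homMk, Wheel.len_comp]
    zify
    rw [Int.toNat_of_nonneg e1, Int.toNat_of_nonneg e2, Int.toNat_of_nonneg, hk0, hk1, ← add_assoc]
    · ring
    · rw [← add_assoc]
      rw [hk0, hk1] at e2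
      linarith

theorem toFunctor_isHorizontal {n m : ℕ+} (φ : PeriodicMap n m) :
    Wheel.IsHorizontal φ.toFunctor := by
  refine (Wheel.hasDegree_iff _ _).2 fun y => ?_
  change (φ.toFun ((y.res.val : ℤ) + ((n : ℕ) : ℤ)) - φ.toFun (y.res.val : ℤ)).toNat = _
  rw [φ.period]
  simp

theorem toFunctor_id (n : ℕ+) : (id n).toFunctor = 𝟭 (Wheel n) :=
  Wheel.functor_ext (fun y => Wheel.ext (intCast_cast y.res)) (fun y y' f => by
    change (((y.res.val : ℤ) + (Wheel.len f : ℤ)) - (y.res.val : ℤ)).toNat = Wheel.len f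
    simp)

theorem toFunctor_comp {n m k : ℕ+} (φ : PeriodicMap n m) (ψ : PeriodicMap m k) :
    (φ.comp ψ).toFunctor = φ.toFunctor ⋙ ψ.toFunctor := by
  have key (y : Wheel n) : ((φ.toFun (y.res.val : ℤ) : ℤ) : ZMod (m : ℕ)) =
      (((φ.toFunctor.obj y).res.val : ℤ) : ZMod (m : ℕ)) := (intCast_cast _).symm
  refine Wheel.functor_ext (fun y => Wheel.ext ?_) (fun y y' f => ?_)
  · obtain ⟨c, -, hc⟩ := ψ.exists_shift (key y)
    have hc0 := hc 0
    rw [add_zero, add_zero] at hc0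
    change ((ψ.toFun (φ.toFun (y.res.val : ℤ)) : ℤ) : ZMod (k : ℕ)) =
      ((ψ.toFun ((φ.toFunctor.obj y).res.val : ℤ) : ℤ) : ZMod (k : ℕ))
    rw [hc0]
    push_cast
    simp
  · obtain ⟨c, -, hc⟩ := ψ.exists_shift (key y)
    have hc0 := hc 0
    have hc1 := hc (φ.toFun ((y.res.val : ℤ) + (Wheel.len f : ℤ)) - φ.toFun (y.res.val : ℤ))
    rw [add_zero, add_zero] at hc0
    change (ψ.toFun (φ.toFun ((y.res.val : ℤ) + (Wheel.len f : ℤ))) -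
        ψ.toFun (φ.toFun (y.res.val : ℤ))).toNat =
      (ψ.toFun (((φ.toFunctor.obj y).res.val : ℤ) +
        ((φ.toFun ((y.res.val : ℤ) + (Wheel.len f : ℤ)) - φ.toFun (y.res.val : ℤ)).toNat : ℤ)) -
        ψ.toFun ((φ.toFunctor.obj y).res.val : ℤ)).toNat
    rw [Int.toNat_of_nonneg (φ.increment_nonneg _ _), hc0, hc1]
    congr 1
    rw [add_sub_cancel]
    ring

/-- The set whose minimum is `f_♯(y)`. -/
def above {n m : ℕ+} (φ : PeriodicMap n m) (y : ℤ) : Set ℤ := {x : ℤ | y ≤ φ.toFun x}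

theorem above_nonempty {n m : ℕ+} (φ : PeriodicMap n m) (y : ℤ) : (φ.above y).Nonempty := by
  refine ⟨0 + |y - φ.toFun 0| * ((n : ℕ) : ℤ), ?_⟩
  change y ≤ _
  rw [φ.period_mul]
  have hm : (1 : ℤ) ≤ ((m : ℕ) : ℤ) := by exact_mod_cast m.2
  nlinarith [le_abs_self (y - φ.toFun 0), abs_nonneg (y - φ.toFun 0)]

theorem above_bddBelow {n m : ℕ+} (φ : PeriodicMap n m) (y : ℤ) : BddBelow (φ.above y) := by
  refine ⟨0 + (-(|y - φ.toFun 0| + 1)) * ((n : ℕ) : ℤ), fun x hx => ?_⟩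
  by_contra hlt
  have h1 := φ.mono (le_of_lt (not_le.1 hlt))
  rw [φ.period_mul] at h1
  have hm : (1 : ℤ) ≤ ((m : ℕ) : ℤ) := by exact_mod_cast m.2
  have hx' : y ≤ φ.toFun x := hx
  nlinarith [neg_abs_le (y - φ.toFun 0), abs_nonneg (y - φ.toFun 0)]

/-- The map `f_♯(y) = min {x | f(x) ≥ y}`. -/
noncomputable def sharpFun {n m : ℕ+} (φ : PeriodicMap n m) (y : ℤ) : ℤ := sInf (φ.above y)

theorem sharpFun_gc {n m : ℕ+} (φ : PeriodicMap n m) : GaloisConnection φ.sharpFun φ.toFun := by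
  intro y x
  constructor
  · intro h
    have h1 : y ≤ φ.toFun (φ.sharpFun y) :=
      Int.csInf_mem (φ.above_nonempty y) (φ.above_bddBelow y)
    exact h1.trans (φ.mono h)
  · intro h
    exact csInf_le (φ.above_bddBelow y) h

/-- The left adjoint `f_♯` of a horizontal `f`, on the level of periodic maps. -/
noncomputable def sharp {n m : ℕ+} (φ : PeriodicMap n m) : PeriodicMap m n where
  toFun := φ.sharpFun
  mono := φ.sharpFun_gc.monotone_l
  period y := by
    refine eq_of_forall_ge_iff fun c => ?_
    refine (φ.sharpFun_gc (y + ((m : ℕ) : ℤ)) c).trans ?_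
    refine Iff.trans ?_ ((φ.sharpFun_gc y (c - ((n : ℕ) : ℤ))).symm.trans le_sub_iff_add_le)
    have h := φ.period (c - ((n : ℕ) : ℤ))
    rw [sub_add_cancel] at h
    rw [h]
    exact add_le_add_iff_right _

theorem sharp_id (n : ℕ+) : (id n).sharp = id n :=
  PeriodicMap.ext (funext fun _ => eq_of_forall_ge_iff fun _ => (id n).sharpFun_gc _ _)

theorem sharp_comp {n m k : ℕ+} (φ : PeriodicMap n m) (ψ : PeriodicMap m k) :
    (φ.comp ψ).sharp = ψ.sharp.comp φ.sharp :=
  PeriodicMap.ext (funext fun _ => eq_of_forall_ge_iff fun _ =>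
    ((φ.comp ψ).sharpFun_gc _ _).trans
      (((φ.sharpFun_gc _ _).trans (ψ.sharpFun_gc _ _)).symm))

/-- The periodic extension of a monotone map `{0,…,k} → {0,…,k'}`. It describes the image of this
map under the embedding `j : Δ ⥤ Λ`. -/
def ofSimplex {a b : SimplexCategory} (f : a ⟶ b) :
    PeriodicMap (Nat.succPNat a.len) (Nat.succPNat b.len) where
  toFun x := ((f.toOrderHom ⟨(x % (a.len + 1 : ℤ)).toNat, by
      have h1 := Int.emod_nonneg x (show (a.len + 1 : ℤ) ≠ 0 by omega)
      have h2 := Int.emod_lt_of_pos x (show (0 : ℤ) < a.len + 1 by omega)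
      omega⟩ : Fin (b.len + 1)) : ℤ) + (b.len + 1 : ℤ) * (x / (a.len + 1 : ℤ))
  mono x x' hxx' := by
    have h1 := Int.emod_nonneg x (show (a.len + 1 : ℤ) ≠ 0 by omega)
    have h2 := Int.emod_lt_of_pos x (show (0 : ℤ) < a.len + 1 by omega)
    have h1' := Int.emod_nonneg x' (show (a.len + 1 : ℤ) ≠ 0 by omega)
    have h2' := Int.emod_lt_of_pos x' (show (0 : ℤ) < a.len + 1 by omega)
    have hd := Int.ediv_le_ediv (show (0 : ℤ) < a.len + 1 by omega) hxx'
    have e := Int.emod_add_mul_ediv x (a.len + 1 : ℤ)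
    have e' := Int.emod_add_mul_ediv x' (a.len + 1 : ℤ)
    rcases hd.eq_or_lt with hd | hd
    · rw [← hd] at e'
      dsimp only
      rw [← hd]
      refine (add_le_add_iff_right _).2 ?_
      have : f.toOrderHom ⟨(x % (a.len + 1 : ℤ)).toNat, by omega⟩ ≤
          f.toOrderHom ⟨(x' % (a.len + 1 : ℤ)).toNat, by omega⟩ :=
        f.toOrderHom.monotone (by
          change (x % (a.len + 1 : ℤ)).toNat ≤ (x' % (a.len + 1 : ℤ)).toNat
          exact Int.toNat_le_toNat (by linarith))
      exact_mod_cast this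
    · have hb := (f.toOrderHom ⟨(x % (a.len + 1 : ℤ)).toNat, by omega⟩).2
      have hb' : (((f.toOrderHom ⟨(x % (a.len + 1 : ℤ)).toNat, by omega⟩ : Fin (b.len + 1)) : ℕ) : ℤ)
        < b.len + 1 := by exact_mod_cast hb
      have h0 : (0 : ℤ) ≤
        (((f.toOrderHom ⟨(x' % (a.len + 1 : ℤ)).toNat, by omega⟩ : Fin (b.len + 1)) : ℕ) : ℤ) :=
        Int.natCast_nonneg _
      have hpos : (0 : ℤ) ≤ (b.len : ℤ) + 1 := by omega
      have := mul_le_mul_of_nonneg_left (Int.add_one_le_iff.2 hd) hpos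
      dsimp only
      linarith
  period x := by
    have hne : ((a.len : ℤ) + 1) ≠ 0 := by omega
    have h1 : (x + ((Nat.succPNat a.len : ℕ) : ℤ)) = x + ((a.len : ℤ) + 1) := by simp
    have h2 : (((Nat.succPNat b.len : ℕ) : ℤ)) = (b.len : ℤ) + 1 := by simp
    simp only [h1, h2, Int.add_emod_right, Int.add_ediv_of_dvd_right (dvd_refl _),
      Int.ediv_self hne]
    ring

theorem ofSimplex_id (a : SimplexCategory) : ofSimplex (𝟙 a) = id (Nat.succPNat a.len) := by
  refine PeriodicMap.ext (funext fun x => ?_)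
  have h1 := Int.emod_nonneg x (show (a.len + 1 : ℤ) ≠ 0 by omega)
  have e := Int.emod_add_mul_ediv x (a.len + 1 : ℤ)
  change (((x % (a.len + 1 : ℤ)).toNat : ℕ) : ℤ) + (a.len + 1 : ℤ) * (x / (a.len + 1 : ℤ)) = x
  rw [Int.toNat_of_nonneg h1]
  exact e

theorem ofSimplex_comp {a b c : SimplexCategory} (f : a ⟶ b) (g : b ⟶ c) :
    ofSimplex (f ≫ g) = (ofSimplex f).comp (ofSimplex g) := by
  refine PeriodicMap.ext (funext fun x => ?_)
  have aux : ∀ (r : Fin (b.len + 1)) (q : ℤ),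
      (ofSimplex g).toFun ((r : ℤ) + (b.len + 1 : ℤ) * q) =
        ((g.toOrderHom r : Fin (c.len + 1)) : ℤ) + (c.len + 1 : ℤ) * q := by
    intro r q
    have hr : ((r : ℕ) : ℤ) < (b.len : ℤ) + 1 := by exact_mod_cast r.2
    have hr0 : (0 : ℤ) ≤ ((r : ℕ) : ℤ) := Int.natCast_nonneg _
    have hne : ((b.len : ℤ) + 1) ≠ 0 := by omega
    simp only [ofSimplex, Int.add_mul_emod_self_left, Int.add_mul_ediv_left _ _ hne,
      Int.emod_eq_of_lt hr0 hr, Int.ediv_eq_zero_of_lt hr0 hr, zero_add, Int.toNat_natCast]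
  exact (aux _ _).symm

end PeriodicMap

/-- The embedding `j^o : Δ^o ⥤ Λ`, obtained from `j : Δ ⥤ Λ` by the duality `f ↦ f_♯`. It sends
the ordered set `{0,…,k}` to `[k+1]`. -/
noncomputable def jo : SimplexCategoryᵒᵖ ⥤ Cyclic where
  obj a := ⟨Nat.succPNat a.unop.len⟩
  map f := ⟨(PeriodicMap.ofSimplex f.unop).sharp.toFunctor,
    PeriodicMap.toFunctor_isHorizontal _⟩
  map_id a := Subtype.ext (by
    change (PeriodicMap.ofSimplex (𝟙 a.unop)).sharp.toFunctor = _
    rw [PeriodicMap.ofSimplex_id, PeriodicMap.sharp_id, PeriodicMap.toFunctor_id]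
    rfl)
  map_comp f g := Subtype.ext (by
    change (PeriodicMap.ofSimplex (g.unop ≫ f.unop)).sharp.toFunctor = _
    rw [PeriodicMap.ofSimplex_comp, PeriodicMap.sharp_comp,
      PeriodicMap.toFunctor_comp]
    rfl)

/-! ### Homology of small categories, Hochschild homology -/

section Homology

variable (I : Type) [SmallCategory I] (A : Type u) [Ring A]

/-- The category `Fun(I, A)` of functors from `I` to left `A`-modules has enough projectives. -/
instance enoughProjectives_functor : EnoughProjectives (I ⥤ ModuleCat.{u} A) where
  presentation E := by
    let P : I → (I ⥤ ModuleCat.{u} A) := fun c =>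
      (evaluationLeftAdjoint (ModuleCat.{u} A) c).obj (Projective.over (E.obj c))
    let q : ∀ c, P c ⟶ E := fun c =>
      ((evaluationAdjunctionRight (ModuleCat.{u} A) c).homEquiv _ _).symm (Projective.π (E.obj c))
    have hP : ∀ c, Projective (P c) := fun c =>
      (evaluationAdjunctionRight (ModuleCat.{u} A) c).map_projective _ inferInstance
    have hS : Projective (∐ P) := {
      factors := fun f p _ => ⟨Sigma.desc fun c => Projective.factorThru (Sigma.ι P c ≫ f) p, by
        ext1
        simp⟩ }
    have : ∀ c : I, Epi ((Sigma.desc q).app c) := fun c => by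
      let s : Projective.over (E.obj c) ⟶ (∐ P).obj c :=
        (evaluationAdjunctionRight (ModuleCat.{u} A) c).unit.app _ ≫ (Sigma.ι P c).app c
      let t : (∐ P).obj c ⟶ E.obj c := (Sigma.desc q).app c
      have h : s ≫ t = Projective.π (E.obj c) := by
        have h1 := (evaluationAdjunctionRight (ModuleCat.{u} A) c).homEquiv_unit
          (X := Projective.over (E.obj c)) (Y := E) (f := q c)
        rw [Equiv.apply_symm_apply] at h1
        have h2 : (Sigma.ι P c).app c ≫ t = (q c).app c := by
          rw [← NatTrans.comp_app, Sigma.ι_desc]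
        exact (Category.assoc _ _ _).trans ((congrArg (fun z => (evaluationAdjunctionRight
          (ModuleCat.{u} A) c).unit.app (Projective.over (E.obj c)) ≫ z) h2).trans h1.symm)
      have h' : Epi (s ≫ t) := h ▸ Projective.π_epi (E.obj c)
      exact epi_of_epi s t
    exact ⟨{ p := ∐ P, projective := hS, f := Sigma.desc q, epi := NatTrans.epi_of_epi_app _ }⟩

instance colim_additive : (colim : (I ⥤ ModuleCat.{u} A) ⥤ ModuleCat.{u} A).Additive :=
  have : (Functor.const I : ModuleCat.{u} A ⥤ (I ⥤ ModuleCat.{u} A)).Additive :=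
    { map_add := rfl }
  colimConstAdj.left_adjoint_additive

/-- The homology `H_i(I, -)` of a small category `I` with coefficients in functors to `A`-modules:
the left derived functors of the colimit, that is, of the left Kan extension along `I ⥤ pt`. -/
noncomputable def categoryHomology (i : ℕ) : (I ⥤ ModuleCat.{u} A) ⥤ ModuleCat.{u} A :=
  (colim : (I ⥤ ModuleCat.{u} A) ⥤ ModuleCat.{u} A).leftDerived i

/-- Hochschild homology `HH_i(E) = H_i(Δ^o, j^{o*} E)` of an object `E` of `Fun(Λ, A)`. -/
noncomputable def HH (i : ℕ) : (Cyclic ⥤ ModuleCat.{u} A) ⥤ ModuleCat.{u} A :=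
  (Functor.whiskeringLeft _ _ _).obj jo ⋙ categoryHomology SimplexCategoryᵒᵖ A i

end Homology

/-! ### Modules over group rings, the comparison map -/

section Comparison

variable {A : Type u} [Ring A]

/-- The functor `pt_G ⥤ A-mod` corresponding to a left `A[G]`-module: the underlying `A`-module,
with `g ∈ G` acting as multiplication by the basis element `g` of `A[G]`. -/
noncomputable def moduleFunctor {G : Type} [Group G] (M : ModuleCat.{u} (MonoidAlgebra A G)) :
    SingleObj G ⥤ ModuleCat.{u} A where
  obj _ := (ModuleCat.restrictScalars
    (MonoidAlgebra.singleOneRingHom : A →+* MonoidAlgebra A G)).obj M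
  map g := ModuleCat.ofHom
    (X := (ModuleCat.restrictScalars
      (MonoidAlgebra.singleOneRingHom : A →+* MonoidAlgebra A G)).obj M)
    (Y := (ModuleCat.restrictScalars
      (MonoidAlgebra.singleOneRingHom : A →+* MonoidAlgebra A G)).obj M)
    { toFun := fun (x : M) => (MonoidAlgebra.single (show G from g) (1 : A) • x : M)
      map_add' := fun (x y : M) => smul_add _ x y
      map_smul' := fun (r : A) (x : M) => by
        change MonoidAlgebra.single (show G from g) (1 : A) •
            (MonoidAlgebra.single (1 : G) r • x) =
          MonoidAlgebra.single (1 : G) r • (MonoidAlgebra.single (show G from g) (1 : A) • x)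
        rw [smul_smul, smul_smul, MonoidAlgebra.single_mul_single,
          MonoidAlgebra.single_mul_single]
        simp }
  map_id _ := by
    ext (x : M)
    exact one_smul (MonoidAlgebra A G) x
  map_comp g h := by
    ext (x : M)
    change MonoidAlgebra.single ((show G from h) * (show G from g)) (1 : A) • x =
      MonoidAlgebra.single (show G from h) (1 : A) •
        (MonoidAlgebra.single (show G from g) (1 : A) • x)
    rw [smul_smul, MonoidAlgebra.single_mul_single, one_mul]

/-- `e^n_! M` for an `A[ℤ/n]`-module `M`. -/
noncomputable def eShriek (n : ℕ+) (M : ModuleCat.{u} (MonoidAlgebra A (CyclicGroup n))) :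
    Cyclic ⥤ ModuleCat.{u} A :=
  (e n).lan.obj (moduleFunctor M)

/-- `e^n_{l!} M` for an `A[ℤ/nl]`-module `M`. -/
noncomputable def eLShriek (n l : ℕ+)
    (M : ModuleCat.{u} (MonoidAlgebra A (CyclicGroup (n * l)))) :
    CyclicL l ⥤ ModuleCat.{u} A :=
  (eL n l).lan.obj (moduleFunctor M)

/-- The natural map `e^n_{l!} M ⟶ i_l^* e^{nl}_! M`, adjoint to
`M ⟶ e^{nl*} e^{nl}_! M ≅ e^{n*}_l i_l^* e^{nl}_! M`. -/
noncomputable def comparison (n l : ℕ+)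
    (M : ModuleCat.{u} (MonoidAlgebra A (CyclicGroup (n * l)))) :
    eLShriek n l M ⟶ iL l ⋙ eShriek (n * l) M :=
  (((eL n l).lanAdjunction (ModuleCat.{u} A)).homEquiv (moduleFunctor M) (iL l ⋙ eShriek (n * l) M)).symm
    ((e (n * l)).lanUnit.app (moduleFunctor M) ≫
      Functor.whiskerRight (eLCompIL n l).inv (eShriek (n * l) M))

/-- The (underived) left Kan extension `π_{l!} : Fun(Λ_l, A) ⥤ Fun(Λ, A)`. -/
noncomputable def piShriek (A : Type u) [Ring A] (l : ℕ+) :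
    (CyclicL l ⥤ ModuleCat.{u} A) ⥤ (Cyclic ⥤ ModuleCat.{u} A) :=
  (piL l).lan

end Comparison

end HochschildWitt

/-!
Write `N = nl`. The comparison map is shown to be a split monomorphism of functors on `Λ`, whose
cokernel restricts to a simplicial module with exact alternating face complex.

*Generators and relations.* A horizontal functor `[N]_Λ ⥤ [ml]_Λ` is a monotone `p : ℤ → ℤ` with
`p (x + N) = p x + ml`, up to translation of the value by `ml`. Since every functor
`[c]_Λ ⥤ [m]_Λ` of degree `l` lifts to a horizontal one along the covering `[ml]_Λ → [m]_Λ`,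
uniquely up to deck transformations, the pointwise formula for left Kan extensions says that
`(π_{l!} i_l^* e^{nl}_! M) [m]` is the quotient of the direct sum of copies of `M` indexed by these
`p` by the action of the translations of the argument (twisted by the action on `M`) and of the
translations of the value by `m` (`targetGen`, `target_hom_ext`, `exists_target_desc`).
Likewise `(π_{l!} e^n_{l!} M) [m]` is generated by copies of `M` indexed by the `p` with
`p (x + n) = p x + m` (`sourceGen`, `source_hom_ext`), and the comparison map is the inclusion of
these generators (`sourceGen_comparison`).

*Splitting.* The map `p ↦ (x ↦ max_j (p (x + jn) - jm))`, called `PeriodicMap.retract`, is a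
retraction of all `p` onto those with `p (x + n) = p x + m`. It commutes with translations and with
composition with morphisms of `Λ`, so it induces a retraction of the comparison map
(`comparison_retraction`). As `HH_i` is additive, it is enough to show that `H_i(Δᵒᵖ, -)` vanishes
on the cokernel `D` (`isIso_map_of_retraction`).

*Acyclicity of the cokernel.* In degree `k`, put `m = k + 1`. Then `D` is the quotient of the chains
`S` on the simplicial set of all `p` by the submodule `R` generated by the differences
`κ s - s` and by the `p` of period `n`, and by the image of `t - 1`; here `t` is the translation of
the argument by one, and `κ p = p (· - n) + m` with the twist by `M`.

* `S` is acyclic modulo `R`. Let `c_a` be the vertex `x ↦ ⌈(x - a) / n⌉`. The endomorphisms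
  `p ↦ max(p, c_a)` preserve `R`, and an edge from `c_a` to `c_{a+1}` gives a simplicial homotopy
  between two consecutive ones that preserves `R` too. On a given chain the operator is the
  identity for large `a`, and it has values in the span of the `p` of period `n` for very negative
  `a` (`exists_boundary`).
* `t - 1` is injective modulo `R`, because `R` is graded by a degree that `t` raises by one
  (`PeriodicMap.degree`, `mem_deckRel_of_rotate_sub_mem`). Hence `S` is acyclic modulo
  `R + range (t - 1)` as well (`exists_boundary_of_injective`, `exactAt_of_surjective`).

*From complexes to derived functors.* It remains to see that a simplicial module with exact
alternating face complex has no homology over `Δᵒᵖ` (`isZero_categoryHomology`). This is dimension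
shifting in the class of simplicial modules whose complex is exact in positive degrees. The class
contains the projectives, since a projective is a retract of its décalage, which has an extra
degeneracy; it is closed under kernels of epimorphisms, and `colim` is exact on the short exact
sequences in it because `colim X` is the cokernel of the first differential
(`isZero_leftDerived_succ`).
-/

namespace HochschildWitt

/-! ### Vanishing of left derived functors -/

section Vanishing

open ZeroObject HomologicalComplex

variable {C : Type*} [Category* C] [Abelian C] {D : Type*} [Category* D] [Abelian D]

theorem shortExact_opcycles {X : C} (P : ProjectiveResolution X) (n : ℕ) :
    (ShortComplex.mk (P.complex.fromOpcycles (n + 1) n) (P.complex.pOpcycles n)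
      (by rw [← cancel_epi (P.complex.pOpcycles (n + 1))]; simp)).ShortExact where
  exact := by
    have h : (ShortComplex.mk (P.complex.d (n + 1) n) (P.complex.pOpcycles n) (by simp)).Exact :=
      ShortComplex.exact_of_g_is_cokernel _ (P.complex.opcyclesIsCokernel (n + 1) n (by simp))
    rw [ShortComplex.exact_iff_exact_up_to_refinements] at h ⊢
    intro T x hx
    obtain ⟨T', π, hπ, y, hy⟩ := h x hx
    exact ⟨T', π, hπ, y ≫ P.complex.pOpcycles (n + 1), by simpa using hy⟩
  mono_f := by
    have h := (P.complex.exactAt_iff_isZero_homology (n + 1)).1 (P.complex_exactAt_succ n)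
    have h' : (ShortComplex.mk (P.complex.homologyι (n + 1)) (P.complex.fromOpcycles (n + 1) n)
        (by simp)).Exact :=
      ShortComplex.exact_of_f_is_kernel _ (P.complex.homologyIsKernel (n + 1) n (by simp))
    exact (ShortComplex.exact_iff_mono _ (h.eq_of_src _ _)).1 h'
  epi_g := inferInstance

/-- Dimension shifting: a right exact functor has vanishing higher left derived functors on every
class of objects that contains the projectives, is closed under kernels of epimorphisms, and on
whose short exact sequences the functor is exact. -/
theorem isZero_leftDerived_succ [HasProjectiveResolutions C] (F : C ⥤ D) [F.Additive]
    [PreservesFiniteColimits F] (W : C → Prop) (hiso : ∀ {X Y : C}, (X ≅ Y) → W X → W Y)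
    (hproj : ∀ X : C, Projective X → W X)
    (hker : ∀ S : ShortComplex C, S.ShortExact → W S.X₂ → W S.X₃ → W S.X₁ ∧ Mono (F.map S.f))
    {X : C} (hX : W X) (n : ℕ) : IsZero ((F.leftDerived (n + 1)).obj X) := by
  let P := projectiveResolution X
  have hop : ∀ k : ℕ, W (P.complex.opcycles k) := by
    intro k
    induction k with
    | zero =>
      exact hiso ((P.complex.opcyclesIsCokernel 1 0 (by simp)).coconePointUniqueUpToIso
        P.isColimitCokernelCofork).symm hX
    | succ k ih => exact (hker _ (shortExact_opcycles P k) (hproj _ (P.projective k)) ih).1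
  have hmono : Mono (F.map (P.complex.fromOpcycles (n + 1) n)) :=
    (hker _ (shortExact_opcycles P n) (hproj _ (P.projective n)) (hop n)).2
  refine IsZero.of_iso ?_ (P.isoLeftDerivedObj F (n + 1))
  refine (exactAt_iff_isZero_homology _ _).1 ?_
  rw [exactAt_iff' _ (n + 2) (n + 1) n (by simp) (by simp)]
  have h : (ShortComplex.mk (P.complex.d (n + 2) (n + 1)) (P.complex.pOpcycles (n + 1))
      (by simp)).Exact :=
    ShortComplex.exact_of_g_is_cokernel _ (P.complex.opcyclesIsCokernel (n + 2) (n + 1) (by simp))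
  have hF := h.map_of_epi_of_preservesCokernel F inferInstance inferInstance
  rw [ShortComplex.exact_iff_exact_up_to_refinements] at hF ⊢
  have key : ∀ {T : D} (x : T ⟶ F.obj (P.complex.X (n + 1))),
      x ≫ F.map (P.complex.d (n + 1) n) = 0 → x ≫ F.map (P.complex.pOpcycles (n + 1)) = 0 := by
    intro T x hx
    rw [← cancel_mono (F.map (P.complex.fromOpcycles (n + 1) n)), Category.assoc, ← F.map_comp,
      p_fromOpcycles, hx, zero_comp]
  exact fun T x hx => hF x (key x hx)

end Vanishing

/-- An additive functor inverts a split monomorphism once it kills the cokernel. -/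
theorem isIso_map_of_retraction {C : Type*} [Category* C] [Abelian C] {D : Type*} [Category* D]
    [Preadditive D] (F : C ⥤ D) [F.Additive] {X Y : C} (f : X ⟶ Y) (r : Y ⟶ X)
    (hr : f ≫ r = 𝟙 X) (h : IsZero (F.obj (cokernel f))) : IsIso (F.map f) := by
  refine ⟨F.map r, by rw [← F.map_comp, hr, F.map_id], ?_⟩
  -- `1 - r f` factors through the cokernel of `f`.
  have hs : f ≫ (𝟙 Y - r ≫ f) = 0 := by
    rw [Preadditive.comp_sub, Category.comp_id, ← Category.assoc, hr, Category.id_comp, sub_self]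
  have hz : F.map (𝟙 Y - r ≫ f) = 0 := by
    rw [← cokernel.π_desc f _ hs, F.map_comp, h.eq_of_src (F.map (cokernel.desc f _ hs)) 0,
      comp_zero]
  rw [F.map_sub, F.map_id, F.map_comp, sub_eq_zero] at hz
  exact hz.symm

/-- The left derived functors are additive, since a sum of lifts to projective resolutions lifts
the sum. -/
theorem leftDerived_additive {C D : Type*} [Category* C] [Category* D] [Abelian C] [Abelian D]
    [HasProjectiveResolutions C] (F : C ⥤ D) [F.Additive] (i : ℕ) :
    (F.leftDerived i).Additive where
  map_add {X Y f g} := by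
    have h (f : X ⟶ Y) := F.leftDerived_map_eq i f
      (ProjectiveResolution.lift f (projectiveResolution X) (projectiveResolution Y))
      (ProjectiveResolution.lift_commutes f _ _)
    have h' := F.leftDerived_map_eq i (f + g)
      (ProjectiveResolution.lift f (projectiveResolution X) (projectiveResolution Y) +
        ProjectiveResolution.lift g (projectiveResolution X) (projectiveResolution Y)) (by
        rw [Preadditive.add_comp, ProjectiveResolution.lift_commutes,
          ProjectiveResolution.lift_commutes, Functor.map_add, Preadditive.comp_add])
    rw [h', h f, h g, Functor.map_add, Preadditive.add_comp, Preadditive.comp_add]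

/-! ### Décalage -/

section Decalage

open Simplicial AlgebraicTopology

/-- The functor `Δ ⥤ Δ` that adjoins a new least element to a finite ordinal. -/
def adjoinZero : SimplexCategory ⥤ SimplexCategory where
  obj a := ⦋a.len + 1⦌
  map {a b} f := SimplexCategory.mkHom
    { toFun := Fin.cases 0 fun i => (f.toOrderHom i).succ
      monotone' := by
        intro i j hij
        induction i using Fin.cases with
        | zero => simp
        | succ i =>
          induction j using Fin.cases with
          | zero => simp at hij
          | succ j => simpa using f.toOrderHom.monotone (Fin.succ_le_succ_iff.1 hij) }
  map_id a := by
    ext i : 3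
    induction i using Fin.cases <;> rfl
  map_comp f g := by
    ext i : 3
    induction i using Fin.cases <;> rfl

theorem adjoinZero_map_δ {n : ℕ} (i : Fin (n + 2)) :
    adjoinZero.map (SimplexCategory.δ i) = SimplexCategory.δ i.succ := by
  ext j : 3
  induction j using Fin.cases with
  | zero => exact (Fin.succ_succAbove_zero i).symm
  | succ j => exact (Fin.succ_succAbove_succ i j).symm

theorem adjoinZero_map_σ {n : ℕ} (i : Fin (n + 1)) :
    adjoinZero.map (SimplexCategory.σ i) = SimplexCategory.σ i.succ := by
  ext j : 3
  induction j using Fin.cases with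
  | zero => rfl
  | succ j => exact (Fin.succ_predAbove_succ i j).symm

/-- The inclusion of a finite ordinal as the complement of the new least element. -/
def toAdjoinZero : 𝟭 SimplexCategory ⟶ adjoinZero where
  app a := SimplexCategory.mkHom ⟨Fin.succ, fun _ _ h => Fin.succ_le_succ_iff.2 h⟩

variable {C : Type*} [Category* C]

/-- The décalage of a simplicial object: one forgets the first face and the first degeneracy. -/
def decalage (X : SimplicialObject C) : SimplicialObject C := adjoinZero.op ⋙ X

/-- The map from the décalage given by the forgotten face. -/
def decalageHom (X : SimplicialObject C) : decalage X ⟶ X :=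
  Functor.whiskerRight (NatTrans.op toAdjoinZero) X

instance (X : SimplicialObject C) (a : SimplexCategoryᵒᵖ) :
    IsSplitEpi ((decalageHom X).app a) :=
  IsSplitEpi.mk' ⟨X.map (SimplexCategory.σ (0 : Fin (a.unop.len + 1))).op, by
    change X.map _ ≫ X.map (SimplexCategory.δ (0 : Fin (a.unop.len + 2))).op =
      𝟙 (X.obj (op ⦋a.unop.len⦌))
    rw [← X.map_comp, ← op_comp, SimplexCategory.δ_comp_σ_self' (by rfl), op_id, X.map_id]⟩

theorem decalage_δ (X : SimplicialObject C) {n : ℕ} (i : Fin (n + 2)) :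
    (decalage X).δ i = X.δ i.succ :=
  congrArg (fun f => X.map (Quiver.Hom.op f)) (adjoinZero_map_δ i)

theorem decalage_σ (X : SimplicialObject C) {n : ℕ} (i : Fin (n + 1)) :
    (decalage X).σ i = X.σ i.succ :=
  congrArg (fun f => X.map (Quiver.Hom.op f)) (adjoinZero_map_σ i)

/-- The décalage, augmented by the vertex that the new least element gives. -/
def augmentedDecalage (X : SimplicialObject C) : SimplicialObject.Augmented C where
  left := decalage X
  right := X _⦋0⦌
  hom :=
    { app := fun a => X.map (SimplexCategory.const ⦋0⦌ (adjoinZero.obj a.unop) 0).op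
      naturality := fun _ b f =>
        (X.map_comp (adjoinZero.map f.unop).op
          (SimplexCategory.const ⦋0⦌ (adjoinZero.obj b.unop) 0).op).symm.trans
          (Category.comp_id _).symm }

/-- The forgotten degeneracy is an extra degeneracy of the décalage. -/
def decalageExtraDegeneracy (X : SimplicialObject C) :
    (augmentedDecalage X).ExtraDegeneracy where
  s' := X.σ 0
  s n := X.σ (0 : Fin (n + 2))
  s'_comp_ε :=
    (X.map_comp (SimplexCategory.σ 0).op (SimplexCategory.const ⦋0⦌ ⦋1⦌ 0).op).symm.trans
      ((congrArg (fun f => X.map (Quiver.Hom.op f))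
        (SimplexCategory.isTerminalZero.hom_ext _ (𝟙 ⦋0⦌))).trans (X.map_id _))
  s₀_comp_δ₁ := by
    change X.σ 0 ≫ (decalage X).δ 1 = X.map _ ≫ X.σ 0
    rw [decalage_δ]
    exact (X.δ_comp_σ_of_gt (n := 0) (i := 1) (j := 0) (by simp)).trans (by
      congr 1
      refine congrArg (fun f => X.map (Quiver.Hom.op f)) ?_
      ext i : 3
      fin_cases i
      rfl)
  s_comp_δ₀ n := by
    change X.σ 0 ≫ (decalage X).δ 0 = _
    rw [decalage_δ]
    exact X.δ_comp_σ_succ (i := 0)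
  s_comp_δ n i := by
    change X.σ 0 ≫ (decalage X).δ i.succ = (decalage X).δ i ≫ X.σ 0
    rw [decalage_δ, decalage_δ]
    exact X.δ_comp_σ_of_gt (i := i.succ) (j := 0) (by simp)
  s_comp_σ n i := by
    change X.σ 0 ≫ (decalage X).σ i.succ = (decalage X).σ i ≫ X.σ 0
    rw [decalage_σ, decalage_σ]
    exact (X.σ_comp_σ (i := 0) (j := i.succ) (by simp)).symm

theorem decalage_exactAt [Abelian C] (X : SimplicialObject C) (j : ℕ) :
    (AlternatingFaceMapComplex.obj (decalage X)).ExactAt (j + 1) := by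
  rw [HomologicalComplex.exactAt_iff_isZero_homology]
  refine IsZero.of_iso ?_ ((decalageExtraDegeneracy X).homotopyEquiv.toHomologyIso (j + 1))
  exact (HomologicalComplex.exactAt_iff_isZero_homology _ _).1
    (ChainComplex.exactAt_succ_single_obj _ _)

end Decalage

/-! ### The alternating face complex detects vanishing of homology -/

section Bridge

open Simplicial AlgebraicTopology

variable {A : Type u} [Ring A]

/-- Every vertex of a simplex gives the same map to a cocone under a simplicial object. -/
theorem map_vertex_eq {X : SimplicialObject (ModuleCat.{u} A)} {B : ModuleCat.{u} A}
    (p : X _⦋0⦌ ⟶ B) (hp : X.δ 0 ≫ p = X.δ 1 ≫ p) (a : SimplexCategory) (v w : ⦋0⦌ ⟶ a) :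
    X.map v.op ≫ p = X.map w.op ≫ p := by
  wlog h : v.toOrderHom 0 ≤ w.toOrderHom 0 generalizing v w
  · exact (this w v (le_of_not_ge h)).symm
  let φ : ⦋1⦌ ⟶ a := SimplexCategory.mkHom
    ⟨![v.toOrderHom 0, w.toOrderHom 0], by
      intro i j hij
      fin_cases i <;> fin_cases j <;> simp_all⟩
  have hv : v = SimplexCategory.δ 1 ≫ φ := by
    ext i : 3
    fin_cases i
    rfl
  have hw : w = SimplexCategory.δ 0 ≫ φ := by
    ext i : 3
    fin_cases i
    rfl
  rw [hv, hw, op_comp, op_comp, X.map_comp, X.map_comp, Category.assoc, Category.assoc]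
  exact congrArg (fun z => X.map φ.op ≫ z) hp.symm

/-- A map out of the vertices that equalizes the two faces of edges extends to a cocone. -/
def vertexCocone (X : SimplicialObject (ModuleCat.{u} A)) {B : ModuleCat.{u} A}
    (p : X _⦋0⦌ ⟶ B) (hp : X.δ 0 ≫ p = X.δ 1 ≫ p) : Cocone X where
  pt := B
  ι :=
    { app := fun a => X.map (SimplexCategory.const ⦋0⦌ a.unop 0).op ≫ p
      naturality := fun a b f => by
        change X.map f ≫ X.map _ ≫ p = (X.map _ ≫ p) ≫ 𝟙 _
        rw [Category.comp_id, ← Category.assoc, ← X.map_comp]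
        exact map_vertex_eq p hp a.unop (SimplexCategory.const ⦋0⦌ b.unop 0 ≫ f.unop) _ }

theorem afc_d_one_zero (X : SimplicialObject (ModuleCat.{u} A)) :
    (AlternatingFaceMapComplex.obj X).d 1 0 = X.δ 0 - X.δ 1 := by
  rw [AlternatingFaceMapComplex.obj_d_eq, Fin.sum_univ_two]
  simp [sub_eq_add_neg]

theorem colimit_ι_zero_surjective (X : SimplicialObject (ModuleCat.{u} A)) :
    Function.Surjective (colimit.ι X (op ⦋0⦌)) := by
  rw [← ModuleCat.epi_iff_surjective]
  refine ⟨fun g h hgh => colimit.hom_ext fun a => ?_⟩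
  let v : ⦋0⦌ ⟶ a.unop := SimplexCategory.const ⦋0⦌ a.unop 0
  rw [← colimit.w X v.op, Category.assoc, Category.assoc, hgh]

theorem exists_of_colimit_ι_zero_eq_zero (X : SimplicialObject (ModuleCat.{u} A))
    (x : X _⦋0⦌) (hx : colimit.ι X (op ⦋0⦌) x = 0) :
    ∃ y : X _⦋1⦌, (AlternatingFaceMapComplex.obj X).d 1 0 y = x := by
  let d : X _⦋1⦌ ⟶ X _⦋0⦌ := X.δ 0 - X.δ 1
  let p : X _⦋0⦌ ⟶ ModuleCat.of A (X _⦋0⦌ ⧸ LinearMap.range d.hom) :=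
    ModuleCat.ofHom (Submodule.mkQ _)
  have hp : X.δ 0 ≫ p = X.δ 1 ≫ p := by
    rw [← sub_eq_zero, ← Preadditive.sub_comp]
    ext y
    exact (Submodule.Quotient.mk_eq_zero _).2 ⟨y, rfl⟩
  have h0 : X.map (SimplexCategory.const ⦋0⦌ ⦋0⦌ 0).op ≫ p = p := by
    rw [SimplexCategory.isTerminalZero.hom_ext (SimplexCategory.const ⦋0⦌ ⦋0⦌ 0) (𝟙 _), op_id,
      X.map_id, Category.id_comp]
  have h1 : colimit.ι X (op ⦋0⦌) ≫ colimit.desc X (vertexCocone X p hp) = p :=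
    (colimit.ι_desc _ _).trans h0
  have h2 : p x = 0 :=
    (ConcreteCategory.congr_hom h1 x).symm.trans
      ((congrArg (colimit.desc X (vertexCocone X p hp)) hx).trans (map_zero _))
  obtain ⟨y, hy⟩ := (Submodule.Quotient.mk_eq_zero _).1 h2
  exact ⟨y, by rw [afc_d_one_zero]; exact hy⟩

theorem afc_shortExact {S : ShortComplex (SimplexCategoryᵒᵖ ⥤ ModuleCat.{u} A)}
    (hS : S.ShortExact) :
    (ShortComplex.mk (AlternatingFaceMapComplex.map S.f) (AlternatingFaceMapComplex.map S.g)
      (by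
        ext j : 1
        exact congrArg (fun z => NatTrans.app z (op ⦋j⦌)) S.zero)).ShortExact :=
  HomologicalComplex.shortExact_of_degreewise_shortExact _ fun j =>
    hS.map_of_exact ((evaluation _ _).obj (op ⦋j⦌))

/-- The simplicial modules whose alternating face complex has no homology in positive degrees. -/
def IsResolution (X : SimplexCategoryᵒᵖ ⥤ ModuleCat.{u} A) : Prop :=
  ∀ j : ℕ, (AlternatingFaceMapComplex.obj X).ExactAt (j + 1)

theorem IsResolution.of_retract {X Y : SimplexCategoryᵒᵖ ⥤ ModuleCat.{u} A} (i : X ⟶ Y)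
    (r : Y ⟶ X) (h : i ≫ r = 𝟙 X) (hY : IsResolution Y) : IsResolution X := by
  intro j
  have hz := (HomologicalComplex.exactAt_iff_isZero_homology _ _).1 (hY j)
  rw [HomologicalComplex.exactAt_iff_isZero_homology, IsZero.iff_id_eq_zero]
  have h' : (AlternatingFaceMapComplex.map i) ≫ (AlternatingFaceMapComplex.map r) = 𝟙 _ :=
    ((alternatingFaceMapComplex _).map_comp i r).symm.trans
      ((congrArg (alternatingFaceMapComplex _).map h).trans
        ((alternatingFaceMapComplex _).map_id X))
  rw [← HomologicalComplex.homologyMap_id, ← h', HomologicalComplex.homologyMap_comp,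
    hz.eq_of_tgt (HomologicalComplex.homologyMap (AlternatingFaceMapComplex.map i) (j + 1)) 0,
    zero_comp]

/-- A projective simplicial module is a retract of its décalage. -/
theorem isResolution_of_projective (X : SimplexCategoryᵒᵖ ⥤ ModuleCat.{u} A) [Projective X] :
    IsResolution X := by
  have : ∀ a, Epi ((decalageHom X).app a) := fun a => inferInstance
  have : Epi (decalageHom X : decalage X ⟶ X) := NatTrans.epi_of_epi_app _
  exact IsResolution.of_retract (Projective.factorThru (𝟙 X) (decalageHom X)) (decalageHom X)
    (Projective.factorThru_comp _ _) (decalage_exactAt X)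

theorem IsResolution.kernel {S : ShortComplex (SimplexCategoryᵒᵖ ⥤ ModuleCat.{u} A)}
    (hS : S.ShortExact) (h₂ : IsResolution S.X₂) (h₃ : IsResolution S.X₃) :
    IsResolution S.X₁ := by
  intro j
  have e := (afc_shortExact hS).homology_exact₁ (j + 1 + 1) (j + 1) (by simp)
  rw [HomologicalComplex.exactAt_iff_isZero_homology]
  exact e.isZero_of_both_zeros
    (((HomologicalComplex.exactAt_iff_isZero_homology _ _).1 (h₃ (j + 1))).eq_of_src _ _)
    (((HomologicalComplex.exactAt_iff_isZero_homology _ _).1 (h₂ j)).eq_of_tgt _ _)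

/-- The colimit functor is left exact on short exact sequences whose quotient is a resolution of
its colimit: this is the end of the long exact homology sequence. -/
theorem IsResolution.mono_colim {S : ShortComplex (SimplexCategoryᵒᵖ ⥤ ModuleCat.{u} A)}
    (hS : S.ShortExact) (h₃ : IsResolution S.X₃) : Mono (colim.map S.f) := by
  have hS' := afc_shortExact hS
  have hf : ∀ k, Function.Injective (S.f.app k) := fun k => by
    have := hS.mono_f
    exact (ModuleCat.mono_iff_injective _).1 inferInstance
  have hg : ∀ k, Function.Surjective (S.g.app k) := fun k => by
    have := hS.epi_g
    exact (ModuleCat.epi_iff_surjective _).1 inferInstance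
  have he : ∀ k (y : S.X₂.obj k), S.g.app k y = 0 → ∃ x, S.f.app k x = y := fun k =>
    (ShortComplex.moduleCat_exact_iff _).1 (hS.map_of_exact ((evaluation _ _).obj k)).exact
  have e₃ : ∀ (x : S.X₃.obj (op ⦋1⦌)), (AlternatingFaceMapComplex.obj S.X₃).d 1 0 x = 0 →
      ∃ y : S.X₃.obj (op ⦋2⦌), (AlternatingFaceMapComplex.obj S.X₃).d 2 1 y = x :=
    (ShortComplex.moduleCat_exact_iff _).1
      ((HomologicalComplex.exactAt_iff' _ 2 1 0 (by simp) (by simp)).1 (h₃ 0))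
  have nat : ∀ {X Y : SimplexCategoryᵒᵖ ⥤ ModuleCat.{u} A} (φ : X ⟶ Y) (i j : ℕ)
      (x : X.obj (op ⦋i⦌)), (AlternatingFaceMapComplex.obj Y).d i j (φ.app (op ⦋i⦌) x) =
        φ.app (op ⦋j⦌) ((AlternatingFaceMapComplex.obj X).d i j x) := fun φ i j x =>
    ConcreteCategory.congr_hom ((AlternatingFaceMapComplex.map φ).comm i j) x
  rw [ModuleCat.mono_iff_injective, injective_iff_map_eq_zero]
  intro z hz
  obtain ⟨k, rfl⟩ := colimit_ι_zero_surjective S.X₁ z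
  have hz' : colimit.ι S.X₂ (op ⦋0⦌) (S.f.app _ k) = 0 := by
    rw [← hz]
    exact (ConcreteCategory.congr_hom (ι_colimMap S.f (op ⦋0⦌)) k).symm
  obtain ⟨p, hp⟩ := exists_of_colimit_ι_zero_eq_zero S.X₂ _ hz'
  obtain ⟨y, hy⟩ := e₃ (S.g.app _ p) (by
    rw [nat, hp]
    exact ConcreteCategory.congr_hom (NatTrans.congr_app S.zero (op ⦋0⦌)) k)
  obtain ⟨q, rfl⟩ := hg _ y
  obtain ⟨c, hc⟩ := he (op ⦋1⦌)
    (p - (show S.X₂.obj (op ⦋1⦌) from (AlternatingFaceMapComplex.obj S.X₂).d 2 1 q)) (by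
    rw [map_sub, ← hy, nat]
    exact sub_self _)
  have hck : (AlternatingFaceMapComplex.obj S.X₁).d 1 0 c = k := by
    apply hf
    rw [← nat, hc, map_sub, hp]
    have h0 : (AlternatingFaceMapComplex.obj S.X₂).d 1 0
        ((AlternatingFaceMapComplex.obj S.X₂).d 2 1 q) = 0 :=
      ConcreteCategory.congr_hom ((AlternatingFaceMapComplex.obj S.X₂).d_comp_d 2 1 0) q
    exact sub_eq_self.2 h0
  rw [← hck, afc_d_one_zero]
  have w0 := colimit.w S.X₁ (SimplexCategory.δ (0 : Fin 2)).op
  have w1 := colimit.w S.X₁ (SimplexCategory.δ (1 : Fin 2)).op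
  have := ConcreteCategory.congr_hom (w0.trans w1.symm) c
  change colimit.ι S.X₁ (op ⦋0⦌) (S.X₁.map _ c - S.X₁.map _ c) = 0
  rw [map_sub, sub_eq_zero]
  exact this

/-- A simplicial module with exact alternating face complex has no homology over `Δᵒᵖ`. -/
theorem isZero_categoryHomology (X : SimplexCategoryᵒᵖ ⥤ ModuleCat.{u} A)
    (hX : ∀ j : ℕ, (AlternatingFaceMapComplex.obj X).ExactAt j) (i : ℕ) :
    IsZero ((categoryHomology SimplexCategoryᵒᵖ A i).obj X) := by
  cases i with
  | zero =>
    refine IsZero.of_iso ?_ ((colim (J := SimplexCategoryᵒᵖ)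
      (C := ModuleCat.{u} A)).leftDerivedZeroIsoSelf.app X)
    have e₀ : ∀ x : X.obj (op ⦋0⦌),
        ∃ y : X.obj (op ⦋1⦌), (AlternatingFaceMapComplex.obj X).d 1 0 y = x := fun x =>
      (ShortComplex.moduleCat_exact_iff _).1
        ((HomologicalComplex.exactAt_iff' _ 1 0 0 (by simp) (by simp)).1 (hX 0)) x
          (by
            change (AlternatingFaceMapComplex.obj X).d 0 0 x = 0
            rw [HomologicalComplex.shape _ _ _ (by simp)]
            rfl)
    have hz : ∀ z : (colimit X : ModuleCat.{u} A), z = 0 := by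
      intro z
      obtain ⟨x, rfl⟩ := colimit_ι_zero_surjective X z
      obtain ⟨y, rfl⟩ := e₀ x
      have w0 := colimit.w X (SimplexCategory.δ (0 : Fin 2)).op
      have w1 := colimit.w X (SimplexCategory.δ (1 : Fin 2)).op
      rw [afc_d_one_zero]
      change colimit.ι X (op ⦋0⦌) (X.map _ y - X.map _ y) = 0
      rw [map_sub, sub_eq_zero]
      exact ConcreteCategory.congr_hom (w0.trans w1.symm) y
    have : Subsingleton (colimit X : ModuleCat.{u} A) := ⟨fun a b => (hz a).trans (hz b).symm⟩
    exact @ModuleCat.isZero_of_subsingleton _ _ (colimit X) this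
  | succ i =>
    exact isZero_leftDerived_succ _ IsResolution
      (fun e h => IsResolution.of_retract e.inv e.hom e.inv_hom_id h)
      (fun X _ => isResolution_of_projective X)
      (fun S hS h₂ h₃ => ⟨IsResolution.kernel hS h₂ h₃, IsResolution.mono_colim hS h₃⟩)
      (fun j => hX (j + 1)) i

end Bridge

/-! ### Periodic maps and lifts of functors between the categories `[n]_Λ` -/

namespace PeriodicMap

variable {n m k : ℕ+}

/-- Translation of the argument. -/
def shiftSrc (p : PeriodicMap n m) (a : ℤ) : PeriodicMap n m where
  toFun x := p.toFun (x + a)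
  mono _ _ h := p.mono (add_le_add_left h a)
  period x := by rw [add_right_comm, p.period]

/-- Translation of the value. -/
def shiftTgt (p : PeriodicMap n m) (a : ℤ) : PeriodicMap n m where
  toFun x := p.toFun x + a
  mono _ _ h := add_le_add_left (p.mono h) a
  period x := by rw [p.period, add_right_comm]

/-- The pointwise maximum. -/
def sup (p q : PeriodicMap n m) : PeriodicMap n m where
  toFun x := max (p.toFun x) (q.toFun x)
  mono _ _ h := max_le_max (p.mono h) (q.mono h)
  period x := by rw [p.period, q.period, max_add_add_right]

/-- The map `p`, with both periods multiplied by `l`. -/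
def scale (l : ℕ+) (p : PeriodicMap n m) : PeriodicMap (n * l) (m * l) where
  toFun := p.toFun
  mono := p.mono
  period x := by
    have h := p.period_mul x ((l : ℕ) : ℤ)
    rw [PNat.mul_coe, PNat.mul_coe, Nat.cast_mul, Nat.cast_mul, mul_comm ((n : ℕ) : ℤ),
      mul_comm ((m : ℕ) : ℤ), h]

@[simp] theorem shiftSrc_toFun (p : PeriodicMap n m) (a x : ℤ) :
    (p.shiftSrc a).toFun x = p.toFun (x + a) := rfl
@[simp] theorem shiftTgt_toFun (p : PeriodicMap n m) (a x : ℤ) :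
    (p.shiftTgt a).toFun x = p.toFun x + a := rfl
@[simp] theorem sup_toFun (p q : PeriodicMap n m) (x : ℤ) :
    (p.sup q).toFun x = max (p.toFun x) (q.toFun x) := rfl
@[simp] theorem scale_toFun (l : ℕ+) (p : PeriodicMap n m) (x : ℤ) :
    (p.scale l).toFun x = p.toFun x := rfl
@[simp] theorem comp_toFun (p : PeriodicMap n m) (q : PeriodicMap m k) (x : ℤ) :
    (p.comp q).toFun x = q.toFun (p.toFun x) := rfl

theorem shiftSrc_shiftSrc (p : PeriodicMap n m) (a b : ℤ) :
    (p.shiftSrc a).shiftSrc b = p.shiftSrc (b + a) :=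
  PeriodicMap.ext (funext fun x => by simp only [shiftSrc_toFun, add_assoc])

theorem shiftSrc_zero (p : PeriodicMap n m) : p.shiftSrc 0 = p :=
  PeriodicMap.ext (funext fun x => by simp only [shiftSrc_toFun, add_zero])

theorem shiftTgt_shiftTgt (p : PeriodicMap n m) (a b : ℤ) :
    (p.shiftTgt a).shiftTgt b = p.shiftTgt (a + b) :=
  PeriodicMap.ext (funext fun x => by simp only [shiftTgt_toFun, add_assoc])

theorem shiftTgt_zero (p : PeriodicMap n m) : p.shiftTgt 0 = p :=
  PeriodicMap.ext (funext fun x => by simp only [shiftTgt_toFun, add_zero])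

theorem toFunctor_obj (p : PeriodicMap n m) (y : Wheel n) :
    p.toFunctor.obj y = ⟨((p.toFun (y.res.val : ℤ) : ℤ) : ZMod (m : ℕ))⟩ := rfl

theorem len_toFunctor_map (p : PeriodicMap n m) {y y' : Wheel n} (f : y ⟶ y') :
    (Wheel.len (p.toFunctor.map f) : ℤ) =
      p.toFun ((y.res.val : ℤ) + (Wheel.len f : ℤ)) - p.toFun (y.res.val : ℤ) :=
  Int.toNat_of_nonneg (p.increment_nonneg _ _)

/-- The functor of `p` does not depend on the representative of the source. -/
theorem toFunctor_obj_intCast (p : PeriodicMap n m) (x : ℤ) :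
    p.toFunctor.obj ⟨(x : ZMod (n : ℕ))⟩ = ⟨((p.toFun x : ℤ) : ZMod (m : ℕ))⟩ := by
  obtain ⟨c, -, hc⟩ := p.exists_shift (intCast_cast (x : ZMod (n : ℕ))).symm
  have h0 := hc 0
  rw [add_zero, add_zero] at h0
  rw [toFunctor_obj, h0]
  simp

theorem len_toFunctor_map_intCast (p : PeriodicMap n m) (x : ℤ) {y y' : Wheel n} (f : y ⟶ y')
    (hy : y = ⟨(x : ZMod (n : ℕ))⟩) :
    (Wheel.len (p.toFunctor.map f) : ℤ) = p.toFun (x + (Wheel.len f : ℤ)) - p.toFun x := by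
  subst hy
  obtain ⟨c, -, hc⟩ := p.exists_shift (intCast_cast (x : ZMod (n : ℕ))).symm
  have h0 := hc 0
  rw [add_zero, add_zero] at h0
  rw [len_toFunctor_map, h0, hc]
  ring

theorem shiftSrc_toFunctor (p : PeriodicMap n m) (a : ℤ) :
    (p.shiftSrc a).toFunctor = Wheel.rot n (a : ZMod (n : ℕ)) ⋙ p.toFunctor := by
  have h (y : Wheel n) : (Wheel.rot n (a : ZMod (n : ℕ))).obj y =
      ⟨(((y.res.val : ℤ) + a : ℤ) : ZMod (n : ℕ))⟩ := by
    rw [Int.cast_add, intCast_cast]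
    rfl
  refine Wheel.functor_ext (fun y => ?_) (fun y y' f => ?_)
  · rw [Functor.comp_obj, h, toFunctor_obj_intCast, toFunctor_obj]
    rfl
  · zify
    rw [Functor.comp_map, len_toFunctor_map_intCast p _ _ (h y), len_toFunctor_map]
    simp only [shiftSrc_toFun]
    rw [add_right_comm]
    rfl

theorem shiftTgt_toFunctor (p : PeriodicMap n m) (a : ℤ) :
    (p.shiftTgt a).toFunctor = p.toFunctor ⋙ Wheel.rot m (a : ZMod (m : ℕ)) := by
  refine Wheel.functor_ext (fun y => Wheel.ext ?_) (fun y y' f => ?_)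
  · change ((p.toFun (y.res.val : ℤ) + a : ℤ) : ZMod (m : ℕ)) = _
    rw [Int.cast_add]
    rfl
  · change _ = Wheel.len (p.toFunctor.map f)
    zify
    rw [len_toFunctor_map, len_toFunctor_map]
    simp

theorem shiftTgt_period_toFunctor (p : PeriodicMap n m) (c : ℤ) :
    (p.shiftTgt (c * ((m : ℕ) : ℤ))).toFunctor = p.toFunctor := by
  rw [shiftTgt_toFunctor]
  have : ((c * ((m : ℕ) : ℤ) : ℤ) : ZMod (m : ℕ)) = 0 := by simp
  rw [this, Wheel.rot_zero]
  rfl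

theorem scale_toFunctor_comp_proj (l : ℕ+) (p : PeriodicMap n m) :
    (p.scale l).toFunctor ⋙ Wheel.proj m l = Wheel.proj n l ⋙ p.toFunctor := by
  have h (y : Wheel (n * l)) : (Wheel.proj n l).obj y =
      ⟨((y.res.val : ℤ) : ZMod (n : ℕ))⟩ := by
    refine Wheel.ext ?_
    change Wheel.reduce n l y.res = _
    conv_lhs => rw [← intCast_cast y.res]
    rw [map_intCast]
  refine Wheel.functor_ext (fun y => ?_) (fun y y' f => ?_)
  · rw [Functor.comp_obj, Functor.comp_obj, h, toFunctor_obj_intCast]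
    refine Wheel.ext ?_
    change Wheel.reduce m l ((p.toFun (y.res.val : ℤ) : ℤ) : ZMod _) = _
    rw [map_intCast]
  · change Wheel.len ((p.scale l).toFunctor.map f) = _
    zify
    rw [Functor.comp_map, len_toFunctor_map_intCast p _ _ (h y), len_toFunctor_map]
    rfl

theorem eq_shiftTgt_of_len_eq (p q : PeriodicMap n m)
    (h : ∀ (y y' : Wheel n) (f : y ⟶ y'),
      Wheel.len (p.toFunctor.map f) = Wheel.len (q.toFunctor.map f)) :
    q = p.shiftTgt (q.toFun 0 - p.toFun 0) := by
  have hnat (x : ℕ) : p.toFun x - p.toFun 0 = q.toFun x - q.toFun 0 := by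
    have hx := h ⟨0⟩ ⟨(x : ZMod (n : ℕ))⟩ (Wheel.homMk x (zero_add _))
    zify at hx
    rw [len_toFunctor_map_intCast p 0 _ (by simp), len_toFunctor_map_intCast q 0 _ (by simp)] at hx
    simpa using hx
  refine PeriodicMap.ext (funext fun x => ?_)
  obtain ⟨c, b, hb⟩ : ∃ (c : ℤ) (b : ℕ), x = (b : ℤ) + c * ((n : ℕ) : ℤ) := by
    have hn : ((n : ℕ) : ℤ) ≠ 0 := by exact_mod_cast n.ne_zero
    refine ⟨x / ((n : ℕ) : ℤ), (x % ((n : ℕ) : ℤ)).toNat, ?_⟩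
    rw [Int.toNat_of_nonneg (Int.emod_nonneg _ hn), mul_comm]
    exact (Int.emod_add_mul_ediv _ _).symm
  rw [hb, shiftTgt_toFun, period_mul, period_mul]
  linarith [hnat b]

/-- Lifts along the covering `[ml]_Λ → [m]_Λ` are unique up to deck transformations. -/
theorem exists_shiftTgt_of_comp_proj_eq {l : ℕ+} (p q : PeriodicMap n (m * l))
    (h : p.toFunctor ⋙ Wheel.proj m l = q.toFunctor ⋙ Wheel.proj m l) :
    ∃ c : ℤ, q = p.shiftTgt (c * ((m : ℕ) : ℤ)) := by
  have hlen (y y' : Wheel n) (f : y ⟶ y') :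
      Wheel.len (p.toFunctor.map f) = Wheel.len (q.toFunctor.map f) := by
    have := Functor.congr_hom h f
    have h' := congrArg Wheel.len this
    rw [Wheel.len_comp, Wheel.len_comp, Wheel.len_eqToHom, Wheel.len_eqToHom, zero_add,
      add_zero] at h'
    exact h'
  have hobj := congrArg Wheel.res (Functor.congr_obj h ⟨((0 : ℤ) : ZMod (n : ℕ))⟩)
  rw [Functor.comp_obj, Functor.comp_obj, toFunctor_obj_intCast, toFunctor_obj_intCast] at hobj
  change Wheel.reduce m l _ = Wheel.reduce m l _ at hobj
  rw [map_intCast, map_intCast] at hobj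
  obtain ⟨c, hc⟩ := (ZMod.intCast_eq_intCast_iff_dvd_sub _ _ _).1 hobj
  refine ⟨c, (eq_shiftTgt_of_len_eq p q hlen).trans ?_⟩
  exact congrArg p.shiftTgt (hc.trans (mul_comm _ _))

/-- Unwinding of a functor `[n]_Λ ⥤ [m]_Λ` of degree `d` to a map of the universal covers. -/
theorem exists_unwinding (F : Wheel n ⥤ Wheel m) (d : ℕ) (hF : Wheel.HasDegree F d) :
    ∃ φ : ℤ → ℤ, Monotone φ ∧
      (∀ x : ℤ, φ (x + ((n : ℕ) : ℤ)) = φ x + (d : ℤ) * ((m : ℕ) : ℤ)) ∧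
      (∀ y : Wheel n, F.obj y = ⟨((φ (y.res.val : ℤ) : ℤ) : ZMod (m : ℕ))⟩) ∧
      ∀ (y y' : Wheel n) (f : y ⟶ y'),
        (Wheel.len (F.map f) : ℤ) = φ ((y.res.val : ℤ) + Wheel.len f) - φ (y.res.val : ℤ) := by
  have hn : (0 : ℤ) < ((n : ℕ) : ℤ) := by exact_mod_cast n.pos
  -- The length of the image of the path of length `b` that starts at `0`.
  let L : ℕ → ℕ := fun b =>
    Wheel.len (F.map (Wheel.homMk b (zero_add _) : (⟨0⟩ : Wheel n) ⟶ ⟨(b : ZMod (n : ℕ))⟩))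
  have hL0 {y' : Wheel n} (g : (⟨0⟩ : Wheel n) ⟶ y') : L (Wheel.len g) = Wheel.len (F.map g) := by
    have hy' : y' = ⟨(Wheel.len g : ZMod (n : ℕ))⟩ :=
      Wheel.ext ((Wheel.len_cond g).symm.trans (zero_add _))
    obtain ⟨b, hb⟩ : ∃ b, b = Wheel.len g := ⟨_, rfl⟩
    rw [← hb] at hy' ⊢
    subst hy'
    change Wheel.len (F.map _) = _
    congr 2
    exact Wheel.hom_ext hb
  have hL (b : ℕ) {y y' : Wheel n} (hy : y = ⟨(b : ZMod (n : ℕ))⟩) (f : y ⟶ y') :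
      L (b + Wheel.len f) = L b + Wheel.len (F.map f) := by
    subst hy
    rw [← Wheel.len_comp (F.map _) (F.map f), ← F.map_comp, ← hL0]
    rfl
  have hLn (b : ℕ) : L (b + (n : ℕ)) = L b + d * (m : ℕ) := by
    have := hL b rfl (Wheel.tau (⟨(b : ZMod (n : ℕ))⟩ : Wheel n))
    rw [(Wheel.hasDegree_iff F d).1 hF] at this
    exact this
  have hLmono : Monotone L := monotone_nat_of_le_succ fun b => by
    have := hL b rfl (Wheel.homMk 1 (by push_cast; rfl) :
      (⟨(b : ZMod (n : ℕ))⟩ : Wheel n) ⟶ ⟨((b + 1 : ℕ) : ZMod (n : ℕ))⟩)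
    rw [Wheel.len_homMk] at this
    omega
  have hLq (b q : ℕ) : (L (b + q * (n : ℕ)) : ℤ) = L b + q * ((d : ℤ) * ((m : ℕ) : ℤ)) := by
    induction q with
    | zero => simp
    | succ q ih =>
      rw [show b + (q + 1) * (n : ℕ) = b + q * (n : ℕ) + (n : ℕ) by ring, hLn, Nat.cast_add, ih]
      push_cast
      ring
  let v : ℤ := ((F.obj ⟨0⟩).res.val : ℤ)
  let φ : ℤ → ℤ := fun x => v + L (x % ((n : ℕ) : ℤ)).toNat +
    (x / ((n : ℕ) : ℤ)) * ((d : ℤ) * ((m : ℕ) : ℤ))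
  have hφ (b : ℕ) (q : ℤ) : φ ((b : ℤ) + q * ((n : ℕ) : ℤ)) =
      v + L b + q * ((d : ℤ) * ((m : ℕ) : ℤ)) := by
    have h1 : ((b : ℤ) + q * ((n : ℕ) : ℤ)) % ((n : ℕ) : ℤ) = ((b % (n : ℕ) : ℕ) : ℤ) := by
      rw [Int.add_mul_emod_self_right]
      rfl
    have h2 : ((b : ℤ) + q * ((n : ℕ) : ℤ)) / ((n : ℕ) : ℤ) = ((b / (n : ℕ) : ℕ) : ℤ) + q := by
      rw [Int.add_mul_ediv_right _ _ hn.ne']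
      rfl
    change v + (L _ : ℤ) + _ * _ = _
    rw [h1, h2, Int.toNat_natCast]
    have h3 := hLq (b % (n : ℕ)) (b / (n : ℕ))
    rw [mul_comm (b / (n : ℕ)), Nat.mod_add_div] at h3
    rw [h3]
    ring
  have hφ0 (b : ℕ) : φ b = v + L b := by
    have := hφ b 0
    simpa using this
  have hrep (x : ℤ) (q : ℤ) (hq : q * ((n : ℕ) : ℤ) ≤ x) :
      φ x = v + L (x - q * ((n : ℕ) : ℤ)).toNat + q * ((d : ℤ) * ((m : ℕ) : ℤ)) := by
    rw [← hφ, Int.toNat_of_nonneg (by linarith), sub_add_cancel]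
  refine ⟨φ, fun x x' hx => ?_, fun x => ?_, fun y => ?_, fun y y' f => ?_⟩
  · have hq := Int.ediv_mul_le x hn.ne'
    rw [hrep x _ hq, hrep x' _ (hq.trans hx)]
    have : L (x - x / ((n : ℕ) : ℤ) * ((n : ℕ) : ℤ)).toNat ≤
        L (x' - x / ((n : ℕ) : ℤ) * ((n : ℕ) : ℤ)).toNat :=
      hLmono (Int.toNat_le_toNat (by linarith))
    have : (L (x - x / ((n : ℕ) : ℤ) * ((n : ℕ) : ℤ)).toNat : ℤ) ≤
        L (x' - x / ((n : ℕ) : ℤ) * ((n : ℕ) : ℤ)).toNat := by exact_mod_cast this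
    linarith
  · have hq := Int.ediv_mul_le x hn.ne'
    rw [hrep x _ hq, hrep _ (x / ((n : ℕ) : ℤ) + 1) (by linarith)]
    rw [show x + ((n : ℕ) : ℤ) - (x / ((n : ℕ) : ℤ) + 1) * ((n : ℕ) : ℤ) =
      x - x / ((n : ℕ) : ℤ) * ((n : ℕ) : ℤ) by ring]
    ring
  · have hy : y = ⟨((y.res.val : ℕ) : ZMod (n : ℕ))⟩ := Wheel.ext (ZMod.natCast_zmod_val _).symm
    have := Wheel.len_cond (F.map (Wheel.homMk y.res.val (zero_add _) :
      (⟨0⟩ : Wheel n) ⟶ ⟨((y.res.val : ℕ) : ZMod (n : ℕ))⟩))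
    rw [hφ0]
    conv_lhs => rw [hy]
    refine Wheel.ext (this.symm.trans ?_)
    rw [Int.cast_add, intCast_cast, Int.cast_natCast]
  · have := hL y.res.val (Wheel.ext (ZMod.natCast_zmod_val _).symm) f
    have h2 := hφ0 (y.res.val + Wheel.len f)
    rw [Nat.cast_add, this] at h2
    rw [h2, hφ0]
    push_cast
    ring

/-- Every functor `[n]_Λ ⥤ [m]_Λ` of degree `l` lifts along the covering `[ml]_Λ → [m]_Λ` to a
horizontal one. -/
theorem exists_lift {l : ℕ+} (F : Wheel n ⥤ Wheel m) (hF : Wheel.HasDegree F (l : ℕ)) :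
    ∃ p : PeriodicMap n (m * l), p.toFunctor ⋙ Wheel.proj m l = F := by
  obtain ⟨φ, hmono, hper, hobj, hmap⟩ := exists_unwinding F _ hF
  let p : PeriodicMap n (m * l) := ⟨φ, hmono, fun x => by
    rw [hper, PNat.mul_coe, Nat.cast_mul, mul_comm ((l : ℕ) : ℤ)]⟩
  refine ⟨p, Wheel.functor_ext (fun y => ?_) (fun y y' f => ?_)⟩
  · rw [hobj]
    refine Wheel.ext ?_
    change Wheel.reduce m l ((φ (y.res.val : ℤ) : ℤ) : ZMod _) = _
    rw [map_intCast]
  · change Wheel.len (p.toFunctor.map f) = _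
    zify
    rw [hmap, len_toFunctor_map]

theorem exists_toFunctor_eq (F : Wheel n ⥤ Wheel m) (hF : Wheel.IsHorizontal F) :
    ∃ p : PeriodicMap n m, p.toFunctor = F := by
  obtain ⟨φ, hmono, hper, hobj, hmap⟩ := exists_unwinding F _ hF
  let p : PeriodicMap n m := ⟨φ, hmono, fun x => by rw [hper, Nat.cast_one, one_mul]⟩
  refine ⟨p, Wheel.functor_ext (fun y => (hobj y).symm) (fun y y' f => ?_)⟩
  zify
  rw [hmap, len_toFunctor_map]

end PeriodicMap

theorem Wheel.HasDegree.comp_horizontal {a b c : ℕ+} {F : Wheel a ⥤ Wheel b} {d : ℕ}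
    (hF : Wheel.HasDegree F d) {G : Wheel b ⥤ Wheel c} (hG : Wheel.IsHorizontal G) :
    Wheel.HasDegree (F ⋙ G) d := fun y => by
  have h : G.mapEnd (F.obj y) (Wheel.tau (F.obj y) ^ d) = Wheel.tau (G.obj (F.obj y)) ^ d := by
    refine (map_pow (G.mapEnd (F.obj y)) (Wheel.tau (F.obj y)) d).trans ?_
    exact congrArg (fun z : End (G.obj (F.obj y)) => z ^ d)
      ((hG (F.obj y)).trans (pow_one (Wheel.tau (G.obj (F.obj y)))))
  rw [Functor.comp_map, hF y]
  exact h

theorem Wheel.IsHorizontal.comp_hasDegree {a b c : ℕ+} {F : Wheel a ⥤ Wheel b}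
    (hF : Wheel.IsHorizontal F) {G : Wheel b ⥤ Wheel c} {d : ℕ} (hG : Wheel.HasDegree G d) :
    Wheel.HasDegree (F ⋙ G) d := fun y => by
  rw [Functor.comp_map, hF y, pow_one, hG (F.obj y)]
  rfl

/-! ### The retraction onto maps of smaller period -/

namespace PeriodicMap

variable {n m k l : ℕ+}

/-- The conjugate by `j` depends only on the residue of `j` modulo `l`. -/
theorem exists_add_mul_eq (p : PeriodicMap (n * l) (m * l)) (x j : ℤ) :
    ∃ i ∈ Finset.range (l : ℕ), p.toFun (x + j * ((n : ℕ) : ℤ)) - j * ((m : ℕ) : ℤ) =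
      p.toFun (x + (i : ℤ) * ((n : ℕ) : ℤ)) - (i : ℤ) * ((m : ℕ) : ℤ) := by
  have hl : (0 : ℤ) < ((l : ℕ) : ℤ) := by exact_mod_cast l.pos
  have h0 := Int.emod_nonneg j hl.ne'
  refine ⟨(j % ((l : ℕ) : ℤ)).toNat, ?_, ?_⟩
  · have := Int.emod_lt_of_pos j hl
    rw [Finset.mem_range]
    omega
  · rw [Int.toNat_of_nonneg h0]
    have hj := Int.emod_add_mul_ediv j ((l : ℕ) : ℤ)
    have hp := p.period_mul (x + (j % ((l : ℕ) : ℤ)) * ((n : ℕ) : ℤ)) (j / ((l : ℕ) : ℤ))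
    rw [PNat.mul_coe, PNat.mul_coe, Nat.cast_mul, Nat.cast_mul] at hp
    have e1 : x + (j % ((l : ℕ) : ℤ)) * ((n : ℕ) : ℤ) +
        j / ((l : ℕ) : ℤ) * (((n : ℕ) : ℤ) * ((l : ℕ) : ℤ)) = x + j * ((n : ℕ) : ℤ) := by
      conv_rhs => rw [← hj]
      ring
    rw [e1] at hp
    rw [hp]
    linear_combination (((m : ℕ) : ℤ)) * hj

/-- The values whose maximum is the value of the retraction. -/
def translates (p : PeriodicMap (n * l) (m * l)) (x : ℤ) : Set ℤ :=
  Set.range fun j : ℤ => p.toFun (x + j * ((n : ℕ) : ℤ)) - j * ((m : ℕ) : ℤ)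

theorem translates_finite (p : PeriodicMap (n * l) (m * l)) (x : ℤ) : (p.translates x).Finite := by
  refine ((Finset.range (l : ℕ)).finite_toSet.image fun i : ℕ =>
    p.toFun (x + (i : ℤ) * ((n : ℕ) : ℤ)) - (i : ℤ) * ((m : ℕ) : ℤ)).subset ?_
  rintro _ ⟨j, rfl⟩
  obtain ⟨i, hi, h⟩ := p.exists_add_mul_eq x j
  exact ⟨i, hi, h.symm⟩

/-- The maximum over `j` of `p (x + j n) - j m`. -/
noncomputable def retractFun (p : PeriodicMap (n * l) (m * l)) (x : ℤ) : ℤ := sSup (p.translates x)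

theorem isGreatest_retractFun (p : PeriodicMap (n * l) (m * l)) (x : ℤ) :
    IsGreatest (p.translates x) (p.retractFun x) :=
  ⟨Int.csSup_mem (Set.range_nonempty _) (p.translates_finite x).bddAbove,
    fun _ h => le_csSup (p.translates_finite x).bddAbove h⟩

theorem le_retractFun (p : PeriodicMap (n * l) (m * l)) (x j : ℤ) :
    p.toFun (x + j * ((n : ℕ) : ℤ)) - j * ((m : ℕ) : ℤ) ≤ p.retractFun x :=
  (p.isGreatest_retractFun x).2 ⟨j, rfl⟩

theorem retractFun_le_iff (p : PeriodicMap (n * l) (m * l)) (x c : ℤ) :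
    p.retractFun x ≤ c ↔ ∀ j : ℤ, p.toFun (x + j * ((n : ℕ) : ℤ)) - j * ((m : ℕ) : ℤ) ≤ c :=
  (isLUB_le_iff (p.isGreatest_retractFun x).isLUB).trans Set.forall_mem_range

/-- The retraction of the maps of periods `nl`, `ml` onto those of periods `n`, `m`: the maximum
over `j` of the conjugates `x ↦ p (x + j n) - j m`. -/
noncomputable def retract (p : PeriodicMap (n * l) (m * l)) : PeriodicMap n m where
  toFun := p.retractFun
  mono x x' h := (p.retractFun_le_iff x _).2 fun j =>
    (sub_le_sub_right (p.mono (add_le_add_left h _)) _).trans (p.le_retractFun x' j)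
  period x := by
    refine eq_of_forall_ge_iff fun c => ?_
    rw [← le_sub_iff_add_le, retractFun_le_iff, retractFun_le_iff]
    refine ⟨fun h j => ?_, fun h j => ?_⟩
    · have := h (j - 1)
      rw [show x + ((n : ℕ) : ℤ) + (j - 1) * ((n : ℕ) : ℤ) = x + j * ((n : ℕ) : ℤ) by ring] at this
      linarith
    · have := h (j + 1)
      rw [show x + (j + 1) * ((n : ℕ) : ℤ) = x + ((n : ℕ) : ℤ) + j * ((n : ℕ) : ℤ) by ring] at this
      linarith

theorem retract_le_iff (p : PeriodicMap (n * l) (m * l)) (x c : ℤ) :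
    p.retract.toFun x ≤ c ↔ ∀ j : ℤ, p.toFun (x + j * ((n : ℕ) : ℤ)) - j * ((m : ℕ) : ℤ) ≤ c :=
  p.retractFun_le_iff x c

theorem retract_scale (p : PeriodicMap n m) : (p.scale l).retract = p := by
  refine PeriodicMap.ext (funext fun x => eq_of_forall_ge_iff fun c => ?_)
  rw [retract_le_iff]
  simp only [scale_toFun, period_mul, add_sub_cancel_right, forall_const]

theorem retract_shiftTgt (p : PeriodicMap (n * l) (m * l)) (a : ℤ) :
    (p.shiftTgt a).retract = p.retract.shiftTgt a := by
  refine PeriodicMap.ext (funext fun x => eq_of_forall_ge_iff fun c => ?_)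
  rw [shiftTgt_toFun, ← le_sub_iff_add_le, retract_le_iff, retract_le_iff]
  refine forall_congr' fun j => ?_
  rw [shiftTgt_toFun]
  constructor <;> intro h <;> linarith

theorem retract_shiftSrc (p : PeriodicMap (n * l) (m * l)) (a : ℤ) :
    (p.shiftSrc a).retract = p.retract.shiftSrc a := by
  refine PeriodicMap.ext (funext fun x => eq_of_forall_ge_iff fun c => ?_)
  rw [shiftSrc_toFun, retract_le_iff, retract_le_iff]
  simp only [shiftSrc_toFun, add_right_comm]

theorem retract_comp_scale (p : PeriodicMap (n * l) (m * l)) (q : PeriodicMap m k) :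
    (p.comp (q.scale l)).retract = p.retract.comp q := by
  refine PeriodicMap.ext (funext fun x => le_antisymm ?_ ?_)
  · rw [retract_le_iff]
    intro j
    have h1 := q.mono (p.le_retractFun x j)
    have h2 := q.period_mul (p.toFun (x + j * ((n : ℕ) : ℤ))) (-j)
    rw [neg_mul, neg_mul, ← sub_eq_add_neg, ← sub_eq_add_neg] at h2
    rw [h2] at h1
    exact h1
  · obtain ⟨j, hj⟩ := (p.isGreatest_retractFun x).1
    have h2 := q.period_mul (p.toFun (x + j * ((n : ℕ) : ℤ))) (-j)
    rw [neg_mul, neg_mul, ← sub_eq_add_neg, ← sub_eq_add_neg] at h2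
    change q.toFun (p.retractFun x) ≤ _
    rw [← hj]
    dsimp only
    rw [h2]
    exact (p.comp (q.scale l)).le_retractFun x j

/-- The automorphism `p ↦ p (x - n) + m` of the maps of periods `nl`, `ml`. Its fixed points are
the maps of periods `n`, `m`. -/
def deck (p : PeriodicMap (n * l) (m * l)) : PeriodicMap (n * l) (m * l) :=
  (p.shiftSrc (-((n : ℕ) : ℤ))).shiftTgt ((m : ℕ) : ℤ)

theorem deck_toFun (p : PeriodicMap (n * l) (m * l)) (x : ℤ) :
    p.deck.toFun x = p.toFun (x - ((n : ℕ) : ℤ)) + ((m : ℕ) : ℤ) := rfl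

theorem deck_scale (p : PeriodicMap n m) : (p.scale l).deck = p.scale l := by
  refine PeriodicMap.ext (funext fun x => ?_)
  rw [deck_toFun, scale_toFun, scale_toFun, ← p.period, sub_add_cancel]

theorem retract_deck (p : PeriodicMap (n * l) (m * l)) : p.deck.retract = p.retract := by
  rw [deck, retract_shiftTgt, retract_shiftSrc]
  refine PeriodicMap.ext (funext fun x => ?_)
  rw [shiftTgt_toFun, shiftSrc_toFun, ← period, neg_add_cancel_right]

theorem deck_sup_scale (p : PeriodicMap (n * l) (m * l)) (q : PeriodicMap n m) :
    (p.sup (q.scale l)).deck = p.deck.sup (q.scale l) := by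
  refine PeriodicMap.ext (funext fun x => ?_)
  have : (q.scale l).toFun x = (q.scale l).toFun (x - ((n : ℕ) : ℤ)) + ((m : ℕ) : ℤ) := by
    conv_lhs => rw [← deck_scale]
    rfl
  rw [deck_toFun, sup_toFun, sup_toFun, this, deck_toFun, max_add_add_right]

theorem deck_comp_scale (p : PeriodicMap (n * l) (m * l)) (q : PeriodicMap m k) :
    (p.comp (q.scale l)).deck = p.deck.comp (q.scale l) := by
  refine PeriodicMap.ext (funext fun x => ?_)
  rw [deck_toFun, comp_toFun, comp_toFun, deck_toFun, scale_toFun, scale_toFun, q.period]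

/-- A grading of the maps of periods `nl`, `ml` that is raised by a translation of the source and
not changed by `deck`: the first argument at which the retraction is nonnegative. -/
noncomputable def degree (p : PeriodicMap (n * l) (m * l)) : ℤ := p.retract.sharpFun 0

theorem degree_deck (p : PeriodicMap (n * l) (m * l)) : p.deck.degree = p.degree := by
  rw [degree, retract_deck, degree]

theorem degree_shiftSrc (p : PeriodicMap (n * l) (m * l)) :
    (p.shiftSrc (-1)).degree = p.degree + 1 := by
  refine eq_of_forall_ge_iff fun c => ?_
  rw [degree, degree, retract_shiftSrc]
  refine (sharpFun_gc _ 0 c).trans ?_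
  rw [← le_sub_iff_add_le]
  rw [shiftSrc_toFun, ← sub_eq_add_neg]
  exact (sharpFun_gc p.retract 0 (c - 1)).symm

theorem comp_sup (p q : PeriodicMap n m) (r : PeriodicMap m k) :
    (p.sup q).comp r = (p.comp r).sup (q.comp r) :=
  PeriodicMap.ext (funext fun _ => r.mono.map_max)

theorem ofSimplex_nonneg_iff {a b : SimplexCategory} (f : a ⟶ b) (x : ℤ) :
    0 ≤ (ofSimplex f).toFun x ↔ 0 ≤ x := by
  have ha : (0 : ℤ) < (a.len : ℤ) + 1 := by omega
  have hb : (0 : ℤ) < (b.len : ℤ) + 1 := by omega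
  have h1 := Int.emod_nonneg x ha.ne'
  have h2 := Int.emod_lt_of_pos x ha
  have hf := (f.toOrderHom ⟨(x % (a.len + 1 : ℤ)).toNat, by omega⟩).2
  have hd : 0 ≤ x ↔ 0 ≤ x / ((a.len : ℤ) + 1) := (Int.ediv_nonneg_iff_of_pos ha).symm
  rw [hd]
  change 0 ≤ (((f.toOrderHom ⟨(x % (a.len + 1 : ℤ)).toNat, by omega⟩ : Fin (b.len + 1)) : ℕ) : ℤ) +
    ((b.len : ℤ) + 1) * (x / ((a.len : ℤ) + 1)) ↔ _
  constructor
  · intro h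
    by_contra hneg
    have : x / ((a.len : ℤ) + 1) ≤ -1 := by omega
    have := mul_le_mul_of_nonneg_left this hb.le
    have hf' : (((f.toOrderHom ⟨(x % (a.len + 1 : ℤ)).toNat, by omega⟩ : Fin (b.len + 1)) : ℕ) : ℤ)
      < (b.len : ℤ) + 1 := by exact_mod_cast hf
    linarith
  · intro h
    have := mul_nonneg hb.le h
    positivity

theorem sharp_ofSimplex_zero {a b : SimplexCategory} (f : a ⟶ b) :
    (ofSimplex f).sharp.toFun 0 = 0 :=
  eq_of_forall_ge_iff fun x => ((ofSimplex f).sharpFun_gc 0 x).trans (ofSimplex_nonneg_iff f x)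

end PeriodicMap

/-! ### The simplicial sets of periodic maps -/

section

open Simplicial MonoidalCategory

/-- The simplicial set of periodic maps with source period `n l`. Its `k`-simplices are the maps
`p` with `p (x + n l) = p x + (k + 1) l`. -/
noncomputable def coverSet (n l : ℕ+) : SSet.{0} where
  obj a := PeriodicMap (n * l) (Nat.succPNat a.unop.len * l)
  map f := ↾ fun p => p.comp ((PeriodicMap.ofSimplex f.unop).sharp.scale l)
  map_id a := by
    refine ConcreteCategory.hom_ext _ _ fun p => ?_
    change p.comp ((PeriodicMap.ofSimplex (𝟙 a.unop)).sharp.scale l) = p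
    rw [PeriodicMap.ofSimplex_id, PeriodicMap.sharp_id]
    rfl
  map_comp f g := by
    refine ConcreteCategory.hom_ext _ _ fun p => ?_
    change p.comp ((PeriodicMap.ofSimplex (g.unop ≫ f.unop)).sharp.scale l) = _
    rw [PeriodicMap.ofSimplex_comp, PeriodicMap.sharp_comp]
    rfl

/-- The simplicial set of periodic maps with source period `n`. Its `k`-simplices are the maps
`p` with `p (x + n) = p x + (k + 1)`. -/
noncomputable def baseSet (n : ℕ+) : SSet.{0} where
  obj a := PeriodicMap n (Nat.succPNat a.unop.len)
  map f := ↾ fun p => p.comp (PeriodicMap.ofSimplex f.unop).sharp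
  map_id a := by
    refine ConcreteCategory.hom_ext _ _ fun p => ?_
    change p.comp (PeriodicMap.ofSimplex (𝟙 a.unop)).sharp = p
    rw [PeriodicMap.ofSimplex_id, PeriodicMap.sharp_id]
    rfl
  map_comp f g := by
    refine ConcreteCategory.hom_ext _ _ fun p => ?_
    change p.comp (PeriodicMap.ofSimplex (g.unop ≫ f.unop)).sharp = _
    rw [PeriodicMap.ofSimplex_comp, PeriodicMap.sharp_comp]
    rfl

variable {n l : ℕ+}

/-- The pointwise maximum, as a map of simplicial sets. -/
noncomputable def joinHom (n l : ℕ+) : coverSet n l ⊗ baseSet n ⟶ coverSet n l where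
  app a := ↾ fun x => PeriodicMap.sup (x.1 : PeriodicMap (n * l) (Nat.succPNat a.unop.len * l))
    (PeriodicMap.scale l (x.2 : PeriodicMap n (Nat.succPNat a.unop.len)))
  naturality a b f := by
    refine ConcreteCategory.hom_ext _ _ fun x => ?_
    exact (PeriodicMap.comp_sup (x.1 : PeriodicMap (n * l) (Nat.succPNat a.unop.len * l))
      (PeriodicMap.scale l (x.2 : PeriodicMap n (Nat.succPNat a.unop.len)))
      ((PeriodicMap.ofSimplex f.unop).sharp.scale l)).symm

/-- The pointwise maximum with a vertex of `baseSet n`. -/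
noncomputable def cut (l : ℕ+) (v : (baseSet n) _⦋0⦌) : coverSet n l ⟶ coverSet n l where
  app a := ↾ fun p => PeriodicMap.sup (p : PeriodicMap (n * l) (Nat.succPNat a.unop.len * l))
    (PeriodicMap.scale l ((baseSet n).map (SimplexCategory.const a.unop ⦋0⦌ 0).op v :
      PeriodicMap n (Nat.succPNat a.unop.len)))
  naturality a b f := by
    refine ConcreteCategory.hom_ext _ _ fun p => ?_
    have hv : ((baseSet n).map (SimplexCategory.const b.unop ⦋0⦌ 0).op v :
        PeriodicMap n (Nat.succPNat b.unop.len)) =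
        PeriodicMap.comp ((baseSet n).map (SimplexCategory.const a.unop ⦋0⦌ 0).op v)
          (PeriodicMap.ofSimplex f.unop).sharp :=
      (congrArg (fun z => (baseSet n).map z v) (Subsingleton.elim _ _)).trans
        (ConcreteCategory.congr_hom
          ((baseSet n).map_comp (SimplexCategory.const a.unop ⦋0⦌ 0).op f) v)
    exact (congrArg (fun w : PeriodicMap n (Nat.succPNat b.unop.len) =>
      PeriodicMap.sup ((coverSet n l).map f p : PeriodicMap (n * l) (Nat.succPNat b.unop.len * l))
        (w.scale l)) hv).trans (PeriodicMap.comp_sup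
          (p : PeriodicMap (n * l) (Nat.succPNat a.unop.len * l))
          (PeriodicMap.scale l ((baseSet n).map (SimplexCategory.const a.unop ⦋0⦌ 0).op v :
            PeriodicMap n (Nat.succPNat a.unop.len)))
          ((PeriodicMap.ofSimplex f.unop).sharp.scale l)).symm

theorem yonedaEquiv_symm_app_const (e : (baseSet n) _⦋1⦌) (a : SimplexCategoryᵒᵖ) (i j : Fin 2)
    (θ : (Δ[1] : SSet.{0}).obj a) (hθ : ∀ k, SSet.stdSimplex.objEquiv θ k = j)
    (hij : SimplexCategory.δ i 0 = j) :
    (SSet.yonedaEquiv.symm e).app a θ =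
      (baseSet n).map (SimplexCategory.const a.unop ⦋0⦌ 0).op ((baseSet n).δ i e) := by
  have h : SSet.stdSimplex.objEquiv θ =
      SimplexCategory.const a.unop ⦋0⦌ 0 ≫ SimplexCategory.δ i := by
    ext k : 3
    exact (hθ k).trans hij.symm
  change (baseSet n).map (SSet.stdSimplex.objEquiv θ).op e = _
  rw [h, op_comp, (baseSet n).map_comp]
  rfl

open SSet in
/-- An edge of `baseSet n` gives a homotopy between the maps defined by its ends. -/
noncomputable def cutHomotopy (l : ℕ+) (e : (baseSet n) _⦋1⦌) :
    SSet.Homotopy (cut l ((baseSet n).δ 1 e)) (cut l ((baseSet n).δ 0 e)) where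
  h := (coverSet n l ◁ SSet.yonedaEquiv.symm e) ≫ joinHom n l
  h₀ := by
    refine NatTrans.ext (funext fun a => ConcreteCategory.hom_ext _ _ fun p => ?_)
    exact congrArg (fun w : PeriodicMap n (Nat.succPNat a.unop.len) => PeriodicMap.sup
      (p : PeriodicMap (n * l) (Nat.succPNat a.unop.len * l)) (w.scale l))
      (yonedaEquiv_symm_app_const e a 1 0 _ (fun k => rfl) rfl)
  h₁ := by
    refine NatTrans.ext (funext fun a => ConcreteCategory.hom_ext _ _ fun p => ?_)
    exact congrArg (fun w : PeriodicMap n (Nat.succPNat a.unop.len) => PeriodicMap.sup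
      (p : PeriodicMap (n * l) (Nat.succPNat a.unop.len * l)) (w.scale l))
      (yonedaEquiv_symm_app_const e a 0 1 _ (fun k => rfl) rfl)
  rel := by
    refine NatTrans.ext (funext fun a => ConcreteCategory.hom_ext _ _ fun x => ?_)
    exact x.1.2.elim

theorem exists_cutHomotopy_h (e : (baseSet n) _⦋1⦌) {k : ℕ} (i : Fin (k + 1)) :
    ∃ q : PeriodicMap n (Nat.succPNat (k + 1)),
      (cutHomotopy l e).toSimplicialObjectHomotopy.h i =
        ↾ fun p : PeriodicMap (n * l) (Nat.succPNat k * l) =>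
          (p.comp ((PeriodicMap.ofSimplex (SimplexCategory.σ i)).sharp.scale l)).sup
            (q.scale l) :=
  ⟨(SSet.yonedaEquiv.symm e).app (op ⦋k + 1⦌)
    (SSet.prodStdSimplex.nonDegenerateEquiv₁ i).1.2, rfl⟩

end

/-! ### Cutting periodic maps -/

section

open Simplicial

variable {n l : ℕ+}

namespace PeriodicMap

theorem exists_bound {N M : ℕ+} (p q : PeriodicMap N M) :
    ∃ B : ℤ, 0 ≤ B ∧ ∀ x, p.toFun x ≤ q.toFun x + B := by
  refine ⟨|p.toFun 0 - q.toFun 0| + ((M : ℕ) : ℤ), by positivity, fun x => ?_⟩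
  have hN : (0 : ℤ) < ((N : ℕ) : ℤ) := by exact_mod_cast N.pos
  have hx := Int.emod_add_mul_ediv x ((N : ℕ) : ℤ)
  rw [mul_comm] at hx
  have h1 := p.mono (Int.emod_lt_of_pos x hN).le
  have h2 := q.mono (Int.emod_nonneg x hN.ne')
  have h3 := p.period 0
  rw [zero_add] at h3
  rw [h3] at h1
  rw [← hx, p.period_mul, q.period_mul]
  linarith [le_abs_self (p.toFun 0 - q.toFun 0)]

/-- The map `x ↦ ⌈(x - a) / n⌉`. -/
def ceilDiv (n : ℕ+) (a : ℤ) : PeriodicMap n (Nat.succPNat 0) where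
  toFun x := -((a - x) / ((n : ℕ) : ℤ))
  mono x x' h := by
    have hn : (0 : ℤ) < ((n : ℕ) : ℤ) := by exact_mod_cast n.pos
    exact neg_le_neg (Int.ediv_le_ediv hn (by linarith))
  period x := by
    have hn : (0 : ℤ) < ((n : ℕ) : ℤ) := by exact_mod_cast n.pos
    have : a - (x + ((n : ℕ) : ℤ)) = a - x + (-1) * ((n : ℕ) : ℤ) := by ring
    rw [this, Int.add_mul_ediv_right _ _ hn.ne']
    simp [add_comm]

theorem ceilDiv_antitone {a b : ℤ} (h : a ≤ b) (x : ℤ) :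
    (ceilDiv n b).toFun x ≤ (ceilDiv n a).toFun x :=
  neg_le_neg (Int.ediv_le_ediv (by exact_mod_cast n.pos) (by linarith))

theorem ceilDiv_mul (j x : ℤ) :
    (ceilDiv n (j * ((n : ℕ) : ℤ))).toFun x = (ceilDiv n 0).toFun x - j := by
  have hn : (0 : ℤ) < ((n : ℕ) : ℤ) := by exact_mod_cast n.pos
  change -((j * ((n : ℕ) : ℤ) - x) / ((n : ℕ) : ℤ)) = -((0 - x) / ((n : ℕ) : ℤ)) - j
  rw [show j * ((n : ℕ) : ℤ) - x = 0 - x + j * ((n : ℕ) : ℤ) by ring,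
    Int.add_mul_ediv_right _ _ hn.ne']
  ring

theorem ceilDiv_le_succ (a x : ℤ) :
    (ceilDiv n a).toFun x ≤ (ceilDiv n (a + 1)).toFun x + 1 := by
  have hn : (1 : ℤ) ≤ ((n : ℕ) : ℤ) := by exact_mod_cast n.pos
  have h := ceilDiv_mul (n := n)
  have : (ceilDiv n (a + 1)).toFun x = (ceilDiv n (a + 1 - ((n : ℕ) : ℤ))).toFun x - 1 := by
    have h : a + 1 - x = a + 1 - ((n : ℕ) : ℤ) - x + 1 * ((n : ℕ) : ℤ) := by ring
    change -((a + 1 - x) / ((n : ℕ) : ℤ)) = -((a + 1 - ((n : ℕ) : ℤ) - x) / ((n : ℕ) : ℤ)) - 1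
    rw [h, Int.add_mul_ediv_right _ _ (by omega)]
    ring
  rw [this]
  have := ceilDiv_antitone (n := n) (show a + 1 - ((n : ℕ) : ℤ) ≤ a by linarith) x
  linarith

/-- The edge of `baseSet n` from `ceilDiv n a` to `ceilDiv n (a + 1)`. -/
def ceilDivEdge (n : ℕ+) (a : ℤ) : PeriodicMap n (Nat.succPNat 1) where
  toFun x := (ceilDiv n a).toFun x + (ceilDiv n (a + 1)).toFun x
  mono _ _ h := add_le_add ((ceilDiv n a).mono h) ((ceilDiv n (a + 1)).mono h)
  period x := by
    rw [(ceilDiv n a).period, (ceilDiv n (a + 1)).period]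
    simp
    ring

theorem ofSimplex_vertex {b : SimplexCategory} (f : ⦋0⦌ ⟶ b) (x : ℤ) :
    (ofSimplex f).toFun x = ((f.toOrderHom 0 : Fin (b.len + 1)) : ℤ) + (b.len + 1) * x := by
  have h := (ofSimplex f).period_mul 0 x
  have h0 : (ofSimplex f).toFun 0 = ((f.toOrderHom 0 : Fin (b.len + 1)) : ℤ) := by
    change (((f.toOrderHom _ : Fin (b.len + 1)) : ℕ) : ℤ) + (b.len + 1 : ℤ) * (0 / _) = _
    rw [Int.zero_ediv, mul_zero, add_zero]
    rfl
  rw [h0] at h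
  simp only [Nat.succPNat_coe, SimplexCategory.len_mk] at h
  push_cast at h
  rw [zero_add, mul_one] at h
  rw [h]
  ring

theorem sharp_vertex_le_iff {b : SimplexCategory} (f : ⦋0⦌ ⟶ b) (y x : ℤ) :
    (ofSimplex f).sharp.toFun y ≤ x ↔
      y ≤ ((f.toOrderHom 0 : Fin (b.len + 1)) : ℤ) + (b.len + 1) * x :=
  ((ofSimplex f).sharpFun_gc y x).trans (by rw [ofSimplex_vertex])

theorem sharp_const (k : ℕ) (y : ℤ) :
    (ofSimplex (SimplexCategory.const ⦋k⦌ ⦋0⦌ 0)).sharp.toFun y = ((k : ℤ) + 1) * y := by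
  have h := (ofSimplex (SimplexCategory.const ⦋k⦌ ⦋0⦌ 0)).sharp.period_mul 0 y
  rw [sharp_ofSimplex_zero] at h
  simp only [Nat.succPNat_coe, SimplexCategory.len_mk] at h
  push_cast at h
  rw [show (0 : ℤ) + y * 1 = y by ring] at h
  rw [h]
  ring

end PeriodicMap

open PeriodicMap

theorem baseSet_δ_one_ceilDivEdge (n : ℕ+) (a : ℤ) :
    (baseSet n).δ 1 (ceilDivEdge n a) = ceilDiv n a := by
  refine PeriodicMap.ext (funext fun x => eq_of_forall_ge_iff fun c => ?_)
  have h1 := ceilDiv_antitone (n := n) (show a ≤ a + 1 by omega) x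
  have h2 := ceilDiv_le_succ (n := n) a x
  refine (sharp_vertex_le_iff (SimplexCategory.δ (1 : Fin 2)) _ c).trans ?_
  change (ceilDiv n a).toFun x + (ceilDiv n (a + 1)).toFun x ≤ 0 + ((1 : ℕ) + 1) * c ↔ _
  push_cast
  omega

theorem baseSet_δ_zero_ceilDivEdge (n : ℕ+) (a : ℤ) :
    (baseSet n).δ 0 (ceilDivEdge n a) = ceilDiv n (a + 1) := by
  refine PeriodicMap.ext (funext fun x => eq_of_forall_ge_iff fun c => ?_)
  have h1 := ceilDiv_antitone (n := n) (show a ≤ a + 1 by omega) x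
  have h2 := ceilDiv_le_succ (n := n) a x
  refine (sharp_vertex_le_iff (SimplexCategory.δ (0 : Fin 2)) _ c).trans ?_
  change (ceilDiv n a).toFun x + (ceilDiv n (a + 1)).toFun x ≤ 1 + ((1 : ℕ) + 1) * c ↔ _
  push_cast
  omega

theorem cut_ceilDiv_toFun (a : ℤ) {k : ℕ} (p : PeriodicMap (n * l) (Nat.succPNat k * l)) (x : ℤ) :
    PeriodicMap.toFun ((cut l (ceilDiv n a : (baseSet n) _⦋0⦌)).app (op ⦋k⦌) p :
      PeriodicMap (n * l) (Nat.succPNat k * l)) x =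
      max (p.toFun x) (((k : ℤ) + 1) * (ceilDiv n a).toFun x) :=
  congrArg (max (p.toFun x)) (sharp_const k _)

/-- The values of the totally degenerate `k`-simplex of `baseSet n` on the vertex `ceilDiv n a`. -/
theorem exists_degenerate_ceilDiv (n : ℕ+) (a : ℤ) (k : ℕ) :
    ∃ q : PeriodicMap n (Nat.succPNat k), ∀ x,
      q.toFun x = ((k : ℤ) + 1) * (ceilDiv n a).toFun x :=
  ⟨(ceilDiv n a).comp (ofSimplex (SimplexCategory.const ⦋k⦌ ⦋0⦌ 0)).sharp, fun _ => sharp_const k _⟩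

/-- For large `a`, the maximum with `ceilDiv n a` does not change a given simplex. -/
theorem exists_cut_eq_self {k : ℕ} (p : PeriodicMap (n * l) (Nat.succPNat k * l)) :
    ∃ b : ℤ, ∀ a, b ≤ a → (cut l (ceilDiv n a : (baseSet n) _⦋0⦌)).app (op ⦋k⦌) p = p := by
  obtain ⟨q, hq⟩ := exists_degenerate_ceilDiv n 0 k
  obtain ⟨B, hB0, hB⟩ := exists_bound (q.scale l) p
  refine ⟨B * ((n : ℕ) : ℤ), fun a ha => PeriodicMap.ext (funext fun x => ?_)⟩
  rw [cut_ceilDiv_toFun, max_eq_left]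
  have h1 := ceilDiv_antitone (n := n) ha x
  have h2 := hB x
  rw [ceilDiv_mul] at h1
  rw [scale_toFun, hq] at h2
  nlinarith

/-- For very negative `a`, the maximum of a given simplex with `ceilDiv n a` is `ceilDiv n a`, and
hence of period `n`. -/
theorem exists_cut_mem_range {k : ℕ} (p : PeriodicMap (n * l) (Nat.succPNat k * l)) :
    ∃ b : ℤ, ∀ a, a ≤ b → ∃ q : PeriodicMap n (Nat.succPNat k),
      q.scale l = (cut l (ceilDiv n a : (baseSet n) _⦋0⦌)).app (op ⦋k⦌) p := by
  obtain ⟨q, hq⟩ := exists_degenerate_ceilDiv n 0 k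
  obtain ⟨B, hB0, hB⟩ := exists_bound p (q.scale l)
  refine ⟨-B * ((n : ℕ) : ℤ), fun a ha => ?_⟩
  obtain ⟨q', hq'⟩ := exists_degenerate_ceilDiv n a k
  refine ⟨q', PeriodicMap.ext (funext fun x => ?_)⟩
  rw [cut_ceilDiv_toFun, scale_toFun, hq', max_eq_right]
  have h1 := ceilDiv_antitone (n := n) ha x
  have h2 := hB x
  rw [ceilDiv_mul] at h1
  rw [scale_toFun, hq] at h2
  nlinarith

end

/-! ### Chains of a simplicial set with coefficients -/

section

open Simplicial AlgebraicTopology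

variable {A : Type u} [Ring A]

/-- The linear map `single p x ↦ single (φ p) (ρ x)`. -/
noncomputable def pushforward {X Y : Type} {V : ModuleCat.{u} A} (φ : X → Y) (ρ : V →ₗ[A] V) :
    (X →₀ V) →ₗ[A] (Y →₀ V) :=
  Finsupp.lmapDomain V A φ ∘ₗ Finsupp.mapRange.linearMap ρ

@[simp] theorem pushforward_single {X Y : Type} {V : ModuleCat.{u} A} (φ : X → Y) (ρ : V →ₗ[A] V)
    (p : X) (x : V) :
    pushforward φ ρ (Finsupp.single p x) = Finsupp.single (φ p) (ρ x) := by
  simp [pushforward, Finsupp.mapDomain_single]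

theorem pushforward_ext {X : Type} {V : ModuleCat.{u} A} {B : Type*} [AddCommGroup B] [Module A B]
    {f g : (X →₀ V) →ₗ[A] B} (h : ∀ p x, f (Finsupp.single p x) = g (Finsupp.single p x)) :
    f = g :=
  Finsupp.lhom_ext h

/-- The functor that sends a set `X` to the direct sum of copies of `V` indexed by `X`. -/
noncomputable def directSum (V : ModuleCat.{u} A) : Type ⥤ ModuleCat.{u} A where
  obj X := ModuleCat.of A (X →₀ V)
  map φ := ModuleCat.ofHom (pushforward φ LinearMap.id)
  map_id X := by
    refine ModuleCat.hom_ext (pushforward_ext fun p x => ?_)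
    exact pushforward_single _ _ _ _
  map_comp φ ψ := by
    refine ModuleCat.hom_ext (pushforward_ext fun p x => ?_)
    refine (pushforward_single _ _ _ _).trans ?_
    exact ((congrArg (pushforward ψ LinearMap.id) (pushforward_single φ LinearMap.id p x)).trans
      (pushforward_single _ _ _ _)).symm

/-- The chains of `coverSet n l` with coefficients in `V`, as a simplicial module. -/
noncomputable def coverChains (n l : ℕ+) (V : ModuleCat.{u} A) :
    SimplexCategoryᵒᵖ ⥤ ModuleCat.{u} A :=
  coverSet n l ⋙ directSum V

variable {n l : ℕ+} {V : ModuleCat.{u} A}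

section Relations

variable {k k' : ℕ+}

/-- The submodule of relations generated by `single p.deck (σ x) - single p x` and by the maps of
period `n`. -/
noncomputable def deckRel (n l k : ℕ+) (σ : V →ₗ[A] V) :
    Submodule A (PeriodicMap (n * l) (k * l) →₀ V) :=
  LinearMap.range (pushforward PeriodicMap.deck σ - LinearMap.id) ⊔
    LinearMap.range (pushforward (PeriodicMap.scale l : PeriodicMap n k → _) LinearMap.id)

theorem pushforward_mem_deckRel {σ : V →ₗ[A] V}
    (φ : PeriodicMap (n * l) (k * l) → PeriodicMap (n * l) (k' * l)) (ρ : V →ₗ[A] V)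
    (hφ : ∀ p, φ p.deck = (φ p).deck) (hρ : ∀ x, ρ (σ x) = σ (ρ x))
    (hφ' : ∀ q : PeriodicMap n k, ∃ q' : PeriodicMap n k', q'.scale l = φ (q.scale l))
    {y : PeriodicMap (n * l) (k * l) →₀ V} (hy : y ∈ deckRel n l k σ) :
    pushforward φ ρ y ∈ deckRel n l k' σ := by
  have h : deckRel n l k σ ≤ (deckRel n l k' σ).comap (pushforward φ ρ) := by
    refine sup_le ?_ ?_
    · rintro _ ⟨z, rfl⟩
      refine Submodule.mem_sup_left ⟨pushforward φ ρ z, ?_⟩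
      have : pushforward φ ρ ∘ₗ pushforward PeriodicMap.deck σ =
          pushforward PeriodicMap.deck σ ∘ₗ pushforward φ ρ :=
        pushforward_ext fun p x => by simp [hφ, hρ]
      have hz := LinearMap.congr_fun this z
      simp only [LinearMap.comp_apply] at hz
      simp [hz]
    · rintro _ ⟨z, rfl⟩
      choose ψ hψ using hφ'
      refine Submodule.mem_sup_right ⟨pushforward ψ ρ z, ?_⟩
      have : pushforward (PeriodicMap.scale l) LinearMap.id ∘ₗ pushforward ψ ρ =
          pushforward φ ρ ∘ₗ pushforward (PeriodicMap.scale l) LinearMap.id :=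
        pushforward_ext fun p x => by simp [hψ]
      exact LinearMap.congr_fun this z
  exact h hy

theorem scale_single_mem_deckRel (σ : V →ₗ[A] V) (q : PeriodicMap n k) (x : V) :
    Finsupp.single (q.scale l) x ∈ deckRel n l k σ :=
  Submodule.mem_sup_right ⟨Finsupp.single q x, pushforward_single _ _ _ _⟩

/-- The operator `single p x ↦ single (p (· - 1)) (τ x)`. -/
noncomputable def rotate {N M : ℕ+} (τ : V →ₗ[A] V) :
    (PeriodicMap N M →₀ V) →ₗ[A] (PeriodicMap N M →₀ V) :=
  pushforward (fun p => p.shiftSrc (-1)) τ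

theorem deck_shiftSrc (p : PeriodicMap (n * l) (k * l)) (a : ℤ) :
    (p.shiftSrc a).deck = p.deck.shiftSrc a :=
  PeriodicMap.ext (funext fun x => by
    simp only [PeriodicMap.deck_toFun, PeriodicMap.shiftSrc_toFun, sub_add_eq_add_sub])

theorem rotate_mem_deckRel {σ τ : V →ₗ[A] V} (h : ∀ x, τ (σ x) = σ (τ x))
    {y : PeriodicMap (n * l) (k * l) →₀ V} (hy : y ∈ deckRel n l k σ) :
    rotate τ y ∈ deckRel n l k σ :=
  pushforward_mem_deckRel _ _ (fun p => (deck_shiftSrc p _).symm) h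
    (fun q => ⟨q.shiftSrc (-1), rfl⟩) hy

/-- The component of degree `c`. -/
noncomputable def component (c : ℤ) :
    (PeriodicMap (n * l) (k * l) →₀ V) →ₗ[A] (PeriodicMap (n * l) (k * l) →₀ V) :=
  Finsupp.lsum ℕ fun p => if p.degree = c then Finsupp.lsingle p else 0

theorem component_single (c : ℤ) (p : PeriodicMap (n * l) (k * l)) (x : V) :
    component c (Finsupp.single p x) = if p.degree = c then Finsupp.single p x else 0 := by
  rw [component, Finsupp.lsum_single]
  split_ifs <;> rfl

theorem component_mem_deckRel {σ : V →ₗ[A] V} (c : ℤ)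
    {y : PeriodicMap (n * l) (k * l) →₀ V} (hy : y ∈ deckRel n l k σ) :
    component c y ∈ deckRel n l k σ := by
  have h : deckRel n l k σ ≤ (deckRel n l k σ).comap (component c) := by
    refine sup_le ?_ ?_
    · rintro _ ⟨z, rfl⟩
      refine Submodule.mem_sup_left ⟨component c z, ?_⟩
      have : component (n := n) (l := l) (k := k) c ∘ₗ pushforward PeriodicMap.deck σ =
          pushforward PeriodicMap.deck σ ∘ₗ component c :=
        pushforward_ext fun p x => by
          simp only [LinearMap.comp_apply, pushforward_single, component_single,
            PeriodicMap.degree_deck]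
          split_ifs <;> simp
      have hz := LinearMap.congr_fun this z
      simp only [LinearMap.comp_apply] at hz
      simp [hz]
    · rintro _ ⟨z, rfl⟩
      induction z using Finsupp.induction_linear with
      | zero => simp
      | add f g hf hg => rw [map_add]; exact add_mem hf hg
      | single q x =>
        rw [Submodule.mem_comap, pushforward_single, component_single]
        split_ifs
        · exact scale_single_mem_deckRel σ q x
        · exact zero_mem _
  exact h hy

theorem component_rotate (τ : V →ₗ[A] V) (c : ℤ) (y : PeriodicMap (n * l) (k * l) →₀ V) :
    component (c + 1) (rotate τ y) = rotate τ (component c y) := by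
  refine LinearMap.congr_fun (f := component (c + 1) ∘ₗ rotate τ) (g := rotate τ ∘ₗ component c)
    (pushforward_ext fun p x => ?_) y
  simp only [LinearMap.comp_apply, rotate, pushforward_single, component_single,
    PeriodicMap.degree_shiftSrc, add_left_inj]
  split_ifs <;> simp

theorem exists_component_eq_zero (y : PeriodicMap (n * l) (k * l) →₀ V) :
    ∃ b : ℤ, ∀ c, c < b → component c y = 0 := by
  induction y using Finsupp.induction_linear with
  | zero => exact ⟨0, fun c _ => map_zero _⟩
  | add f g hf hg =>
    obtain ⟨b, hb⟩ := hf
    obtain ⟨b', hb'⟩ := hg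
    refine ⟨min b b', fun c hc => ?_⟩
    rw [map_add, hb c (hc.trans_le (min_le_left _ _)), hb' c (hc.trans_le (min_le_right _ _)),
      add_zero]
  | single p x =>
    refine ⟨p.degree, fun c hc => ?_⟩
    rw [component_single, if_neg hc.ne']

theorem mem_of_component_mem {P : Submodule A (PeriodicMap (n * l) (k * l) →₀ V)}
    (y : PeriodicMap (n * l) (k * l) →₀ V) (h : ∀ c, component c y ∈ P) : y ∈ P := by
  have key : ∃ s : Finset ℤ, y = ∑ c ∈ s, component c y := by
    have : ∀ y : PeriodicMap (n * l) (k * l) →₀ V, ∃ s : Finset ℤ, ∀ t, s ⊆ t →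
        y = ∑ c ∈ t, component c y := by
      intro y
      induction y using Finsupp.induction_linear with
      | zero => exact ⟨∅, fun t _ => by simp⟩
      | add f g hf hg =>
        obtain ⟨s, hs⟩ := hf
        obtain ⟨s', hs'⟩ := hg
        refine ⟨s ∪ s', fun t ht => ?_⟩
        simp only [map_add, Finset.sum_add_distrib]
        rw [← hs t (Finset.union_subset_left ht), ← hs' t (Finset.union_subset_right ht)]
      | single p x =>
        refine ⟨{p.degree}, fun t ht => ?_⟩
        simp only [component_single, Finset.sum_ite_eq]
        rw [if_pos (Finset.singleton_subset_iff.1 ht)]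
    exact ⟨_, (this y).choose_spec _ subset_rfl⟩
  obtain ⟨s, hs⟩ := key
  rw [hs]
  exact sum_mem fun c _ => h c

/-- Rotation acts freely modulo the relations, because it raises the degree. -/
theorem mem_deckRel_of_rotate_sub_mem {σ τ : V →ₗ[A] V} (h : ∀ x, τ (σ x) = σ (τ x))
    {y : PeriodicMap (n * l) (k * l) →₀ V} (hy : rotate τ y - y ∈ deckRel n l k σ) :
    y ∈ deckRel n l k σ := by
  obtain ⟨b, hb⟩ := exists_component_eq_zero y
  refine mem_of_component_mem y fun c => ?_
  have hlow : ∀ c, c < b → component c y ∈ deckRel n l k σ := fun c hc => by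
    rw [hb c hc]; exact zero_mem _
  rcases lt_or_ge c b with hc | hc
  · exact hlow c hc
  · induction c, hc using Int.leInduction with
    | base =>
      have h1 := component_mem_deckRel (b - 1 + 1) hy
      rw [map_sub, component_rotate, hb (b - 1) (by omega), map_zero, zero_sub,
        neg_mem_iff, sub_add_cancel] at h1
      exact h1
    | succ c hc ih =>
      have h1 := component_mem_deckRel (c + 1) hy
      rw [map_sub, component_rotate] at h1
      have := sub_mem (rotate_mem_deckRel h ih) h1
      rwa [sub_sub_cancel] at this

end Relations

end

/-! ### Acyclicity modulo the relations -/

section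

open Simplicial AlgebraicTopology

variable {A : Type u} [Ring A]

/-- The morphisms that map one submodule to another one. -/
def preserving {X Y : ModuleCat.{u} A} (P : Submodule A X) (Q : Submodule A Y) :
    AddSubgroup (X ⟶ Y) where
  carrier := {f | ∀ y ∈ P, f y ∈ Q}
  zero_mem' _ _ := Q.zero_mem
  add_mem' hf hg y hy := Q.add_mem (hf y hy) (hg y hy)
  neg_mem' hf y hy := Q.neg_mem (hf y hy)

/-- A chain complex that is acyclic modulo a subcomplex `R` remains so modulo
`R + range (t - 1)` for every chain endomorphism `t` such that `t - 1` is injective modulo `R`. -/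
theorem exists_boundary_of_injective (K : ChainComplex (ModuleCat.{u} A) ℕ) (t : K ⟶ K)
    (R : ∀ i, Submodule A (K.X i)) (hd : ∀ i j, K.d i j ∈ preserving (R i) (R j))
    (ht : ∀ i, t.f i ∈ preserving (R i) (R i))
    (hinj : ∀ i (y : K.X i), t.f i y - y ∈ R i → y ∈ R i)
    (hex : ∀ j (y : K.X j), (∀ i, K.d j i y ∈ R i) →
      ∃ z : K.X (j + 1), y - K.d (j + 1) j z ∈ R j)
    (j : ℕ) (y : K.X j)
    (hy : ∀ i, K.d j i y ∈ R i ⊔ LinearMap.range ((t.f i).hom - LinearMap.id)) :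
    ∃ z : K.X (j + 1),
      y - K.d (j + 1) j z ∈ R j ⊔ LinearMap.range ((t.f j).hom - LinearMap.id) := by
  have hdd (a b c : ℕ) (x : K.X a) : K.d b c (K.d a b x) = 0 := by
    rw [← ConcreteCategory.comp_apply, K.d_comp_d]; rfl
  have hcomm (a b : ℕ) (x : K.X a) : t.f b (K.d a b x) = K.d a b (t.f a x) := by
    rw [← ConcreteCategory.comp_apply, ← ConcreteCategory.comp_apply, t.comm]
  cases j with
  | zero =>
    obtain ⟨z, hz⟩ := hex 0 y fun i => by
      rw [K.shape 0 i (by simp)]; exact zero_mem _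
    exact ⟨z, Submodule.mem_sup_left hz⟩
  | succ j =>
    obtain ⟨ρ, hρ, _, ⟨w, rfl⟩, hw⟩ := Submodule.mem_sup.1 (hy j)
    have hw' : K.d (j + 1) j y = ρ + (t.f j w - w) := hw.symm
    -- `w` is a cycle modulo `R` because `t - 1` is injective modulo `R`.
    have hdw (i : ℕ) : K.d j i w ∈ R i := by
      refine hinj i _ ?_
      have h0 := hdd (j + 1) j i y
      rw [hw', map_add, map_sub, ← hcomm] at h0
      rw [eq_neg_of_add_eq_zero_right h0]
      exact neg_mem (hd j i ρ hρ)
    obtain ⟨v, hv⟩ := hex j w hdw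
    obtain ⟨z, hz⟩ := hex (j + 1) (y - (t.f (j + 1) v - v)) fun i => by
      by_cases hi : i = j
      · subst hi
        have e : K.d (i + 1) i (y - (t.f (i + 1) v - v)) =
            ρ + (t.f i (w - K.d (i + 1) i v) - (w - K.d (i + 1) i v)) := by
          rw [map_sub, map_sub, hw', ← hcomm, map_sub]
          abel
        rw [e]
        exact add_mem hρ (sub_mem (ht i _ hv) hv)
      · rw [K.shape (j + 1) i (by simp; omega)]; exact zero_mem _
    refine ⟨z, ?_⟩
    have e : y - K.d (j + 2) (j + 1) z =
        (y - (t.f (j + 1) v - v) - K.d (j + 2) (j + 1) z) + (t.f (j + 1) v - v) := by abel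
    rw [e]
    exact add_mem (Submodule.mem_sup_left hz) (Submodule.mem_sup_right ⟨v, rfl⟩)

variable {n l : ℕ+} {V : ModuleCat.{u} A}

/-- The submodules `deckRel` of the terms of `coverChains n l V`. -/
noncomputable def coverRel (n l : ℕ+) (σ : V →ₗ[A] V) (a : SimplexCategoryᵒᵖ) :
    Submodule A ((coverChains n l V).obj a) :=
  deckRel n l (Nat.succPNat a.unop.len) σ

theorem directSum_map_preserving {a b : SimplexCategoryᵒᵖ} (σ : V →ₗ[A] V)
    (φ : (coverSet n l).obj a ⟶ (coverSet n l).obj b)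
    (hφ : ∀ p : PeriodicMap (n * l) (Nat.succPNat a.unop.len * l),
      φ p.deck = PeriodicMap.deck (φ p : PeriodicMap (n * l) (Nat.succPNat b.unop.len * l)))
    (hφ' : ∀ q : PeriodicMap n (Nat.succPNat a.unop.len),
      ∃ q' : PeriodicMap n (Nat.succPNat b.unop.len), q'.scale l = φ (q.scale l)) :
    (directSum V).map φ ∈ preserving (coverRel n l σ a) (coverRel n l σ b) := by
  intro y hy
  have hy' : y ∈ deckRel n l (Nat.succPNat a.unop.len) σ := hy
  have h := @pushforward_mem_deckRel A _ n l V (Nat.succPNat a.unop.len)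
    (Nat.succPNat b.unop.len) σ (fun p => φ p) LinearMap.id hφ (fun _ => rfl) hφ' y hy'
  exact h

theorem coverSet_map_deck {a b : SimplexCategoryᵒᵖ} (f : a ⟶ b)
    (p : PeriodicMap (n * l) (Nat.succPNat a.unop.len * l)) :
    (coverSet n l).map f p.deck =
      PeriodicMap.deck ((coverSet n l).map f p :
        PeriodicMap (n * l) (Nat.succPNat b.unop.len * l)) :=
  (PeriodicMap.deck_comp_scale p (PeriodicMap.ofSimplex f.unop).sharp).symm

theorem coverChains_map_preserving (σ : V →ₗ[A] V) {a b : SimplexCategoryᵒᵖ} (f : a ⟶ b) :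
    (coverChains n l V).map f ∈ preserving (coverRel n l σ a) (coverRel n l σ b) :=
  directSum_map_preserving σ _ (coverSet_map_deck f)
    fun q => ⟨q.comp (PeriodicMap.ofSimplex f.unop).sharp, rfl⟩

/-- The alternating face map complex of `coverChains n l V`. -/
noncomputable abbrev coverComplex (n l : ℕ+) (V : ModuleCat.{u} A) :
    ChainComplex (ModuleCat.{u} A) ℕ :=
  AlternatingFaceMapComplex.obj (coverChains n l V)

theorem coverComplex_d_preserving (σ : V →ₗ[A] V) (i j : ℕ) :
    (coverComplex n l V).d i j ∈
      preserving (coverRel n l σ (op ⦋i⦌)) (coverRel n l σ (op ⦋j⦌)) := by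
  by_cases h : j + 1 = i
  · subst h
    rw [AlternatingFaceMapComplex.obj_d_eq]
    exact sum_mem fun k _ => zsmul_mem (coverChains_map_preserving σ _) _
  · rw [(coverComplex n l V).shape i j h]
    exact zero_mem _

/-- The homotopy of `cutHomotopy`, on chains. -/
noncomputable def cutChainHomotopy (l : ℕ+) (V : ModuleCat.{u} A) (e : (baseSet n) _⦋1⦌) :=
  ((cutHomotopy l e).toSimplicialObjectHomotopy.whiskerRight (directSum V)).toChainHomotopy

theorem cutHomotopy_h_preserving (σ : V →ₗ[A] V) (e : (baseSet n) _⦋1⦌) {k : ℕ}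
    (i : Fin (k + 1)) :
    (directSum V).map ((cutHomotopy l e).toSimplicialObjectHomotopy.h i) ∈
      preserving (coverRel n l σ (op ⦋k⦌)) (coverRel n l σ (op ⦋k + 1⦌)) := by
  obtain ⟨q, hq⟩ := exists_cutHomotopy_h (l := l) e i
  rw [hq]
  refine directSum_map_preserving (a := op ⦋k⦌) (b := op ⦋k + 1⦌) σ _ (fun p => ?_) fun p =>
    ⟨(p.comp (PeriodicMap.ofSimplex (SimplexCategory.σ i)).sharp).sup q, rfl⟩
  refine Eq.trans ?_ (PeriodicMap.deck_sup_scale _ q).symm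
  exact congrArg (fun z : PeriodicMap (n * l) (Nat.succPNat (k + 1) * l) => z.sup (q.scale l))
    (PeriodicMap.deck_comp_scale p _).symm

theorem cutChainHomotopy_preserving (σ : V →ₗ[A] V) (e : (baseSet n) _⦋1⦌) (k : ℕ) :
    (cutChainHomotopy l V e).hom k (k + 1) ∈
      preserving (coverRel n l σ (op ⦋k⦌)) (coverRel n l σ (op ⦋k + 1⦌)) := by
  have : (cutChainHomotopy l V e).hom k (k + 1) = _ :=
    SimplicialObject.Homotopy.ToChainHomotopy.hom_eq _ k
  rw [this]
  exact neg_mem (sum_mem fun i _ => zsmul_mem (cutHomotopy_h_preserving σ e i) _)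

/-- The operator on chains defined by `cut`. -/
noncomputable def cutChains (l : ℕ+) (V : ModuleCat.{u} A) (a : ℤ) (k : ℕ) :
    (coverChains n l V).obj (op ⦋k⦌) ⟶ (coverChains n l V).obj (op ⦋k⦌) :=
  (directSum V).map ((cut l (PeriodicMap.ceilDiv n a : (baseSet n) _⦋0⦌)).app (op ⦋k⦌))

theorem cutChainHomotopy_dNext_mem (σ : V →ₗ[A] V) (e : (baseSet n) _⦋1⦌) (k : ℕ)
    (y : (coverComplex n l V).X k)
    (hy : ∀ i, (coverComplex n l V).d k i y ∈ coverRel n l σ (op ⦋i⦌)) :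
    dNext k (cutChainHomotopy l V e).hom y ∈ coverRel n l σ (op ⦋k⦌) := by
  cases k with
  | zero =>
    rw [dNext_eq_zero _ _ (by simp)]
    exact zero_mem _
  | succ k =>
    rw [dNext_eq (i' := k) _ rfl]
    exact cutChainHomotopy_preserving σ e k _ (hy k)

theorem homotopy_sub_mem {K L : ChainComplex (ModuleCat.{u} A) ℕ} {f g : K ⟶ L}
    (H : Homotopy f g) (k : ℕ) (y : K.X k) (P : Submodule A (L.X k)) (hy : dNext k H.hom y ∈ P) :
    f.f k y - g.f k y ∈ P ⊔ LinearMap.range (L.d (k + 1) k).hom := by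
  have h := H.comm k
  rw [prevD_eq (j' := k + 1) _ rfl] at h
  have hz : f.f k y = dNext k H.hom y + L.d (k + 1) k (H.hom k (k + 1) y) + g.f k y :=
    ConcreteCategory.congr_hom h y
  rw [sub_eq_of_eq_add hz]
  exact add_mem (Submodule.mem_sup_left hy) (Submodule.mem_sup_right ⟨_, rfl⟩)

theorem cutChains_sub_mem (σ : V →ₗ[A] V) (a : ℤ) (k : ℕ) (y : (coverComplex n l V).X k)
    (hy : ∀ i, (coverComplex n l V).d k i y ∈ coverRel n l σ (op ⦋i⦌)) :
    cutChains l V a k y - cutChains l V (a + 1) k y ∈ coverRel n l σ (op ⦋k⦌) ⊔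
      LinearMap.range ((coverComplex n l V).d (k + 1) k).hom := by
  let e : (baseSet n) _⦋1⦌ := PeriodicMap.ceilDivEdge n a
  have h1 : ((alternatingFaceMapComplex _).map (((SimplicialObject.whiskering _ _).obj
      (directSum V)).map (cut l ((baseSet n).δ 1 e)))).f k = cutChains l V a k :=
    congrArg (fun v => (directSum V).map ((cut l v).app (op ⦋k⦌))) (baseSet_δ_one_ceilDivEdge n a)
  have h0 : ((alternatingFaceMapComplex _).map (((SimplicialObject.whiskering _ _).obj
      (directSum V)).map (cut l ((baseSet n).δ 0 e)))).f k = cutChains l V (a + 1) k :=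
    congrArg (fun v => (directSum V).map ((cut l v).app (op ⦋k⦌))) (baseSet_δ_zero_ceilDivEdge n a)
  have hy' := cutChainHomotopy_dNext_mem σ e k y hy
  have hz := homotopy_sub_mem (cutChainHomotopy l V e) k y (coverRel n l σ (op ⦋k⦌)) hy'
  rw [h1, h0] at hz
  exact hz

theorem exists_cutChains_eq_self (k : ℕ) (y : (coverChains n l V).obj (op ⦋k⦌)) :
    ∃ b : ℤ, ∀ a, b ≤ a → cutChains l V a k y = y := by
  change PeriodicMap (n * l) (Nat.succPNat k * l) →₀ V at y
  induction y using Finsupp.induction_linear with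
  | zero => exact ⟨0, fun a _ => map_zero (cutChains l V a k).hom⟩
  | add f g hf hg =>
    obtain ⟨b, hb⟩ := hf
    obtain ⟨b', hb'⟩ := hg
    refine ⟨max b b', fun a ha => ?_⟩
    refine (map_add (cutChains l V a k).hom f g).trans ?_
    exact congrArg₂ (· + ·) (hb a ((le_max_left _ _).trans ha))
      (hb' a ((le_max_right _ _).trans ha))
  | single p x =>
    obtain ⟨b, hb⟩ := exists_cut_eq_self p
    refine ⟨b, fun a ha => (pushforward_single _ _ _ _).trans ?_⟩
    exact congrArg (fun q => Finsupp.single q x) (hb a ha)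

theorem exists_cutChains_mem (σ : V →ₗ[A] V) (k : ℕ) (y : (coverChains n l V).obj (op ⦋k⦌)) :
    ∃ b : ℤ, ∀ a, a ≤ b → cutChains l V a k y ∈ coverRel n l σ (op ⦋k⦌) := by
  change PeriodicMap (n * l) (Nat.succPNat k * l) →₀ V at y
  induction y using Finsupp.induction_linear with
  | zero =>
    refine ⟨0, fun a _ => ?_⟩
    have h : cutChains l V a k (0 : PeriodicMap (n * l) (Nat.succPNat k * l) →₀ V) = 0 :=
      map_zero (cutChains l V a k).hom
    rw [h]
    exact zero_mem _
  | add f g hf hg =>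
    obtain ⟨b, hb⟩ := hf
    obtain ⟨b', hb'⟩ := hg
    refine ⟨min b b', fun a ha => ?_⟩
    have h : cutChains l V a k (f + g) = cutChains l V a k f + cutChains l V a k g :=
      map_add (cutChains l V a k).hom f g
    rw [h]
    exact add_mem (hb a (ha.trans (min_le_left _ _))) (hb' a (ha.trans (min_le_right _ _)))
  | single p x =>
    obtain ⟨b, hb⟩ := exists_cut_mem_range p
    refine ⟨b, fun a ha => ?_⟩
    obtain ⟨q, hq⟩ := hb a ha
    have h : cutChains l V a k (Finsupp.single p x) = Finsupp.single (q.scale l) x :=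
      (pushforward_single _ _ _ _).trans (congrArg (fun q => Finsupp.single q x) hq.symm)
    exact h ▸ scale_single_mem_deckRel σ q x

/-- The chains are acyclic modulo `deckRel`: on a cycle, consecutive cuts differ by a boundary, and
the cuts interpolate between the cycle itself and chains of period `n`. -/
theorem exists_boundary (σ : V →ₗ[A] V) (k : ℕ) (y : (coverComplex n l V).X k)
    (hy : ∀ i, (coverComplex n l V).d k i y ∈ coverRel n l σ (op ⦋i⦌)) :
    ∃ z, y - (coverComplex n l V).d (k + 1) k z ∈ coverRel n l σ (op ⦋k⦌) := by
  obtain ⟨b, hb⟩ := exists_cutChains_eq_self k y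
  obtain ⟨b', hb'⟩ := exists_cutChains_mem σ k y
  have key (a : ℤ) : cutChains l V a k y ∈ coverRel n l σ (op ⦋k⦌) ⊔
      LinearMap.range ((coverComplex n l V).d (k + 1) k).hom := by
    rcases le_total a b' with ha | ha
    · exact Submodule.mem_sup_left (hb' a ha)
    · induction a, ha using Int.leInduction with
      | base => exact Submodule.mem_sup_left (hb' b' le_rfl)
      | succ a ha ih =>
        have h := sub_mem ih (cutChains_sub_mem σ a k y hy)
        exact (sub_sub_cancel (cutChains l V a k y) (cutChains l V (a + 1) k y)) ▸ h
  have h := key b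
  rw [hb b le_rfl] at h
  obtain ⟨ρ, hρ, _, ⟨z, rfl⟩, h⟩ := Submodule.mem_sup.1 h
  refine ⟨z, ?_⟩
  exact (sub_eq_of_eq_add h.symm : y - (coverComplex n l V).d (k + 1) k z = ρ) ▸ hρ

/-- Rotation, as an endomorphism of the chains. -/
noncomputable def rotateHom (n l : ℕ+) (τ : V →ₗ[A] V) : coverChains n l V ⟶ coverChains n l V where
  app a := ModuleCat.ofHom
    (X := PeriodicMap (n * l) (Nat.succPNat a.unop.len * l) →₀ V)
    (Y := PeriodicMap (n * l) (Nat.succPNat a.unop.len * l) →₀ V) (rotate τ)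
  naturality a b f := by
    refine ModuleCat.hom_ext (pushforward_ext fun p x => ?_)
    let φ : PeriodicMap (n * l) (Nat.succPNat a.unop.len * l) →
      PeriodicMap (n * l) (Nat.succPNat b.unop.len * l) := fun p => (coverSet n l).map f p
    have h1 : rotate τ (pushforward φ LinearMap.id (Finsupp.single p x)) =
        Finsupp.single ((φ p).shiftSrc (-1)) (τ x) :=
      (congrArg (rotate τ) (pushforward_single φ LinearMap.id p x)).trans
        (pushforward_single _ τ (φ p) x)
    have h2 : pushforward φ LinearMap.id (rotate τ (Finsupp.single p x)) =
        Finsupp.single (φ (p.shiftSrc (-1))) (τ x) :=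
      (congrArg (pushforward φ LinearMap.id) (pushforward_single _ τ p x)).trans
        (pushforward_single φ LinearMap.id _ _)
    exact h1.trans h2.symm

/-- A simplicial module is acyclic if it is the quotient of the chains of `coverSet n l` by the
relations `deckRel` and by the action of a rotation. -/
theorem exactAt_of_surjective {σ τ : V →ₗ[A] V} (h : ∀ x, τ (σ x) = σ (τ x))
    {D : SimplexCategoryᵒᵖ ⥤ ModuleCat.{u} A} (q : coverChains n l V ⟶ D)
    (hq : ∀ k : ℕ, Function.Surjective (q.app (op ⦋k⦌)))
    (hker : ∀ (k : ℕ) (y : PeriodicMap (n * l) (Nat.succPNat k * l) →₀ V),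
      q.app (op ⦋k⦌) y = 0 ↔ y ∈ deckRel n l (Nat.succPNat k) σ ⊔
        LinearMap.range (rotate τ - LinearMap.id)) (j : ℕ) :
    (AlternatingFaceMapComplex.obj D).ExactAt j := by
  rw [HomologicalComplex.exactAt_iff' _ (j + 1) j (j - 1) (by simp) (by cases j <;> simp),
    ShortComplex.moduleCat_exact_iff]
  intro x hx
  obtain ⟨y, rfl⟩ := hq j x
  have hcomm (a b : ℕ) (x : (coverComplex n l V).X a) :
    q.app (op ⦋b⦌) ((coverComplex n l V).d a b x) =
      (AlternatingFaceMapComplex.obj D).d a b (q.app (op ⦋a⦌) x) :=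
    (ConcreteCategory.congr_hom (((alternatingFaceMapComplex _).map q).comm a b) x).symm
  obtain ⟨z, hz⟩ := exists_boundary_of_injective (coverComplex n l V)
    ((alternatingFaceMapComplex _).map (rotateHom n l τ)) (fun i => coverRel n l σ (op ⦋i⦌))
    (coverComplex_d_preserving σ) (fun i y hy => rotate_mem_deckRel h hy)
    (fun i y hy => mem_deckRel_of_rotate_sub_mem h hy) (exists_boundary σ) j y fun i => by
      refine (hker i _).1 ((hcomm j i y).trans ?_)
      by_cases hi : (ComplexShape.down ℕ).Rel j i
      · obtain rfl : i = j - 1 := by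
          have : i + 1 = j := hi
          omega
        exact hx
      · rw [HomologicalComplex.shape _ _ _ hi]
        rfl
  refine ⟨q.app (op ⦋j + 1⦌) z, (hcomm (j + 1) j z).symm.trans ?_⟩
  have hz' := (map_sub (q.app (op ⦋j⦌)).hom y _).symm.trans ((hker j _).2 hz)
  exact (sub_eq_zero.1 hz').symm

end

/-! ### Elements of left Kan extensions -/

section Kan

variable {C D H : Type*} [Category* C] [Category* D] [Category* H] (L : C ⥤ D)
  [∀ F : C ⥤ H, L.HasPointwiseLeftKanExtension F]

theorem lan_hom_ext (F : C ⥤ H) {d : D} {B : H} {f g : (L.lan.obj F).obj d ⟶ B}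
    (h : ∀ (c : C) (a : L.obj c ⟶ d), (L.lanUnit.app F).app c ≫ (L.lan.obj F).map a ≫ f =
      (L.lanUnit.app F).app c ≫ (L.lan.obj F).map a ≫ g) : f = g := by
  have hl := Functor.isPointwiseLeftKanExtensionOfIsLeftKanExtension (L.lan.obj F)
    (L.lanUnit.app F) d
  refine hl.hom_ext fun j => ?_
  exact (Category.assoc _ _ _).trans ((h j.left j.hom).trans (Category.assoc _ _ _).symm)

theorem exists_lan_desc (F : C ⥤ H) (d : D) (B : H) (β : ∀ c : C, (L.obj c ⟶ d) → (F.obj c ⟶ B))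
    (hβ : ∀ (c c' : C) (u : c ⟶ c') (a : L.obj c' ⟶ d), F.map u ≫ β c' a = β c (L.map u ≫ a)) :
    ∃ f : (L.lan.obj F).obj d ⟶ B, ∀ (c : C) (a : L.obj c ⟶ d),
      (L.lanUnit.app F).app c ≫ (L.lan.obj F).map a ≫ f = β c a := by
  have hl := Functor.isPointwiseLeftKanExtensionOfIsLeftKanExtension (L.lan.obj F)
    (L.lanUnit.app F) d
  let s : Cocone (CostructuredArrow.proj L d ⋙ F) :=
    { pt := B
      ι :=
        { app := fun j => β j.left j.hom
          naturality := fun j j' u => by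
            change F.map u.left ≫ _ = _ ≫ 𝟙 _
            rw [Category.comp_id, hβ, CostructuredArrow.w] } }
  refine ⟨hl.desc s, fun c a => ?_⟩
  exact (Category.assoc _ _ _).symm.trans (hl.fac s (CostructuredArrow.mk a))

end Kan

/-! ### Generators and relations for the Kan extensions -/

/-- The morphism of `Λ` defined by a periodic map. -/
def PeriodicMap.hom {n m : ℕ+} (p : PeriodicMap n m) : (⟨n⟩ : Cyclic) ⟶ ⟨m⟩ :=
  ⟨p.toFunctor, p.toFunctor_isHorizontal⟩

/-- The morphism of `Λ_l` defined by a periodic map. -/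
def PeriodicMap.homL {n m : ℕ+} (l : ℕ+) (p : PeriodicMap n m) :
    CyclicL.of l n ⟶ CyclicL.of l m where
  f := (p.scale l).hom
  g := p.hom
  comm := (PeriodicMap.scale_toFunctor_comp_proj l p).symm

theorem PeriodicMap.hom_comp {n m k : ℕ+} (p : PeriodicMap n m) (q : PeriodicMap m k) :
    (p.comp q).hom = p.hom ≫ q.hom :=
  Subtype.ext (PeriodicMap.toFunctor_comp p q)

theorem PeriodicMap.homL_comp {n m k : ℕ+} (l : ℕ+) (p : PeriodicMap n m) (q : PeriodicMap m k) :
    (p.comp q).homL l = p.homL l ≫ q.homL l :=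
  CyclicL.Hom.ext (PeriodicMap.hom_comp (p.scale l) (q.scale l)) (PeriodicMap.hom_comp p q)

/-- The residue of an integer, as an automorphism of the object of `pt_N`. -/
def residue (N : ℕ+) (a : ℤ) :
    SingleObj.star (CyclicGroup N) ⟶ SingleObj.star (CyclicGroup N) :=
  (Multiplicative.ofAdd (a : ZMod (N : ℕ)) : CyclicGroup N)

/-- The rotation of `[n]` by an integer. -/
def rotHom (n : ℕ+) (a : ℤ) : (⟨n⟩ : Cyclic) ⟶ ⟨n⟩ := (e n).map (residue n a)

/-- The rotation of the object `[n]` of `Λ_l` by an integer. -/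
def rotHomL (n l : ℕ+) (a : ℤ) : CyclicL.of l n ⟶ CyclicL.of l n :=
  (eL n l).map (residue (n * l) a)

theorem PeriodicMap.hom_shiftSrc {n m : ℕ+} (p : PeriodicMap n m) (a : ℤ) :
    (p.shiftSrc a).hom = rotHom n a ≫ p.hom :=
  Subtype.ext (p.shiftSrc_toFunctor a)

theorem PeriodicMap.homL_shiftSrc {n m : ℕ+} (l : ℕ+) (p : PeriodicMap n m) (a : ℤ) :
    (p.shiftSrc a).homL l = rotHomL n l a ≫ p.homL l := by
  refine CyclicL.Hom.ext (PeriodicMap.hom_shiftSrc (p.scale l) a) ?_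
  refine Subtype.ext ((p.shiftSrc_toFunctor a).trans ?_)
  change _ = Wheel.rot n (Wheel.reduce n l (a : ZMod ((n * l : ℕ+) : ℕ))) ⋙ p.toFunctor
  rw [map_intCast]

theorem PeriodicMap.exists_homL_eq {n m l : ℕ+} (u : CyclicL.of l n ⟶ CyclicL.of l m) :
    ∃ p : PeriodicMap n m, p.homL l = u := by
  obtain ⟨c, hc⟩ := PeriodicMap.exists_toFunctor_eq (n := n) (m := m) u.g.1 u.g.2
  obtain ⟨p, hp⟩ := PeriodicMap.exists_toFunctor_eq (n := n * l) (m := m * l) u.f.1 u.f.2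
  have h : (c.scale l).toFunctor ⋙ Wheel.proj m l = p.toFunctor ⋙ Wheel.proj m l :=
    (c.scale_toFunctor_comp_proj l).trans ((congrArg (Wheel.proj n l ⋙ ·) hc).trans
      (u.comm.trans (congrArg (· ⋙ Wheel.proj m l) hp.symm)))
  obtain ⟨k, rfl⟩ := PeriodicMap.exists_shiftTgt_of_comp_proj_eq _ _ h
  exact ⟨c.shiftTgt (k * ((m : ℕ) : ℤ)), CyclicL.Hom.ext (Subtype.ext hp)
    (Subtype.ext ((c.shiftTgt_period_toFunctor k).trans hc))⟩

/-- A deck transformation of `[m l]_Λ → [m]_Λ`. -/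
def deckShift (l m : ℕ+) (k : ℤ) : (⟨m * l⟩ : Cyclic) ⟶ ⟨m * l⟩ :=
  ⟨Wheel.rot (m * l) ((k * ((m : ℕ) : ℤ) : ℤ) : ZMod ((m * l : ℕ+) : ℕ)),
    Wheel.rot_isHorizontal _ _⟩

/-- A deck transformation of `[m l]_Λ → [m]_Λ`, as an automorphism in `Λ_l`. -/
def deckHom (l m : ℕ+) (k : ℤ) : CyclicL.of l m ⟶ CyclicL.of l m where
  f := deckShift l m k
  g := 𝟙 _
  comm := by
    change Wheel.proj m l ⋙ 𝟭 _ = Wheel.rot (m * l) _ ⋙ Wheel.proj m l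
    rw [Wheel.rot_comp_proj, map_intCast]
    have : ((k * ((m : ℕ) : ℤ) : ℤ) : ZMod (m : ℕ)) = 0 := by simp
    rw [this, Wheel.rot_zero]

theorem PeriodicMap.hom_shiftTgt {n m l : ℕ+} (p : PeriodicMap n (m * l)) (k : ℤ) :
    (p.shiftTgt (k * ((m : ℕ) : ℤ))).hom = p.hom ≫ deckShift l m k :=
  Subtype.ext (p.shiftTgt_toFunctor _)

theorem PeriodicMap.homL_shiftTgt {n m : ℕ+} (l : ℕ+) (p : PeriodicMap n m) (k : ℤ) :
    (p.shiftTgt (k * ((m : ℕ) : ℤ))).homL l = p.homL l ≫ deckHom l m k :=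
  CyclicL.Hom.ext (PeriodicMap.hom_shiftTgt (p.scale l) k)
    (Subtype.ext (p.shiftTgt_period_toFunctor k))

/-- Every morphism of `Λ` from the target of an object of `Λ_l` lifts to `Λ_l`. -/
theorem exists_homL_lift {l : ℕ+} (v : CyclicL l) {m : ℕ+} (g : v.tgt ⟶ ⟨m⟩) :
    ∃ u : v ⟶ CyclicL.of l m, u.g = g := by
  obtain ⟨p, hp⟩ := PeriodicMap.exists_lift (l := l) (v.v ⋙ g.1) (v.degree.comp_horizontal g.2)
  exact ⟨⟨p.hom, g, hp.symm⟩, rfl⟩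

section Generators

variable {A : Type u} [Ring A] {n l : ℕ+}
  (M : ModuleCat.{u} (MonoidAlgebra A (CyclicGroup (n * l))))

/-- The underlying `A`-module of an `A[ℤ/N]`-module. -/
noncomputable abbrev underlying {N : ℕ+} (M : ModuleCat.{u} (MonoidAlgebra A (CyclicGroup N))) :
    ModuleCat.{u} A :=
  (moduleFunctor M).obj (SingleObj.star _)

/-- The action of the residue of an integer on an `A[ℤ/N]`-module. -/
noncomputable def act {N : ℕ+} (M : ModuleCat.{u} (MonoidAlgebra A (CyclicGroup N))) (a : ℤ) :
    underlying M ⟶ underlying M :=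
  (moduleFunctor M).map (residue N a)

theorem act_add {N : ℕ+} (M : ModuleCat.{u} (MonoidAlgebra A (CyclicGroup N))) (a b : ℤ) :
    act M (a + b) = act M a ≫ act M b := by
  refine Eq.trans ?_ ((moduleFunctor M).map_comp _ _)
  refine congrArg (moduleFunctor M).map ?_
  change Multiplicative.ofAdd ((a + b : ℤ) : ZMod (N : ℕ)) =
    Multiplicative.ofAdd (b : ZMod (N : ℕ)) * Multiplicative.ofAdd (a : ZMod (N : ℕ))
  rw [← ofAdd_add, Int.cast_add, add_comm]

theorem act_zero {N : ℕ+} (M : ModuleCat.{u} (MonoidAlgebra A (CyclicGroup N))) :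
    act M 0 = 𝟙 _ := by
  refine Eq.trans ?_ ((moduleFunctor M).map_id _)
  refine congrArg (moduleFunctor M).map ?_
  change Multiplicative.ofAdd ((0 : ℤ) : ZMod (N : ℕ)) = 1
  rw [Int.cast_zero, ofAdd_zero]

/-- The functor `π_{l!} i_l^* e^{nl}_! M`. -/
noncomputable abbrev target : Cyclic ⥤ ModuleCat.{u} A :=
  (piShriek A l).obj (iL l ⋙ eShriek (n * l) M)

/-- The functor `π_{l!} e^n_{l!} M`. -/
noncomputable abbrev source : Cyclic ⥤ ModuleCat.{u} A :=
  (piShriek A l).obj (eLShriek n l M)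

/-- The unit of `e^n_!`, evaluated at the object of `pt_n`. -/
noncomputable def unitE {N : ℕ+} (M : ModuleCat.{u} (MonoidAlgebra A (CyclicGroup N))) :
    underlying M ⟶ (eShriek N M).obj ⟨N⟩ :=
  ((e N).lanUnit.app (moduleFunctor M)).app (SingleObj.star _)

/-- The unit of `e^n_{l!}`, evaluated at the object of `pt_{nl}`. -/
noncomputable def unitEL : underlying M ⟶ (eLShriek n l M).obj (CyclicL.of l n) :=
  ((eL n l).lanUnit.app (moduleFunctor M)).app (SingleObj.star _)

/-- The unit of `π_{l!}`, evaluated at an object of `Λ_l`. -/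
noncomputable def unitPi (E : CyclicL l ⥤ ModuleCat.{u} A) (v : CyclicL l) :
    E.obj v ⟶ ((piShriek A l).obj E).obj v.tgt :=
  ((piL l).lanUnit.app E).app v

theorem act_unitE {N : ℕ+} (M : ModuleCat.{u} (MonoidAlgebra A (CyclicGroup N))) (a : ℤ) :
    act M a ≫ unitE M = unitE M ≫ (eShriek N M).map (rotHom N a) :=
  ((e N).lanUnit.app (moduleFunctor M)).naturality (residue N a)

theorem act_unitEL (a : ℤ) :
    act M a ≫ unitEL M = unitEL M ≫ (eLShriek n l M).map (rotHomL n l a) :=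
  ((eL n l).lanUnit.app (moduleFunctor M)).naturality (residue (n * l) a)

theorem unitPi_naturality (E : CyclicL l ⥤ ModuleCat.{u} A) {v w : CyclicL l} (u : v ⟶ w) :
    E.map u ≫ unitPi E w = unitPi E v ≫ ((piShriek A l).obj E).map u.g :=
  ((piL l).lanUnit.app E).naturality u

/-- The unit of `π_{l!}`, evaluated at the object `[m]` of `Λ_l`. -/
noncomputable def unitPiOf (E : CyclicL l ⥤ ModuleCat.{u} A) (m : ℕ+) :
    E.obj (CyclicL.of l m) ⟶ ((piShriek A l).obj E).obj ⟨m⟩ :=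
  unitPi E (CyclicL.of l m)

theorem unitPiOf_deckHom (E : CyclicL l ⥤ ModuleCat.{u} A) (m : ℕ+) (k : ℤ) :
    E.map (deckHom l m k) ≫ unitPiOf E m = unitPiOf E m :=
  (unitPi_naturality E (deckHom l m k)).trans
    ((congrArg (unitPi E (CyclicL.of l m) ≫ ·)
      (((piShriek A l).obj E).map_id (CyclicL.of l m).tgt)).trans (Category.comp_id _))

theorem unitPiOf_homL (E : CyclicL l ⥤ ModuleCat.{u} A) {m k : ℕ+} (q : PeriodicMap m k) :
    E.map (q.homL l) ≫ unitPiOf E k = unitPiOf E m ≫ ((piShriek A l).obj E).map q.hom :=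
  unitPi_naturality E (q.homL l)

/-- The unit of `π_{l!}` at `[m]`, for the functor `i_l^* e^{nl}_! M`. -/
noncomputable def unitTarget (m : ℕ+) :
    (eShriek (n * l) M).obj ⟨m * l⟩ ⟶ (target M).obj ⟨m⟩ :=
  unitPiOf (iL l ⋙ eShriek (n * l) M) m

theorem unitTarget_deckShift (m : ℕ+) (k : ℤ) :
    (eShriek (n * l) M).map (deckShift l m k) ≫ unitTarget M m = unitTarget M m :=
  unitPiOf_deckHom (iL l ⋙ eShriek (n * l) M) m k

theorem unitTarget_hom {m k : ℕ+} (q : PeriodicMap m k) :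
    (eShriek (n * l) M).map (q.scale l).hom ≫ unitTarget M k =
      unitTarget M m ≫ (target M).map q.hom :=
  unitPiOf_homL (iL l ⋙ eShriek (n * l) M) q

/-- The comparison map at the object `[m]` of `Λ_l`. -/
noncomputable def comparisonOf (m : ℕ+) :
    (eLShriek n l M).obj (CyclicL.of l m) ⟶ (eShriek (n * l) M).obj ⟨m * l⟩ :=
  (comparison n l M).app (CyclicL.of l m)

theorem unitPiOf_comparison (m : ℕ+) :
    unitPiOf (eLShriek n l M) m ≫ ((piShriek A l).map (comparison n l M)).app ⟨m⟩ =
      comparisonOf M m ≫ unitTarget M m :=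
  (congrArg (fun z => z.app (CyclicL.of l m)) ((piL l).lanUnit.naturality (comparison n l M))).symm

theorem unitEL_comparison :
    unitEL M ≫ comparisonOf M n = unitE M := by
  have h := ((eL n l).lanAdjunction (ModuleCat.{u} A)).homEquiv_unit
    (f := comparison n l M)
  rw [comparison, Equiv.apply_symm_apply] at h
  have h' := congrArg (fun z => z.app (SingleObj.star _)) h
  refine Eq.trans ?_ (h'.symm.trans ?_)
  · rfl
  · exact ((congrArg (_ ≫ ·) ((eShriek (n * l) M).map_id _)).trans (Category.comp_id _))

theorem comparison_homL {m k : ℕ+} (p : PeriodicMap m k) :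
    (eLShriek n l M).map (p.homL l) ≫ comparisonOf M k =
      comparisonOf M m ≫ (eShriek (n * l) M).map (p.scale l).hom :=
  (comparison n l M).naturality (p.homL l)

/-- The generators of `target M` indexed by a periodic map. -/
noncomputable def targetGen {m : ℕ+} (p : PeriodicMap (n * l) (m * l)) :
    underlying M ⟶ (target M).obj ⟨m⟩ :=
  unitE M ≫ (eShriek (n * l) M).map p.hom ≫ unitTarget M m

/-- The generators of `source M` indexed by a periodic map. -/
noncomputable def sourceGen {m : ℕ+} (p : PeriodicMap n m) :
    underlying M ⟶ (source M).obj ⟨m⟩ :=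
  unitEL M ≫ (eLShriek n l M).map (p.homL l) ≫ unitPiOf (eLShriek n l M) m

variable {M}

theorem targetGen_shiftSrc {m : ℕ+} (p : PeriodicMap (n * l) (m * l)) (a : ℤ) :
    targetGen M (p.shiftSrc a) = act M a ≫ targetGen M p := by
  rw [targetGen, PeriodicMap.hom_shiftSrc, Functor.map_comp, targetGen,
    ← Category.assoc (act M a), act_unitE]
  simp only [Category.assoc]

theorem sourceGen_shiftSrc {m : ℕ+} (p : PeriodicMap n m) (a : ℤ) :
    sourceGen M (p.shiftSrc a) = act M a ≫ sourceGen M p := by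
  rw [sourceGen, PeriodicMap.homL_shiftSrc, Functor.map_comp, sourceGen,
    ← Category.assoc (act M a), act_unitEL]
  simp only [Category.assoc]

theorem targetGen_shiftTgt {m : ℕ+} (p : PeriodicMap (n * l) (m * l)) (k : ℤ) :
    targetGen M (p.shiftTgt (k * ((m : ℕ) : ℤ))) = targetGen M p := by
  rw [targetGen, PeriodicMap.hom_shiftTgt, Functor.map_comp, Category.assoc, unitTarget_deckShift,
    targetGen]

theorem sourceGen_shiftTgt {m : ℕ+} (p : PeriodicMap n m) (k : ℤ) :
    sourceGen M (p.shiftTgt (k * ((m : ℕ) : ℤ))) = sourceGen M p := by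
  rw [sourceGen, PeriodicMap.homL_shiftTgt, Functor.map_comp, Category.assoc, unitPiOf_deckHom,
    sourceGen]

theorem targetGen_comp {m k : ℕ+} (p : PeriodicMap (n * l) (m * l)) (q : PeriodicMap m k) :
    targetGen M (p.comp (q.scale l)) = targetGen M p ≫ (target M).map q.hom := by
  rw [targetGen, PeriodicMap.hom_comp, Functor.map_comp, targetGen]
  simp only [Category.assoc]
  rw [unitTarget_hom]

theorem sourceGen_comp {m k : ℕ+} (p : PeriodicMap n m) (q : PeriodicMap m k) :
    sourceGen M (p.comp q) = sourceGen M p ≫ (source M).map q.hom := by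
  rw [sourceGen, PeriodicMap.homL_comp, Functor.map_comp, sourceGen]
  simp only [Category.assoc]
  rw [unitPiOf_homL]

theorem sourceGen_comparison {m : ℕ+} (p : PeriodicMap n m) :
    sourceGen M p ≫ ((piShriek A l).map (comparison n l M)).app ⟨m⟩ =
      targetGen M (p.scale l) := by
  rw [sourceGen, targetGen, ← unitEL_comparison]
  simp only [Category.assoc]
  rw [unitPiOf_comparison, ← Category.assoc ((eLShriek n l M).map _), comparison_homL]
  simp only [Category.assoc]

end Generators

/-! ### The universal property of the generators -/

section Descent

variable {A : Type u} [Ring A] {n l : ℕ+}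
  {M : ModuleCat.{u} (MonoidAlgebra A (CyclicGroup (n * l)))}

theorem PeriodicMap.exists_hom_eq {n m : ℕ+} (u : (⟨n⟩ : Cyclic) ⟶ ⟨m⟩) :
    ∃ p : PeriodicMap n m, p.hom = u := by
  obtain ⟨p, hp⟩ := PeriodicMap.exists_toFunctor_eq u.1 u.2
  exact ⟨p, Subtype.ext hp⟩

theorem unitPi_map_g (E : CyclicL l ⥤ ModuleCat.{u} A) {v : CyclicL l} {m : ℕ+}
    (u : v ⟶ CyclicL.of l m) :
    unitPi E v ≫ ((piShriek A l).obj E).map u.g = E.map u ≫ unitPiOf E m :=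
  (unitPi_naturality E u).symm

theorem eShriek_hom_ext {N : ℕ+} {M : ModuleCat.{u} (MonoidAlgebra A (CyclicGroup N))}
    {c : Cyclic} {B : ModuleCat.{u} A} {f g : (eShriek N M).obj c ⟶ B}
    (h : ∀ a : (⟨N⟩ : Cyclic) ⟶ c, unitE M ≫ (eShriek N M).map a ≫ f =
      unitE M ≫ (eShriek N M).map a ≫ g) : f = g :=
  lan_hom_ext (e N) (moduleFunctor M) fun _ a => h a

theorem eLShriek_hom_ext {v : CyclicL l} {B : ModuleCat.{u} A} {f g : (eLShriek n l M).obj v ⟶ B}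
    (h : ∀ a : CyclicL.of l n ⟶ v, unitEL M ≫ (eLShriek n l M).map a ≫ f =
      unitEL M ≫ (eLShriek n l M).map a ≫ g) : f = g :=
  lan_hom_ext (eL n l) (moduleFunctor M) fun _ a => h a

theorem piShriek_hom_ext {E : CyclicL l ⥤ ModuleCat.{u} A} {m : ℕ+} {B : ModuleCat.{u} A}
    {f g : ((piShriek A l).obj E).obj ⟨m⟩ ⟶ B}
    (h : ∀ (v : CyclicL l) (u : v ⟶ CyclicL.of l m), E.map u ≫ unitPiOf E m ≫ f =
      E.map u ≫ unitPiOf E m ≫ g) : f = g := by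
  refine lan_hom_ext (piL l) E fun v a => ?_
  obtain ⟨u, rfl⟩ := exists_homL_lift v a
  have h1 := unitPi_map_g E u
  have key (f : ((piShriek A l).obj E).obj ⟨m⟩ ⟶ B) :
      ((piL l).lanUnit.app E).app v ≫ ((piL l).lan.obj E).map u.g ≫ f =
        E.map u ≫ unitPiOf E m ≫ f :=
    (Category.assoc _ _ _).symm.trans ((congrArg (· ≫ f) h1).trans (Category.assoc _ _ _))
  exact (key f).trans ((h v u).trans (key g).symm)

theorem target_hom_ext {m : ℕ+} {B : ModuleCat.{u} A} {f g : (target M).obj ⟨m⟩ ⟶ B}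
    (h : ∀ p : PeriodicMap (n * l) (m * l), targetGen M p ≫ f = targetGen M p ≫ g) : f = g := by
  have key (c : Cyclic) (x : c ⟶ ⟨m * l⟩) : (eShriek (n * l) M).map x ≫ unitTarget M m ≫ f =
      (eShriek (n * l) M).map x ≫ unitTarget M m ≫ g := by
    refine eShriek_hom_ext fun a => ?_
    obtain ⟨p, hp⟩ := PeriodicMap.exists_hom_eq (a ≫ x)
    have := h p
    rw [targetGen, hp, Functor.map_comp] at this
    simpa only [Category.assoc] using this
  exact piShriek_hom_ext fun v u => key v.src u.f

theorem source_hom_ext {m : ℕ+} {B : ModuleCat.{u} A} {f g : (source M).obj ⟨m⟩ ⟶ B}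
    (h : ∀ p : PeriodicMap n m, sourceGen M p ≫ f = sourceGen M p ≫ g) : f = g := by
  refine piShriek_hom_ext fun v u => ?_
  refine eLShriek_hom_ext fun a => ?_
  obtain ⟨p, hp⟩ := PeriodicMap.exists_homL_eq (a ≫ u)
  have key (f : (source M).obj ⟨m⟩ ⟶ B) :
      unitEL M ≫ (eLShriek n l M).map a ≫ (eLShriek n l M).map u ≫ unitPiOf _ m ≫ f =
        sourceGen M p ≫ f := by
    rw [sourceGen, hp, Functor.map_comp]
    simp only [Category.assoc]
  exact (key f).trans ((h p).trans (key g).symm)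

/-- The behaviour of the generators of `target M` under translations of the value by multiples of
`m` and under translations of the argument gives all relations between them. Indeed a functor
`[nl]_Λ ⥤ [m]_Λ` of degree `l` is a periodic map up to the first kind of translations, so that a
compatible family `β` is a function of such functors, and these index both Kan extensions. -/
theorem exists_target_desc {m : ℕ+} {B : ModuleCat.{u} A}
    (β : PeriodicMap (n * l) (m * l) → (underlying M ⟶ B))
    (hs : ∀ p (k : ℤ), β (p.shiftTgt (k * ((m : ℕ) : ℤ))) = β p)
    (ht : ∀ p (a : ℤ), β (p.shiftSrc a) = act M a ≫ β p) :
    ∃ f : (target M).obj ⟨m⟩ ⟶ B, ∀ p, targetGen M p ≫ f = β p := by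
  let lift {N : ℕ+} (F : {F : Wheel N ⥤ Wheel m // Wheel.HasDegree F (l : ℕ)}) :
    PeriodicMap N (m * l) := (PeriodicMap.exists_lift F.1 F.2).choose
  have lift_spec {N : ℕ+} (F : {F : Wheel N ⥤ Wheel m // Wheel.HasDegree F (l : ℕ)}) :
    (lift F).toFunctor ⋙ Wheel.proj m l = F.1 := (PeriodicMap.exists_lift F.1 F.2).choose_spec
  have hγ (F : {F : Wheel (n * l) ⥤ Wheel m // Wheel.HasDegree F (l : ℕ)})
      (p : PeriodicMap (n * l) (m * l)) (hp : p.toFunctor ⋙ Wheel.proj m l = F.1) :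
      β (lift F) = β p := by
    obtain ⟨k, hk⟩ := PeriodicMap.exists_shiftTgt_of_comp_proj_eq p (lift F)
      (hp.trans (lift_spec F).symm)
    rw [hk, hs]
  -- The values on `(e^{nl}_! M)(c)`, for a functor of degree `l` from `c`.
  have hδ (c : Cyclic) (F : Wheel c.size ⥤ Wheel m) (hF : Wheel.HasDegree F (l : ℕ)) :
      ∃ f : (eShriek (n * l) M).obj c ⟶ B, ∀ a : (⟨n * l⟩ : Cyclic) ⟶ c,
        unitE M ≫ (eShriek (n * l) M).map a ≫ f = β (lift ⟨a.1 ⋙ F, a.2.comp_hasDegree hF⟩) := by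
    obtain ⟨f, hf⟩ := exists_lan_desc (e (n * l)) (moduleFunctor M) c B
      (fun _ a => β (lift ⟨a.1 ⋙ F, a.2.comp_hasDegree hF⟩)) (fun _ _ x a => by
        obtain ⟨k, rfl⟩ : ∃ k, x = residue (n * l) k :=
          (ZMod.intCast_surjective (Multiplicative.toAdd x)).imp fun _ h =>
            congrArg Multiplicative.ofAdd h.symm
        refine (ht _ k).symm.trans (hγ _ _ ?_).symm
        rw [PeriodicMap.shiftSrc_toFunctor, Functor.assoc, lift_spec]
        rfl)
    exact ⟨f, fun a => hf (SingleObj.star _) a⟩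
  choose δ hδ using hδ
  have hδ' {c c' : Cyclic} (x : c ⟶ c') (F : Wheel c'.size ⥤ Wheel m)
      (hF : Wheel.HasDegree F (l : ℕ)) :
      (eShriek (n * l) M).map x ≫ δ c' F hF = δ c (x.1 ⋙ F) (x.2.comp_hasDegree hF) := by
    refine eShriek_hom_ext fun a => ?_
    rw [hδ, ← Category.assoc ((eShriek (n * l) M).map a), ← Functor.map_comp, hδ]
  obtain ⟨f, hf⟩ := exists_lan_desc (piL l) (iL l ⋙ eShriek (n * l) M) ⟨m⟩ B
    (fun v a => δ v.src (v.v ⋙ a.1) (v.degree.comp_horizontal a.2)) (fun v w x a => by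
      refine (hδ' x.f _ _).trans ?_
      have h : x.f.1 ⋙ w.v ⋙ a.1 = v.v ⋙ x.g.1 ⋙ a.1 := congrArg (· ⋙ a.1) x.comm.symm
      have h' (F F' : Wheel v.src.size ⥤ Wheel m) (hF hF') (e : F = F') :
        δ v.src F hF = δ v.src F' hF' := by subst e; rfl
      exact h' _ _ _ _ h)
  let f' : (target M).obj ⟨m⟩ ⟶ B := f
  refine ⟨f', fun p => ?_⟩
  have h1 : unitTarget M m ≫ f' =
      δ ⟨m * l⟩ (Wheel.proj m l) (Wheel.proj_hasDegree m l) :=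
    (congrArg (unitTarget M m ≫ ·)
      ((congrArg (· ≫ f') ((target M).map_id ⟨m⟩)).trans (Category.id_comp f'))).symm.trans
        (hf (CyclicL.of l m) (𝟙 _))
  rw [targetGen, Category.assoc, Category.assoc, h1, hδ]
  exact hγ _ p rfl

end Descent

/-! ### The comparison map is a split monomorphism with acyclic cokernel -/

section Final

open Simplicial AlgebraicTopology

variable {A : Type u} [Ring A] {n l : ℕ+}
  (M : ModuleCat.{u} (MonoidAlgebra A (CyclicGroup (n * l))))

theorem exists_retraction_app (m : ℕ+) : ∃ r : (target M).obj ⟨m⟩ ⟶ (source M).obj ⟨m⟩,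
    ∀ p : PeriodicMap (n * l) (m * l), targetGen M p ≫ r = sourceGen M p.retract :=
  exists_target_desc (fun p => sourceGen M p.retract)
    (fun p k => by rw [PeriodicMap.retract_shiftTgt, sourceGen_shiftTgt])
    (fun p a => by rw [PeriodicMap.retract_shiftSrc, sourceGen_shiftSrc])

/-- The retraction of the comparison map, induced by `PeriodicMap.retract`. -/
noncomputable def retraction : target M ⟶ source M where
  app c := (exists_retraction_app M c.size).choose
  naturality c c' x := by
    obtain ⟨q, rfl⟩ := PeriodicMap.exists_hom_eq x
    refine target_hom_ext fun p => ?_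
    have h := (exists_retraction_app M c.size).choose_spec p
    have h' := (exists_retraction_app M c'.size).choose_spec (p.comp (q.scale l))
    rw [targetGen_comp, PeriodicMap.retract_comp_scale, sourceGen_comp, Category.assoc] at h'
    exact h'.trans ((congrArg (· ≫ (source M).map q.hom) h.symm).trans (Category.assoc _ _ _))

theorem targetGen_retraction {m : ℕ+} (p : PeriodicMap (n * l) (m * l)) :
    targetGen M p ≫ (retraction M).app ⟨m⟩ = sourceGen M p.retract :=
  (exists_retraction_app M m).choose_spec p

theorem comparison_retraction :
    (piShriek A l).map (comparison n l M) ≫ retraction M = 𝟙 (source M) := by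
  refine NatTrans.ext (funext fun c => source_hom_ext (m := c.size) fun p => ?_)
  have h := (Category.assoc _ _ _).symm.trans
    (congrArg (· ≫ (retraction M).app ⟨c.size⟩) (sourceGen_comparison p))
  refine h.trans ((targetGen_retraction M _).trans ?_)
  rw [PeriodicMap.retract_scale]
  exact (Category.comp_id _).symm

/-- The map on the free module on periodic maps with prescribed values on the generators. -/
noncomputable def liftGen {X : Type} {V B : ModuleCat.{u} A} (β : X → (V ⟶ B)) :
    (X →₀ V) →ₗ[A] B :=
  Finsupp.lsum ℕ fun p => (β p).hom

theorem liftGen_single {X : Type} {V B : ModuleCat.{u} A} (β : X → (V ⟶ B)) (p : X) (x : V) :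
    liftGen β (Finsupp.single p x) = β p x := by
  rw [liftGen, Finsupp.lsum_single]

theorem liftGen_surjective {X : Type} {V B : ModuleCat.{u} A} (β : X → (V ⟶ B))
    (h : ∀ {D : ModuleCat.{u} A} {f g : B ⟶ D}, (∀ p, β p ≫ f = β p ≫ g) → f = g) :
    Function.Surjective (liftGen β) := by
  have h0 : ModuleCat.ofHom (LinearMap.range (liftGen β)).mkQ = 0 := h fun p => by
    ext x
    exact ((Submodule.Quotient.mk_eq_zero _).2 ⟨Finsupp.single p x, liftGen_single β p x⟩)
  intro y
  exact (Submodule.Quotient.mk_eq_zero _).1 (ConcreteCategory.congr_hom h0 y)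

/-- The surjection from the chains of `coverSet n l` to the simplicial module
`j^{o*} (target M)`. -/
noncomputable def coverToTarget : coverChains n l (underlying M) ⟶ jo ⋙ target M where
  app a := ModuleCat.ofHom
    (X := PeriodicMap (n * l) (Nat.succPNat a.unop.len * l) →₀ underlying M)
    (Y := (target M).obj ⟨Nat.succPNat a.unop.len⟩) (liftGen fun p => targetGen M p)
  naturality a b f := by
    refine ModuleCat.hom_ext (pushforward_ext fun p x => ?_)
    have h := ConcreteCategory.congr_hom
      (targetGen_comp (M := M) p (PeriodicMap.ofSimplex f.unop).sharp) x
    have h1 : liftGen (fun p => targetGen M p) (pushforward (fun p =>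
        p.comp ((PeriodicMap.ofSimplex f.unop).sharp.scale l)) LinearMap.id (Finsupp.single p x)) =
        targetGen M (p.comp ((PeriodicMap.ofSimplex f.unop).sharp.scale l)) x :=
      (congrArg _ (pushforward_single _ _ p x)).trans (liftGen_single _ _ _)
    have h2 := congrArg ((target M).map (PeriodicMap.ofSimplex f.unop).sharp.hom)
      (liftGen_single (fun p => targetGen M p) p x)
    exact h1.trans (h.trans h2.symm)

theorem act_comm (a b : ℤ) (x : underlying M) : act M a (act M b x) = act M b (act M a x) := by
  have h : act M b ≫ act M a = act M a ≫ act M b := by rw [← act_add, ← act_add, add_comm]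
  exact ConcreteCategory.congr_hom h x

/-- The relations satisfied by the generators of `target M`, modulo the image of `source M`. -/
noncomputable abbrev targetRel (m : ℕ+) :
    Submodule A (PeriodicMap (n * l) (m * l) →₀ underlying M) :=
  deckRel n l m (act M ((n : ℕ) : ℤ)).hom ⊔
    LinearMap.range (rotate (act M 1).hom - LinearMap.id)

theorem targetGen_shiftSrc_neg {m : ℕ+} (p : PeriodicMap (n * l) (m * l)) (a : ℤ)
    (x : underlying M) : targetGen M (p.shiftSrc (-a)) (act M a x) = targetGen M p x := by
  have h : act M a ≫ targetGen M (p.shiftSrc (-a)) = targetGen M p := by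
    rw [targetGen_shiftSrc, ← Category.assoc, ← act_add, add_neg_cancel, act_zero,
      Category.id_comp]
  exact ConcreteCategory.congr_hom h x

theorem targetGen_deck {m : ℕ+} (p : PeriodicMap (n * l) (m * l)) (x : underlying M) :
    targetGen M p.deck (act M ((n : ℕ) : ℤ) x) = targetGen M p x := by
  have h := targetGen_shiftTgt (M := M) (p.shiftSrc (-((n : ℕ) : ℤ))) 1
  rw [one_mul] at h
  rw [PeriodicMap.deck, h]
  exact targetGen_shiftSrc_neg M p _ x

theorem liftGen_scale {m : ℕ+} (z : PeriodicMap n m →₀ underlying M) :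
    liftGen (fun p => targetGen M p) (pushforward (PeriodicMap.scale l) LinearMap.id z) =
      ((piShriek A l).map (comparison n l M)).app ⟨m⟩ (liftGen (fun p => sourceGen M p) z) := by
  refine LinearMap.congr_fun
    (f := liftGen (fun p => targetGen M p) ∘ₗ pushforward (PeriodicMap.scale l) LinearMap.id)
    (g := (((piShriek A l).map (comparison n l M)).app ⟨m⟩).hom ∘ₗ
      liftGen (fun p => sourceGen M p)) (pushforward_ext fun p x => ?_) z
  rw [LinearMap.comp_apply, LinearMap.comp_apply, pushforward_single, liftGen_single,
    liftGen_single]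
  exact (ConcreteCategory.congr_hom (sourceGen_comparison p) x).symm

/-- The relations `targetRel` hold modulo the image of the comparison map. -/
theorem liftGen_mem_range {m : ℕ+} {y : PeriodicMap (n * l) (m * l) →₀ underlying M}
    (hy : y ∈ targetRel M m) : liftGen (fun p => targetGen M p) y ∈
      LinearMap.range (((piShriek A l).map (comparison n l M)).app ⟨m⟩).hom := by
  have h : targetRel M m ≤ (LinearMap.range
      (((piShriek A l).map (comparison n l M)).app ⟨m⟩).hom).comap
        (liftGen fun p => targetGen M p) := by
    have key (f : (PeriodicMap (n * l) (m * l) →₀ underlying M) →ₗ[A] _)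
        (hf : ∀ p x, liftGen (fun p => targetGen M p) (f (Finsupp.single p x)) =
          targetGen M p x) :
        LinearMap.range (f - LinearMap.id) ≤ (LinearMap.range
          (((piShriek A l).map (comparison n l M)).app ⟨m⟩).hom).comap
            (liftGen fun p => targetGen M p) := by
      rintro _ ⟨z, rfl⟩
      have h : liftGen (fun p => targetGen M p) ∘ₗ f = liftGen (fun p => targetGen M p) :=
        pushforward_ext fun p x => (hf p x).trans (liftGen_single _ p x).symm
      refine ⟨0, ?_⟩
      rw [map_zero, LinearMap.sub_apply, map_sub]
      exact (sub_eq_zero.2 (LinearMap.congr_fun h z)).symm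
    refine sup_le (sup_le (key _ fun p x => ?_) ?_) (key _ fun p x => ?_)
    · rw [pushforward_single, liftGen_single]
      exact targetGen_deck M p x
    · rintro _ ⟨z, rfl⟩
      exact ⟨_, (liftGen_scale M z).symm⟩
    · rw [rotate, pushforward_single, liftGen_single]
      exact targetGen_shiftSrc_neg M p 1 x
  exact h hy

theorem shiftSrc_of_shiftSrc_one {N K : ℕ+} {M : ModuleCat.{u} (MonoidAlgebra A (CyclicGroup N))}
    {B : ModuleCat.{u} A} {β : PeriodicMap N K → (underlying M ⟶ B)}
    (h : ∀ p, β (p.shiftSrc 1) = act M 1 ≫ β p) (p : PeriodicMap N K) (a : ℤ) :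
    β (p.shiftSrc a) = act M a ≫ β p := by
  induction a using Int.induction_on with
  | zero => rw [PeriodicMap.shiftSrc_zero, act_zero, Category.id_comp]
  | succ i ih =>
    rw [add_comm, ← PeriodicMap.shiftSrc_shiftSrc p (i : ℤ) 1, h, ih, act_add, Category.assoc]
  | pred i ih =>
    have h1 := h (p.shiftSrc (-(i : ℤ) - 1))
    rw [PeriodicMap.shiftSrc_shiftSrc, add_sub_cancel, ih] at h1
    have h2 : act M (-(i : ℤ) - 1) = act M (-1) ≫ act M (-(i : ℤ)) := by
      rw [← act_add, neg_add_eq_sub]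
    rw [h2, Category.assoc, h1, ← Category.assoc, ← act_add, neg_add_cancel, act_zero,
      Category.id_comp]

theorem shiftTgt_mul_of_shiftTgt {N K : ℕ+} {X : Type*} {β : PeriodicMap N K → X} {m : ℤ}
    (h : ∀ p, β (p.shiftTgt m) = β p) (p : PeriodicMap N K) (k : ℤ) :
    β (p.shiftTgt (k * m)) = β p := by
  induction k using Int.induction_on with
  | zero => rw [zero_mul, PeriodicMap.shiftTgt_zero]
  | succ i ih => rw [add_mul, one_mul, ← PeriodicMap.shiftTgt_shiftTgt p (i * m) m, h, ih]
  | pred i ih =>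
    rw [← h (p.shiftTgt ((-(i : ℤ) - 1) * m)), PeriodicMap.shiftTgt_shiftTgt, sub_mul, one_mul,
      sub_add_cancel, ih]

/-- The class of a generator in a quotient of a free module on periodic maps. -/
noncomputable def quotGen {X : Type} {V : ModuleCat.{u} A} (P : Submodule A (X →₀ V)) (p : X) :
    V ⟶ ModuleCat.of A ((X →₀ V) ⧸ P) :=
  ModuleCat.ofHom (P.mkQ ∘ₗ Finsupp.lsingle p)

theorem comp_quotGen {X : Type} {V : ModuleCat.{u} A} {P : Submodule A (X →₀ V)} {p q : X}
    {g : V ⟶ V} (h : ∀ x, Finsupp.single p (g x) - Finsupp.single q x ∈ P) :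
    g ≫ quotGen P p = quotGen P q :=
  ModuleCat.hom_ext (LinearMap.ext fun x => (Submodule.Quotient.eq _).2 (h x))

/-- All relations between the generators modulo the image of the comparison map are in
`targetRel`. -/
theorem mem_targetRel {m : ℕ+} {y : PeriodicMap (n * l) (m * l) →₀ underlying M}
    (hy : liftGen (fun p => targetGen M p) y ∈
      LinearMap.range (((piShriek A l).map (comparison n l M)).app ⟨m⟩).hom) :
    y ∈ targetRel M m := by
  -- The classes of the generators modulo `targetRel` factor through `target M`.
  let β (p : PeriodicMap (n * l) (m * l)) := quotGen (V := underlying M) (targetRel M m) p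
  have ht (p) (a : ℤ) : β (p.shiftSrc a) = act M a ≫ β p := by
    refine shiftSrc_of_shiftSrc_one (fun p => ?_) p a
    refine (comp_quotGen (P := targetRel M m) fun x =>
      Submodule.mem_sup_right ⟨Finsupp.single (p.shiftSrc 1) x, ?_⟩).symm
    rw [LinearMap.sub_apply, rotate, pushforward_single, PeriodicMap.shiftSrc_shiftSrc,
      neg_add_cancel, PeriodicMap.shiftSrc_zero]
    rfl
  have hs1 (p : PeriodicMap (n * l) (m * l)) : β (p.shiftTgt ((m : ℕ) : ℤ)) = β p := by
    have h := ht (p.shiftTgt ((m : ℕ) : ℤ)) (-((n : ℕ) : ℤ))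
    have h' : act M ((n : ℕ) : ℤ) ≫ β p.deck = β p :=
      comp_quotGen (P := targetRel M m) fun x => Submodule.mem_sup_left (Submodule.mem_sup_left
        ⟨Finsupp.single p x, by rw [LinearMap.sub_apply, pushforward_single]; rfl⟩)
    have h'' : β p.deck = act M (-((n : ℕ) : ℤ)) ≫ β (p.shiftTgt ((m : ℕ) : ℤ)) := h
    rw [← h', h'', ← Category.assoc, ← act_add, add_neg_cancel, act_zero, Category.id_comp]
  have hs (p) (k : ℤ) : β (p.shiftTgt (k * ((m : ℕ) : ℤ))) = β p :=
    shiftTgt_mul_of_shiftTgt hs1 p k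
  obtain ⟨f, hf⟩ := exists_target_desc β hs ht
  have hmk : f.hom ∘ₗ liftGen (fun p => targetGen M p) = (targetRel M m).mkQ :=
    pushforward_ext fun p x => (congrArg f (liftGen_single _ p x)).trans
      (ConcreteCategory.congr_hom (hf p) x)
  obtain ⟨x, hx⟩ := hy
  obtain ⟨z, rfl⟩ := liftGen_surjective (fun p => sourceGen M p) source_hom_ext x
  have h0 : (targetRel M m).mkQ y =
      (targetRel M m).mkQ (pushforward (PeriodicMap.scale l) LinearMap.id z) := by
    rw [← hmk]
    exact congrArg f (hx.symm.trans (liftGen_scale M z).symm)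
  have h1 := (Submodule.Quotient.eq _).1 h0
  have h2 : pushforward (PeriodicMap.scale l) LinearMap.id z ∈ targetRel M m :=
    Submodule.mem_sup_left (Submodule.mem_sup_right ⟨z, rfl⟩)
  exact (Submodule.sub_mem_iff_left _ h2).1 h1

theorem whiskerLeft_comparison_retraction :
    Functor.whiskerLeft jo ((piShriek A l).map (comparison n l M)) ≫
      Functor.whiskerLeft jo (retraction M) = 𝟙 (jo ⋙ source M) := by
  rw [← Functor.whiskerLeft_comp, comparison_retraction, Functor.whiskerLeft_id']

theorem isZero_homology_cokernel (i : ℕ) :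
    IsZero ((categoryHomology SimplexCategoryᵒᵖ A i).obj
      (cokernel (Functor.whiskerLeft jo ((piShriek A l).map (comparison n l M))))) := by
  let φ := Functor.whiskerLeft jo ((piShriek A l).map (comparison n l M))
  let ρ := Functor.whiskerLeft jo (retraction M)
  have hφ : φ ≫ ρ = 𝟙 _ := whiskerLeft_comparison_retraction M
  have hπ (a : SimplexCategoryᵒᵖ) : Function.Surjective ((cokernel.π φ).app a) := by
    rw [← ModuleCat.epi_iff_surjective]
    infer_instance
  have hker (a : SimplexCategoryᵒᵖ) (y : (jo ⋙ target M).obj a) :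
      (cokernel.π φ).app a y = 0 ↔ y ∈ LinearMap.range (φ.app a).hom := by
    constructor
    · intro hy
      -- `1 - φ ρ` factors through the cokernel.
      have h0 : φ ≫ (𝟙 _ - ρ ≫ φ) = 0 := by
        rw [Preadditive.comp_sub, Category.comp_id, ← Category.assoc, hφ, Category.id_comp,
          sub_self]
      have h1 : cokernel.π φ ≫ cokernel.desc φ _ h0 = 𝟙 _ - ρ ≫ φ := cokernel.π_desc _ _ _
      have h2 := ConcreteCategory.congr_hom (congrArg (fun z => z.app a) h1) y
      have h3 : (cokernel.desc φ _ h0).app a ((cokernel.π φ).app a y) =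
          y - φ.app a (ρ.app a y) := h2
      rw [hy, map_zero] at h3
      exact ⟨ρ.app a y, (sub_eq_zero.1 h3.symm).symm⟩
    · rintro ⟨x, rfl⟩
      exact ConcreteCategory.congr_hom (congrArg (fun z => z.app a) (cokernel.condition φ)) x
  refine isZero_categoryHomology _ (exactAt_of_surjective (n := n) (l := l)
    (σ := (act M ((n : ℕ) : ℤ)).hom) (τ := (act M 1).hom) (act_comm M _ _)
    (coverToTarget M ≫ cokernel.π φ) (fun k => ?_) (fun k y => ?_)) i
  · exact (hπ (op ⦋k⦌)).comp (liftGen_surjective (fun p => targetGen M p) target_hom_ext)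
  · exact (hker _ _).trans ⟨fun h => mem_targetRel M h, fun h => liftGen_mem_range M h⟩

end Final

end HochschildWitt

theorem proposition1 {A : Type u} [Ring A] (n l : ℕ+)
    (M : ModuleCat.{u} (MonoidAlgebra A (HochschildWitt.CyclicGroup (n * l)))) (i : ℕ) :
    IsIso ((HochschildWitt.HH A i).map
      ((HochschildWitt.piShriek A l).map (HochschildWitt.comparison n l M))) := by
  have : (HochschildWitt.categoryHomology SimplexCategoryᵒᵖ A i).Additive :=
    HochschildWitt.leftDerived_additive _ i
  exact HochschildWitt.isIso_map_of_retraction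
    (HochschildWitt.categoryHomology SimplexCategoryᵒᵖ A i) _ _
    (HochschildWitt.whiskerLeft_comparison_retraction M)
    (HochschildWitt.isZero_homology_cokernel M i)
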